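/- **Setting.** Fix an input dimension $d\ge 2$, constants $c>0$ and $\beta\in\mathbb{R}$, and a variance $V\in(0,1)$. Let $\varphi,\Phi$ be the standard Gaussian density and distribution function, let $\tilde\varsigma=\sqrt{\tfrac cd(1-V)}$, and let $\tilde\psi(\nu)=\tilde\varsigma\,\varphi(\nu/\tilde\varsigma)+\nu\,\Phi(\nu/\tilde\varsigma)$. The quasi neural network of widths $d_1,d_2$ associated with the two-layer ReLU network with stochastically quantized binary first-layer weights is $$x_{1,i}=\tfrac1{\sqrt d}\sum_{k=1}^d w_{0,ki}x_k+b_{0,i},\qquad \nu_{1,j}=\sqrt{\tfrac c{d_1}}\sum_{i=1}^{d_1}\theta_{1,ij}x_{1,i}+\beta b_{1,j},\qquad \bar y=\tfrac1{\sqrt{d_2}}\sum_{j=1}^{d_2}w_{2,j}\tilde\psi(\nu_{1,j})+\beta b_2 ,$$ and its neural tangent kernel is $$\mathcal K_{d_1,d_2}(x,x')=\sum_{i,j}\frac{\partial\bar y(x)}{\partial\theta_{1,ij}}\frac{\partial\bar y(x')}{\partial\theta_{1,ij}}+\sum_j\frac{\partial\bar y(x)}{\partial b_{1,j}}\frac{\partial\bar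 y(x')}{\partial b_{1,j}}+\sum_j\frac{\partial\bar y(x)}{\partial w_{2,j}}\frac{\partial\bar y(x')}{\partial w_{2,j}} .$$ At initialization all weights are mutually independent, $w_{0,ki},w_{2,j}\sim\mathcal N(0,1)$, the $\theta_{1,ij}$ are identically distributed on $[-1,1]$ with mean $0$ and variance $V$, and all biases are $0$. For $k\ge 0$ let $N(d,k)$ be the dimension of the space of spherical harmonics of order $k$ on $\mathbb S^{d-1}$ (restrictions of harmonic homogeneous polynomials of degree $k$), and let $Y_{k,1},\dots,Y_{k,N(d,k)}$ be any basis of it that is orthonormal for the uniform probability measure on $\mathbb S^{d-1}$. **Theorem.** There is a constant $C>1$ depending only on $V$ such that for every $d\ge2$ there is a threshold $K$ (depending on $d$ and $V$) with the following property. For all $c>0$ and $\beta\in\mathbb R$ there are a kernel $\mathcal K_{BWNN}$ on $\mathbb S^{d-1}$ and numbers $u_k\ge 0$ ($k\ge0$), depending only on $d,V,c,\beta$, such that: 1. for all $x,x'\in\mathbb S^{d-1}$, $\mathcal K_{d_1,d_2}(x,x')\to\mathcal K_{BWNN}(x,x')$ in probability as $d_1,d_2\to\infty$ (at initialization); 2.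 for all $x,x'\in\mathbb S^{d-1}$, $$\mathcal K_{BWNN}(x,x')=\sum_{k=0}^\infty u_k\sum_{j=1}^{N(d,k)}Y_{k,j}(x)Y_{k,j}(x');$$ 3. there are real constants $a_1,a_2>0$ and $p_1,p_2$ (depending on $d,V,c,\beta$) such that for all $k\ge K$ we have $u_k\le a_2k^{p_2}C^{-k}$ and, if $\beta\neq0$, also $a_1k^{p_1}C^{-k}\le u_k$. -/

import Mathlib

open MeasureTheory ProbabilityTheory Filter Topology

noncomputable section

namespace QuasiNN

/-! ### The quasi neural network and its neural tangent kernel at finite width -/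

/-- The limiting conditional standard deviation of a pre-activation of the binary weight network,
`ς² = (c / d) (1 - Var θ)`. -/
def condStd (d : ℕ) (c V : ℝ) : ℝ := Real.sqrt (c / d * (1 - V))

/-- The activation of the quasi neural network: `ς φ(ν/ς) + ν Φ(ν/ς)`, where `φ` and `Φ` are the
density and the distribution function of the standard Gaussian law. -/
def quasiAct (ς ν : ℝ) : ℝ :=
  ς * gaussianPDFReal 0 1 (ν / ς) + ν * cdf (gaussianReal 0 1) (ν / ς)

/-- All the real parameters of a quasi neural network with input dimension `d` and widths
`d₁`, `d₂`. -/
structure Params (d d₁ d₂ : ℕ) where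
  w₀ : Fin d → Fin d₁ → ℝ
  b₀ : Fin d₁ → ℝ
  θ : Fin d₁ → Fin d₂ → ℝ
  b₁ : Fin d₂ → ℝ
  w₂ : Fin d₂ → ℝ
  b₂ : ℝ

/-- The output `x₁` of the fixed additional layer. -/
def layerOne {d d₁ d₂ : ℕ} (p : Params d d₁ d₂) (x : EuclideanSpace ℝ (Fin d)) (i : Fin d₁) : ℝ :=
  1 / Real.sqrt d * ∑ k, p.w₀ k i * x k + p.b₀ i

/-- The conditional mean `ν₁` of the pre-activation. -/
def preAct {d d₁ d₂ : ℕ} (c β : ℝ) (p : Params d d₁ d₂) (x : EuclideanSpace ℝ (Fin d))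
    (j : Fin d₂) : ℝ :=
  Real.sqrt (c / d₁) * ∑ i, p.θ i j * layerOne p x i + β * p.b₁ j

/-- The output of the quasi neural network, whose activation has parameter `ς`. -/
def output {d d₁ d₂ : ℕ} (c β ς : ℝ) (p : Params d d₁ d₂) (x : EuclideanSpace ℝ (Fin d)) : ℝ :=
  1 / Real.sqrt d₂ * ∑ j, p.w₂ j * quasiAct ς (preAct c β p x j) + β * p.b₂

/-- Partial derivative of the output in `θ i j`. -/
def dθ {d d₁ d₂ : ℕ} (c β ς : ℝ) (p : Params d d₁ d₂) (x : EuclideanSpace ℝ (Fin d))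
    (i : Fin d₁) (j : Fin d₂) : ℝ :=
  deriv (fun s : ℝ =>
    output c β ς { p with θ := Function.update p.θ i (Function.update (p.θ i) j s) } x) (p.θ i j)

/-- Partial derivative of the output in `b₁ j`. -/
def db₁ {d d₁ d₂ : ℕ} (c β ς : ℝ) (p : Params d d₁ d₂) (x : EuclideanSpace ℝ (Fin d))
    (j : Fin d₂) : ℝ :=
  deriv (fun s : ℝ => output c β ς { p with b₁ := Function.update p.b₁ j s } x) (p.b₁ j)

/-- Partial derivative of the output in `w₂ j`. -/
def dw₂ {d d₁ d₂ : ℕ} (c β ς : ℝ) (p : Params d d₁ d₂) (x : EuclideanSpace ℝ (Fin d))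
    (j : Fin d₂) : ℝ :=
  deriv (fun s : ℝ => output c β ς { p with w₂ := Function.update p.w₂ j s } x) (p.w₂ j)

/-- The neural tangent kernel at the parameters `p`, with trainable `θ`, `b₁`, `w₂`
(the constant contribution of `b₂` is omitted). -/
def ntk {d d₁ d₂ : ℕ} (c β ς : ℝ) (p : Params d d₁ d₂) (x x' : EuclideanSpace ℝ (Fin d)) : ℝ :=
  ∑ i, ∑ j, dθ c β ς p x i j * dθ c β ς p x' i j
    + ∑ j, db₁ c β ς p x j * db₁ c β ς p x' j
    + ∑ j, dw₂ c β ς p x j * dw₂ c β ς p x' j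

/-! ### Random initialization -/

/-- The law of the initial weights: all entries are mutually independent, the entries of `w₀` and
`w₂` are standard Gaussian, and the entries of `θ` are identically distributed on `[-1, 1]`, centred,
with variance `V`. The networks of all widths use the top left corners of these infinite arrays. -/
structure IsRandomInit {Ω : Type*} [MeasurableSpace Ω] (P : Measure Ω) (V : ℝ) {d : ℕ}
    (w₀ : Fin d → ℕ → Ω → ℝ) (θ : ℕ → ℕ → Ω → ℝ) (w₂ : ℕ → Ω → ℝ) : Prop where
  w₀_law : ∀ k i, HasLaw (w₀ k i) (gaussianReal 0 1) P
  w₂_law : ∀ j, HasLaw (w₂ j) (gaussianReal 0 1) P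
  θ_ident : ∀ i j, IdentDistrib (θ i j) (θ 0 0) P P
  θ_mem : ∀ i j, ∀ᵐ ω ∂P, θ i j ω ∈ Set.Icc (-1 : ℝ) 1
  θ_mean : ∀ i j, ∫ ω, θ i j ω ∂P = 0
  θ_var : ∀ i j, variance (θ i j) P = V
  indep : iIndepFun
    (Sum.elim (fun q : Fin d × ℕ => w₀ q.1 q.2)
      (Sum.elim (fun q : ℕ × ℕ => θ q.1 q.2) (fun j : ℕ => w₂ j))) P

/-- The initial parameters at widths `d₁`, `d₂`: random weights and zero biases. -/
def initParams {Ω : Type*} {d : ℕ} (w₀ : Fin d → ℕ → Ω → ℝ) (θ : ℕ → ℕ → Ω → ℝ)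
    (w₂ : ℕ → Ω → ℝ) (d₁ d₂ : ℕ) (ω : Ω) : Params d d₁ d₂ where
  w₀ := fun k i => w₀ k i ω
  b₀ := fun _ => 0
  θ := fun i j => θ i j ω
  b₁ := fun _ => 0
  w₂ := fun j => w₂ j ω
  b₂ := 0

/-! ### Spherical harmonics -/

/-- The unit sphere of `ℝᵈ`. -/
abbrev Sph (d : ℕ) : Type := Metric.sphere (0 : EuclideanSpace ℝ (Fin d)) 1

/-- The Laplacian on polynomials in `d` variables. -/
def laplacian (d : ℕ) : MvPolynomial (Fin d) ℝ →ₗ[ℝ] MvPolynomial (Fin d) ℝ :=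
  ∑ i, (MvPolynomial.pderiv i).toLinearMap ∘ₗ (MvPolynomial.pderiv i).toLinearMap

/-- Restriction of polynomials to the unit sphere. -/
def restrictToSphere (d : ℕ) : MvPolynomial (Fin d) ℝ →ₗ[ℝ] (Sph d → ℝ) where
  toFun p := fun x => MvPolynomial.eval (fun i => x.1 i) p
  map_add' p q := by ext x; simp
  map_smul' a p := by ext x; simp [MvPolynomial.smul_eval]

/-- Spherical harmonics of order `k`: restrictions to the unit sphere of the harmonic homogeneous
polynomials of degree `k`. -/
def sphericalHarmonics (d k : ℕ) : Submodule ℝ (Sph d → ℝ) :=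
  (MvPolynomial.homogeneousSubmodule (Fin d) ℝ k ⊓ LinearMap.ker (laplacian d)).map
    (restrictToSphere d)

/-- The number `N(d, k)` of linearly independent spherical harmonics of order `k`. -/
def numHarmonics (d k : ℕ) : ℕ := Module.finrank ℝ (sphericalHarmonics d k)

/-- For every `k`, the functions `Y k j` form a basis of the spherical harmonics of order `k` which is
orthonormal for the uniform probability measure on the sphere. (They are `N(d, k)` many, so
orthonormality makes them a basis.) -/
structure IsHarmonicBasis (d : ℕ) (Y : (k : ℕ) → Fin (numHarmonics d k) → Sph d → ℝ) : Prop where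
  mem : ∀ k j, Y k j ∈ sphericalHarmonics d k
  orthonormal : ∀ k i j,
    ⨍ x, Y k i x * Y k j x ∂((volume : Measure (EuclideanSpace ℝ (Fin d))).toSphere)
      = if i = j then 1 else 0

end QuasiNN

end

/-!
The proof has two halves: the infinite-width limit of the neural tangent kernel is computed in
closed form, and the eigenvalues of that closed form are compared with sums over lattice paths.

**The limit.** Writing out the derivatives (`ntk_eq`) turns the kernel at initialization into
`(c A + β²) B + D`, where `A` averages products of the features over the first layer and `B` and
`D` average, over the second layer, products of the derivative of the activation (weighted by the
squares of the output weights) and of the activation itself. `A` converges to `⟨x, x'⟩ / d` by the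
strong law of large numbers. The summands of `B` and `D` change with the first width and are
dependent, because all neurons share their features. However, they are exchangeable, and by the
central limit theorem with the Cramér–Wold device (`tendsto_integral_field`) the pre-activations of
two distinct neurons are asymptotically independent; so the variance of an average tends to zero as
both widths grow (`tendstoInMeasure_average`), in whatever manner. The unbounded activation is
truncated.

The activation is the mean of a ramp over an additional Gaussian noise of variance
`(c / d) (1 - V)` (`quasiAct_eq_integral`). At two points with inner product `t` the limiting
pre-activations have variance `(c / d) V` and correlation `t`; with the independent noises added,
the variance is `c / d` and the correlation `V t`. Hence `B` and `D` converge to arc-cosine kernels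
at `V t`, and the limit is
`limitKernel d c β V t = (c t / d + β²) arcKernel0 (V t) + (c / d) arcKernel1 (V t)`.

**The eigenvalues.** All Taylor coefficients `g n` of the limit are nonnegative and lie between
`V ^ n / (n + 1)²` and `V ^ n`, up to constants (the lower bound needs `β ≠ 0`). By the Funk–Hecke
formula, `⟨x, y⟩ ^ n` acts on the spherical harmonics of order `k` by a scalar, which vanishes
unless `n = k + 2 j` and is then `(n choose j) / 2 ^ n` up to powers of `k + j`
(`powEigenvalue_add_two_mul`). The formula is proved for the Gaussian weight in place of the
sphere, where integration by parts yields a recursion; on homogeneous polynomials the two averages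
differ by a radial factor. Summation over `n` gives the Mercer decomposition, with eigenvalues
comparable to `∑ⱼ (k + 2 j choose j) (V / 2) ^ (k + 2 j)` up to powers of `k`: in the lower bound,
the terms with `j` larger than a multiple of `k` are negligible (`exists_half_pathSum_le_sum`). By
Pascal's rule this sum solves a linear recursion in `k` and, being bounded, is a multiple of
`r ^ k` for the root `r < 1` of `r = (V / 2) (1 + r²)` (`pathSum_eq`). So `C = 1 / r`, which
depends on `V` only.
-/

noncomputable section

namespace QuasiNN

/-! ### Exponential decay of lattice path sums -/

/-- The sum `∑ⱼ (k + 2j choose j) x ^ (k + 2j)`, which counts with weight `x ^ length` the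
`±1` lattice paths from `0` to `k`. -/
def pathSum (x : ℝ) (k : ℕ) : ℝ := ∑' j : ℕ, ((k + 2 * j).choose j : ℝ) * x ^ (k + 2 * j)

lemma choose_mul_pow_le {x : ℝ} (hx : 0 ≤ x) (n j : ℕ) :
    (n.choose j : ℝ) * x ^ n ≤ (2 * x) ^ n := by
  rw [mul_pow]
  gcongr
  exact_mod_cast Nat.choose_le_two_pow n j

lemma summable_two_mul_pow {x : ℝ} (hx : 0 ≤ x) (hx' : x < 1 / 2) (k : ℕ) :
    Summable fun j : ℕ => (2 * x) ^ (k + 2 * j) := by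
  simp_rw [pow_add, pow_mul]
  exact (summable_geometric_of_lt_one (by positivity) (by nlinarith)).mul_left _

lemma summable_pathSum {x : ℝ} (hx : 0 ≤ x) (hx' : x < 1 / 2) (k : ℕ) :
    Summable fun j : ℕ => ((k + 2 * j).choose j : ℝ) * x ^ (k + 2 * j) :=
  .of_nonneg_of_le (fun j => by positivity) (fun j => choose_mul_pow_le hx _ _)
    (summable_two_mul_pow hx hx' k)

lemma pathSum_nonneg {x : ℝ} (hx : 0 ≤ x) (k : ℕ) : 0 ≤ pathSum x k :=
  tsum_nonneg fun j => by positivity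

lemma pathSum_zero_pos {x : ℝ} (hx : 0 ≤ x) (hx' : x < 1 / 2) : 0 < pathSum x 0 :=
  (summable_pathSum hx hx' 0).tsum_pos (fun j => by positivity) 0 (by simp)

lemma pathSum_bounded {x : ℝ} (hx : 0 ≤ x) (hx' : x < 1 / 2) :
    ∃ B : ℝ, ∀ k, pathSum x k ≤ B := by
  refine ⟨∑' j : ℕ, (2 * x) ^ (0 + 2 * j), fun k => ?_⟩
  refine (summable_pathSum hx hx' k).tsum_le_tsum (fun j => ?_) (summable_two_mul_pow hx hx' 0)
  exact (choose_mul_pow_le hx _ _).trans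
    (pow_le_pow_of_le_one (by positivity) (by linarith) (by omega))

/-- Splitting a lattice path at its last step (Pascal's rule). -/
lemma pathSum_succ {x : ℝ} (hx : 0 ≤ x) (hx' : x < 1 / 2) (k : ℕ) :
    pathSum x (k + 1) = x * (pathSum x k + pathSum x (k + 2)) := by
  have h0 := summable_pathSum hx hx' k
  have h1 := summable_pathSum hx hx' (k + 1)
  have h2 := summable_pathSum hx hx' (k + 2)
  unfold pathSum
  rw [h1.tsum_eq_zero_add, h0.tsum_eq_zero_add,
    add_assoc (((k + 2 * 0).choose 0 : ℝ) * x ^ (k + 2 * 0)),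
    ← ((summable_nat_add_iff 1).2 h0).tsum_add h2, mul_add, ← tsum_mul_left]
  congr 1
  · simp [pow_succ, mul_comm]
  · refine tsum_congr fun j => ?_
    have e1 : k + 1 + 2 * (j + 1) = (k + 2 * (j + 1)) + 1 := by ring
    have e2 : k + 2 + 2 * j = k + 2 * (j + 1) := by ring
    rw [e1, e2, Nat.choose_succ_succ]
    push_cast
    ring

/-- The exponential rate of decay of the eigenvalues: the smaller root of `r = (V / 2) (1 + r²)`. -/
def decayRate (V : ℝ) : ℝ := (1 - √(1 - V ^ 2)) / V

lemma decayRate_eq {V : ℝ} (h0 : 0 < V) (h1 : V < 1) :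
    decayRate V = V / 2 * (1 + decayRate V ^ 2) := by
  have h : √(1 - V ^ 2) ^ 2 = 1 - V ^ 2 := Real.sq_sqrt (by nlinarith)
  unfold decayRate
  field_simp
  linear_combination -h

lemma decayRate_pos {V : ℝ} (h0 : 0 < V) : 0 < decayRate V := by
  have : √(1 - V ^ 2) < 1 := by rw [Real.sqrt_lt' one_pos]; nlinarith
  exact div_pos (by linarith) h0

lemma decayRate_lt_one {V : ℝ} (h0 : 0 < V) (h1 : V < 1) : decayRate V < 1 := by
  have : 1 - V < √(1 - V ^ 2) := by rw [Real.lt_sqrt (by linarith)]; nlinarith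
  rw [decayRate, div_lt_one h0]; linarith

/-- Up to scaling, the path sums form the only bounded solution of their recursion. -/
lemma pathSum_eq {V : ℝ} (h0 : 0 < V) (h1 : V < 1) (k : ℕ) :
    pathSum (V / 2) k = pathSum (V / 2) 0 * decayRate V ^ k := by
  set r := decayRate V with hr
  have hr0 : 0 < r := decayRate_pos h0
  have hr1 : r < 1 := decayRate_lt_one h0 h1
  have hre : r = V / 2 * (1 + r ^ 2) := decayRate_eq h0 h1
  have hx : 0 ≤ V / 2 := by positivity
  have hx' : V / 2 < 1 / 2 := by linarith
  -- The defect `S (k + 1) - r S k` is multiplied by `1 / r > 1` in each step, so it vanishes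
  have hT : ∀ k, pathSum (V / 2) 1 - r * pathSum (V / 2) 0
      = r ^ k * (pathSum (V / 2) (k + 1) - r * pathSum (V / 2) k) := by
    intro k
    induction k with
    | zero => simp
    | succ k ih =>
      rw [ih, pow_succ, mul_assoc]
      congr 1
      have := pathSum_succ hx hx' k
      have hV : V / 2 ≠ 0 := by positivity
      apply mul_left_cancel₀ hV
      linear_combination -(pathSum (V / 2) (k + 1)) * hre + r * this
  obtain ⟨B, hB⟩ := pathSum_bounded hx hx'
  have hlim : pathSum (V / 2) 1 - r * pathSum (V / 2) 0 = 0 := by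
    have hB0 : 0 ≤ B := (pathSum_nonneg hx 0).trans (hB 0)
    have : Tendsto (fun k : ℕ => r ^ k * (2 * B)) atTop (𝓝 0) := by
      simpa using (tendsto_pow_atTop_nhds_zero_of_lt_one hr0.le hr1).mul_const (2 * B)
    refine abs_nonpos_iff.1 (ge_of_tendsto' this fun k => ?_)
    rw [hT k, abs_mul, abs_of_pos (pow_pos hr0 k)]
    gcongr
    have p1 := pathSum_nonneg hx (k + 1)
    have p2 := pathSum_nonneg hx k
    have q1 := hB (k + 1)
    have q2 := hB k
    rw [abs_le]
    constructor <;> nlinarith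
  induction k with
  | zero => simp
  | succ k ih =>
    have := hT k
    rw [hlim, eq_comm, mul_eq_zero] at this
    have h3 := this.resolve_left (pow_pos hr0 k).ne'
    rw [pow_succ, ← mul_assoc, ← ih]
    linarith

/-- Half of the path sum comes from paths whose length is at most linear in `k`: the remaining
paths are compared with the path sum for a larger weight. -/
lemma exists_half_pathSum_le_sum {V : ℝ} (h0 : 0 < V) (h1 : V < 1) :
    ∃ M K : ℕ, ∀ k, K ≤ k → pathSum (V / 2) 0 / 2 * decayRate V ^ k ≤
      ∑ j ∈ Finset.range (M * k), ((k + 2 * j).choose j : ℝ) * (V / 2) ^ (k + 2 * j) := by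
  -- The terms with `j ≥ M k` are at most `(V / W) ^ (M k)` times those for the weight `W / 2`, and
  -- `M` and `K` are such that the resulting bound is half of the path sum.
  obtain ⟨W, hVW, hW1⟩ := exists_between h1
  have hW0 : 0 < W := h0.trans hVW
  set q := V / W with hq
  have hq0 : 0 < q := div_pos h0 hW0
  have hq1 : q < 1 := (div_lt_one hW0).2 hVW
  have hr0 := decayRate_pos h0
  have hR0 := decayRate_pos hW0
  have hS0 := pathSum_zero_pos (x := V / 2) (by positivity) (by linarith)
  have hT0 := pathSum_zero_pos (x := W / 2) (by positivity) (by linarith)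
  obtain ⟨M, hM⟩ : ∃ M : ℕ, q ^ M < decayRate V / 2 / decayRate W :=
    exists_pow_lt_of_lt_one (by positivity) hq1
  have hM' : q ^ M * decayRate W ≤ decayRate V / 2 := ((lt_div_iff₀ hR0).1 hM).le
  obtain ⟨K, hK⟩ : ∃ K : ℕ, (1 / 2 : ℝ) ^ K < pathSum (V / 2) 0 / 2 / pathSum (W / 2) 0 :=
    exists_pow_lt_of_lt_one (by positivity) (by norm_num)
  refine ⟨M, K, fun k hk => ?_⟩
  have hsum := summable_pathSum (x := V / 2) (by positivity) (by linarith) k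
  have hsumW := summable_pathSum (x := W / 2) (by positivity) (by linarith) k
  have hsplit := hsum.sum_add_tsum_nat_add (M * k)
  have htail : ∑' j, ((k + 2 * (j + M * k)).choose (j + M * k) : ℝ)
      * (V / 2) ^ (k + 2 * (j + M * k)) ≤ q ^ (M * k) * pathSum (W / 2) k := by
    calc _ ≤ ∑' j, q ^ (M * k) * (((k + 2 * (j + M * k)).choose (j + M * k) : ℝ)
      * (W / 2) ^ (k + 2 * (j + M * k))) := by
          refine ((summable_nat_add_iff (M * k)).2 hsum).tsum_le_tsum (fun j => ?_)
            (((summable_nat_add_iff (M * k)).2 hsumW).mul_left _)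
          have : V / 2 = q * (W / 2) := by rw [hq]; field_simp
          rw [this, mul_pow, mul_left_comm]
          have : q ^ (k + 2 * (j + M * k)) ≤ q ^ (M * k) :=
            pow_le_pow_of_le_one hq0.le hq1.le (by omega)
          gcongr
      _ ≤ _ := by
          rw [tsum_mul_left]
          gcongr
          rw [pathSum, ← hsumW.sum_add_tsum_nat_add (M * k)]
          exact le_add_of_nonneg_left (Finset.sum_nonneg fun j _ => by positivity)
  have h2 : q ^ (M * k) * pathSum (W / 2) k ≤ pathSum (V / 2) 0 / 2 * decayRate V ^ k := by
    rw [pathSum_eq hW0 hW1]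
    calc _ = pathSum (W / 2) 0 * (q ^ M * decayRate W) ^ k := by rw [pow_mul, mul_pow]; ring
      _ ≤ pathSum (W / 2) 0 * (decayRate V / 2) ^ k := by gcongr
      _ = pathSum (W / 2) 0 * (1 / 2) ^ k * decayRate V ^ k := by rw [mul_assoc, ← mul_pow]; ring
      _ ≤ pathSum (W / 2) 0 * (1 / 2) ^ K * decayRate V ^ k := by
          have : (1 / 2 : ℝ) ^ k ≤ (1 / 2) ^ K :=
            pow_le_pow_of_le_one (by norm_num) (by norm_num) hk
          gcongr
      _ ≤ _ := by
          gcongr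
          rw [mul_comm]
          exact ((lt_div_iff₀ hT0).1 hK).le
  have h3 := pathSum_eq h0 h1 k
  rw [pathSum] at h3
  linarith

/-! ### Gaussian and spherical integrals of polynomials -/

/-- The `a`-th moment of the weight `exp (-x² / 2)` on the line. -/
def moment1 (a : ℕ) : ℝ := ∫ x : ℝ, x ^ a * Real.exp (-x ^ 2 / 2)

lemma integrable_pow_mul_exp (a : ℕ) :
    Integrable fun x : ℝ => x ^ a * Real.exp (-x ^ 2 / 2) := by
  have := integrable_rpow_mul_exp_neg_mul_sq (b := 1 / 2) (by norm_num) (s := a)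
    (by linarith [(Nat.cast_nonneg a : (0 : ℝ) ≤ a)])
  refine this.congr (.of_forall fun x => ?_)
  simp only [Real.rpow_natCast]
  ring_nf

lemma moment1_zero_pos : 0 < moment1 0 := by
  have h : moment1 0 = √(Real.pi / (1 / 2)) := by
    rw [← integral_gaussian (1 / 2), moment1]
    congr 1; ext x; ring_nf
  rw [h]; positivity

lemma hasDerivAt_pow_mul_exp (a : ℕ) (x : ℝ) :
    HasDerivAt (fun x : ℝ => x ^ a * Real.exp (-x ^ 2 / 2))
      (a * (x ^ (a - 1) * Real.exp (-x ^ 2 / 2)) - x ^ (a + 1) * Real.exp (-x ^ 2 / 2)) x := by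
  have h := (hasDerivAt_pow a x).mul (((hasDerivAt_pow 2 x).neg.div_const 2).exp)
  refine h.congr_deriv ?_
  simp; ring

lemma moment1_succ (a : ℕ) : moment1 (a + 1) = a * moment1 (a - 1) := by
  have h := integral_eq_zero_of_hasDerivAt_of_integrable (hasDerivAt_pow_mul_exp a)
    (((integrable_pow_mul_exp (a - 1)).const_mul (a : ℝ)).sub (integrable_pow_mul_exp (a + 1)))
    (integrable_pow_mul_exp a)
  rw [integral_sub ((integrable_pow_mul_exp (a - 1)).const_mul (a : ℝ))
    (integrable_pow_mul_exp (a + 1)), integral_const_mul] at h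
  unfold moment1
  linarith

/-- The unnormalized Gaussian weight on `ℝᵈ`. -/
def gaussWeight {d : ℕ} (y : Fin d → ℝ) : ℝ := ∏ i, Real.exp (-y i ^ 2 / 2)

lemma eval_monomial_mul_gaussWeight {d : ℕ} (s : Fin d →₀ ℕ) (a : ℝ) (y : Fin d → ℝ) :
    MvPolynomial.eval y (MvPolynomial.monomial s a) * gaussWeight y
      = a * ∏ i, (y i ^ s i * Real.exp (-y i ^ 2 / 2)) := by
  rw [MvPolynomial.eval_monomial, Finsupp.prod_fintype _ _ (by simp), gaussWeight, mul_assoc,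
    ← Finset.prod_mul_distrib]

lemma integrable_eval_mul_gaussWeight {d : ℕ} (p : MvPolynomial (Fin d) ℝ) :
    Integrable fun y : Fin d → ℝ => MvPolynomial.eval y p * gaussWeight y := by
  induction p using MvPolynomial.induction_on' with
  | monomial s a =>
    simp_rw [eval_monomial_mul_gaussWeight]
    exact (Integrable.fintype_prod fun i => integrable_pow_mul_exp (s i)).const_mul a
  | add p q hp hq =>
    simp only [map_add, add_mul]
    exact hp.add hq

/-- Integration of polynomials against the unnormalized Gaussian weight. -/
def gaussInt (d : ℕ) : MvPolynomial (Fin d) ℝ →ₗ[ℝ] ℝ where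
  toFun p := ∫ y : Fin d → ℝ, MvPolynomial.eval y p * gaussWeight y
  map_add' p q := by
    simp only [map_add, add_mul]
    exact integral_add (integrable_eval_mul_gaussWeight p) (integrable_eval_mul_gaussWeight q)
  map_smul' a p := by
    simp only [MvPolynomial.smul_eval, mul_assoc, RingHom.id_apply, smul_eq_mul]
    exact integral_const_mul _ _

lemma gaussInt_monomial {d : ℕ} (s : Fin d →₀ ℕ) (a : ℝ) :
    gaussInt d (MvPolynomial.monomial s a) = a * ∏ i, moment1 (s i) := by
  change ∫ y : Fin d → ℝ, _ = _
  simp_rw [eval_monomial_mul_gaussWeight]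
  rw [integral_const_mul,
    integral_fintype_prod_volume_eq_prod (fun i (x : ℝ) => x ^ s i * Real.exp (-x ^ 2 / 2))]
  rfl

lemma gaussInt_one_pos (d : ℕ) : 0 < gaussInt d 1 := by
  have := gaussInt_monomial (d := d) 0 1
  rw [show MvPolynomial.monomial (0 : Fin d →₀ ℕ) (1 : ℝ) = 1 from rfl] at this
  rw [this, one_mul]
  exact Finset.prod_pos fun i _ => moment1_zero_pos

/-- Gaussian integration by parts. -/
lemma gaussInt_X_mul {d : ℕ} (i : Fin d) (p : MvPolynomial (Fin d) ℝ) :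
    gaussInt d (MvPolynomial.X i * p) = gaussInt d (MvPolynomial.pderiv i p) := by
  induction p using MvPolynomial.induction_on' with
  | monomial s a =>
    rw [MvPolynomial.X, MvPolynomial.monomial_mul, MvPolynomial.pderiv_monomial,
      gaussInt_monomial, gaussInt_monomial, one_mul, mul_assoc]
    congr 1
    rw [← Finset.mul_prod_erase _ (fun j => moment1 ((Finsupp.single i 1 + s : Fin d →₀ ℕ) j))
        (Finset.mem_univ i),
      ← Finset.mul_prod_erase _ (fun j => moment1 ((s - Finsupp.single i 1 : Fin d →₀ ℕ) j))
        (Finset.mem_univ i),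
      ← mul_assoc]
    congr 1
    · simp [add_comm 1, moment1_succ]
    · refine Finset.prod_congr rfl fun j hj => ?_
      have : i ≠ j := (Finset.ne_of_mem_erase hj).symm
      simp [this]
  | add p q hp hq => simp only [mul_add, map_add, hp, hq]

/-- Radial part of the Gaussian integral of a homogeneous polynomial of degree `m` in `d ≥ 1`
variables. -/
def radialInt (d m : ℕ) : ℝ :=
  ∫ r in Set.Ioi (0 : ℝ), r ^ (m + (d - 1)) * Real.exp (-r ^ 2 / 2)

lemma radialInt_eq {d : ℕ} (hd : 1 ≤ d) (m : ℕ) :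
    radialInt d m = (1 / 2 : ℝ) ^ (-((m + d : ℕ) : ℝ) / 2) * (1 / 2)
      * Real.Gamma (((m + d : ℕ) : ℝ) / 2) := by
  have h := integral_rpow_mul_exp_neg_mul_rpow (p := 2) (q := ((m + (d - 1) : ℕ) : ℝ)) (b := 1 / 2)
    (by norm_num) (by linarith [(Nat.cast_nonneg (m + (d - 1)) : (0 : ℝ) ≤ _)]) (by norm_num)
  have e : ((m + (d - 1) : ℕ) : ℝ) + 1 = ((m + d : ℕ) : ℝ) := by
    rw [← Nat.cast_succ]; congr 1; omega
  rw [e] at h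
  rw [← h, radialInt]
  refine setIntegral_congr_fun measurableSet_Ioi fun x hx => ?_
  simp only [Real.rpow_natCast, Real.rpow_two]
  ring_nf

lemma radialInt_pos {d : ℕ} (hd : 1 ≤ d) (m : ℕ) : 0 < radialInt d m := by
  rw [radialInt_eq hd]
  have : (0 : ℝ) < ((m + d : ℕ) : ℝ) / 2 := by
    have : (0 : ℝ) < ((m + d : ℕ) : ℝ) := by exact_mod_cast (by omega)
    positivity
  have := Real.Gamma_pos_of_pos this
  positivity

lemma radialInt_add_two {d : ℕ} (hd : 1 ≤ d) (m : ℕ) :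
    radialInt d (m + 2) = (m + d) * radialInt d m := by
  rw [radialInt_eq hd, radialInt_eq hd]
  have h0 : ((m + d : ℕ) : ℝ) / 2 ≠ 0 := by
    have : (0 : ℝ) < ((m + d : ℕ) : ℝ) := by exact_mod_cast (by omega)
    positivity
  have e : ((m + 2 + d : ℕ) : ℝ) / 2 = ((m + d : ℕ) : ℝ) / 2 + 1 := by push_cast; ring
  have e2 : -((m + 2 + d : ℕ) : ℝ) / 2 = -((m + d : ℕ) : ℝ) / 2 + -1 := by push_cast; ring
  rw [e, e2, Real.Gamma_add_one h0, Real.rpow_add (by norm_num), Real.rpow_neg_one]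
  push_cast
  ring

/-- The uniform measure on the sphere, before normalization. -/
abbrev sphMeasure (d : ℕ) : Measure (Sph d) :=
  (volume : Measure (EuclideanSpace ℝ (Fin d))).toSphere

lemma eval_smul_of_isHomogeneous {d m : ℕ} {p : MvPolynomial (Fin d) ℝ} (hp : p.IsHomogeneous m)
    (r : ℝ) (y : Fin d → ℝ) :
    MvPolynomial.eval (fun i => r * y i) p = r ^ m * MvPolynomial.eval y p := by
  rw [MvPolynomial.eval_eq', MvPolynomial.eval_eq', Finset.mul_sum]
  refine Finset.sum_congr rfl fun s hs => ?_
  have h : ∑ i, s i = m := by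
    rw [← hp (MvPolynomial.mem_support_iff.1 hs), Finsupp.weight_apply,
      Finsupp.sum_fintype _ _ (by simp)]
    simp
  simp_rw [mul_pow]
  rw [Finset.prod_mul_distrib, Finset.prod_pow_eq_pow_sum, h]
  ring

/-- Polar coordinates for the Gaussian integral of a homogeneous polynomial. -/
lemma gaussInt_eq_integral_sphere {d m : ℕ} (hd : 1 ≤ d) {p : MvPolynomial (Fin d) ℝ}
    (hp : p.IsHomogeneous m) :
    gaussInt d p = (∫ x, restrictToSphere d p x ∂(sphMeasure d)) * radialInt d m := by
  set μ := (volume : Measure (EuclideanSpace ℝ (Fin d)))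
  set f : EuclideanSpace ℝ (Fin d) → ℝ :=
    fun y => MvPolynomial.eval (fun i => y i) p * Real.exp (-‖y‖ ^ 2 / 2) with hf
  have h1 : gaussInt d p = ∫ y, f y ∂μ := by
    rw [← (EuclideanSpace.volume_preserving_symm_measurableEquiv_toLp (Fin d)).symm.integral_comp']
    change ∫ y : Fin d → ℝ, _ = ∫ y : Fin d → ℝ, _
    refine integral_congr_ae (.of_forall fun y => ?_)
    simp only [hf, gaussWeight, ← Real.exp_sum, EuclideanSpace.real_norm_sq_eq]
    simp [Finset.sum_div, neg_div]
  rw [h1]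
  have : Nonempty (Fin d) := ⟨⟨0, hd⟩⟩
  calc
    ∫ y, f y ∂μ = ∫ y : ({(0)}ᶜ : Set (EuclideanSpace ℝ (Fin d))), f y ∂(μ.comap (↑)) := by
      rw [integral_subtype_comap (measurableSet_singleton _).compl f, restrict_compl_singleton]
    _ = ∫ z, f (z.2.1 • z.1.1) ∂(μ.toSphere.prod (.volumeIoiPow
          (Module.finrank ℝ (EuclideanSpace ℝ (Fin d)) - 1))) := by
      rw [← μ.measurePreserving_homeomorphUnitSphereProd.integral_comp
        (Homeomorph.measurableEmbedding _)]
      refine integral_congr_ae (.of_forall fun y => ?_)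
      have : (y : EuclideanSpace ℝ (Fin d)) ≠ 0 := y.2
      simp [smul_smul, this]
    _ = ∫ z, restrictToSphere d p z.1 * (z.2.1 ^ m * Real.exp (-z.2.1 ^ 2 / 2))
          ∂(μ.toSphere.prod (.volumeIoiPow
          (Module.finrank ℝ (EuclideanSpace ℝ (Fin d)) - 1))) := by
      refine integral_congr_ae (.of_forall fun z => ?_)
      have hr : 0 < z.2.1 := z.2.2
      have hz : ‖z.1.1‖ = 1 := by simp
      have he : MvPolynomial.eval (fun i => z.2.1 * z.1.1 i) p
          = z.2.1 ^ m * MvPolynomial.eval (fun i => z.1.1 i) p := eval_smul_of_isHomogeneous hp _ _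
      simp only [hf, PiLp.smul_apply, smul_eq_mul, he, norm_smul, hz, Real.norm_eq_abs, mul_one,
        sq_abs]
      change _ = MvPolynomial.eval (fun i => z.1.1 i) p * _
      ring
    _ = _ := by
      rw [integral_prod_mul (fun x => restrictToSphere d p x)
        (fun r : Set.Ioi (0 : ℝ) => r.1 ^ m * Real.exp (-r.1 ^ 2 / 2))]
      congr 1
      simp only [Measure.volumeIoiPow, ENNReal.ofReal]
      rw [integral_withDensity_eq_integral_smul,
        integral_subtype_comap measurableSet_Ioi fun a =>
          Real.toNNReal (a ^ (Module.finrank ℝ (EuclideanSpace ℝ (Fin d)) - 1)) •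
            (a ^ m * Real.exp (-a ^ 2 / 2)), radialInt,
        setIntegral_congr_fun measurableSet_Ioi fun x hx => ?_]
      · rw [NNReal.smul_def, Real.coe_toNNReal _ (pow_nonneg hx.out.le _)]
        simp
        ring
      · exact (measurable_subtype_coe.pow_const _).real_toNNReal

/-- The average over the sphere of a homogeneous polynomial of degree `m`, as a Gaussian average. -/
lemma average_restrictToSphere {d m : ℕ} (hd : 1 ≤ d) {p : MvPolynomial (Fin d) ℝ}
    (hp : p.IsHomogeneous m) :
    ⨍ x, restrictToSphere d p x ∂(sphMeasure d)
      = gaussInt d p / gaussInt d 1 * (radialInt d 0 / radialInt d m) := by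
  have h1 := gaussInt_eq_integral_sphere hd (MvPolynomial.isHomogeneous_one (Fin d) ℝ)
  have hone : ∀ x, restrictToSphere d 1 x = 1 := fun x => by simp [restrictToSphere]
  simp only [hone, integral_const, smul_eq_mul, mul_one] at h1
  have hg := gaussInt_one_pos d
  have h0 := radialInt_pos hd 0
  have hm := radialInt_pos hd m
  have hs : (sphMeasure d).real Set.univ ≠ 0 := by
    intro h; rw [h, zero_mul] at h1; exact hg.ne' h1
  rw [average_eq, smul_eq_mul, gaussInt_eq_integral_sphere hd hp, h1]
  field_simp

lemma radialInt_zero_div {d : ℕ} (hd : 1 ≤ d) (l : ℕ) :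
    radialInt d 0 / radialInt d (2 * l) = (∏ i ∈ Finset.range l, ((d : ℝ) + 2 * i))⁻¹ := by
  induction l with
  | zero => simp [(radialInt_pos hd 0).ne']
  | succ l ih =>
    rw [Finset.prod_range_succ, mul_add, mul_one, radialInt_add_two hd, mul_inv, ← ih]
    push_cast
    rw [add_comm (2 * (l : ℝ)), mul_comm ((d : ℝ) + 2 * l), ← div_div, div_eq_mul_inv _ (_ + _)]

lemma continuous_restrictToSphere {d : ℕ} (p : MvPolynomial (Fin d) ℝ) :
    Continuous (restrictToSphere d p) := by
  change Continuous fun x : Sph d => MvPolynomial.eval (fun i => x.1 i) p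
  have := MvPolynomial.continuous_eval p
  exact this.comp (by fun_prop)

lemma integrable_of_continuous_sphere {d : ℕ} {f : Sph d → ℝ} (hf : Continuous f) :
    Integrable f (sphMeasure d) :=
  hf.integrable_of_hasCompactSupport (HasCompactSupport.of_compactSpace f)

/-! ### Harmonic polynomials -/

/-- The polynomial is homogeneous of degree `k` and harmonic. -/
def IsHarm {d : ℕ} (k : ℕ) (f : MvPolynomial (Fin d) ℝ) : Prop :=
  f.IsHomogeneous k ∧ laplacian d f = 0

/-- The linear form `y ↦ ⟨x, y⟩`. -/
def linForm {d : ℕ} (x : Fin d → ℝ) : MvPolynomial (Fin d) ℝ :=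
  ∑ i, MvPolynomial.C (x i) * MvPolynomial.X i

/-- The derivative in the direction `x`. -/
def dirDeriv {d : ℕ} (x : Fin d → ℝ) (f : MvPolynomial (Fin d) ℝ) : MvPolynomial (Fin d) ℝ :=
  ∑ i, MvPolynomial.C (x i) * MvPolynomial.pderiv i f

/-- The squared Euclidean norm. -/
def sqNorm (d : ℕ) : MvPolynomial (Fin d) ℝ := ∑ i, MvPolynomial.X i ^ 2

section harmonic

variable {d : ℕ}

lemma laplacian_apply (f : MvPolynomial (Fin d) ℝ) :
    laplacian d f = ∑ i, MvPolynomial.pderiv i (MvPolynomial.pderiv i f) := by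
  simp [laplacian]

lemma pderiv_pderiv_comm (i j : Fin d) (f : MvPolynomial (Fin d) ℝ) :
    MvPolynomial.pderiv i (MvPolynomial.pderiv j f)
      = MvPolynomial.pderiv j (MvPolynomial.pderiv i f) := by
  let D (i : Fin d) : Derivation ℝ (MvPolynomial (Fin d) ℝ) (MvPolynomial (Fin d) ℝ) :=
    MvPolynomial.pderiv i
  have h : ⁅D i, D j⁆ = 0 := by
    refine MvPolynomial.derivation_ext fun l => ?_
    rw [Derivation.commutator_apply]
    simp [D, MvPolynomial.pderiv_X, Pi.single_apply, apply_ite]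
  have := congrArg (fun D => D f) h
  simpa [D, Derivation.commutator_apply, sub_eq_zero] using this

lemma laplacian_pderiv (i : Fin d) (f : MvPolynomial (Fin d) ℝ) :
    laplacian d (MvPolynomial.pderiv i f) = MvPolynomial.pderiv i (laplacian d f) := by
  simp only [laplacian_apply, map_sum]
  refine Finset.sum_congr rfl fun j _ => ?_
  rw [pderiv_pderiv_comm j i, pderiv_pderiv_comm j i]

lemma dirDeriv_mul (x : Fin d → ℝ) (f g : MvPolynomial (Fin d) ℝ) :
    dirDeriv x (f * g) = dirDeriv x f * g + f * dirDeriv x g := by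
  simp only [dirDeriv, MvPolynomial.pderiv_mul, Finset.sum_mul, Finset.mul_sum,
    ← Finset.sum_add_distrib]
  exact Finset.sum_congr rfl fun i _ => by ring

lemma dirDeriv_linForm (x : Fin d → ℝ) :
    dirDeriv x (linForm x) = MvPolynomial.C (∑ i, x i ^ 2) := by
  simp only [dirDeriv, linForm, map_sum, MvPolynomial.pderiv_C_mul, MvPolynomial.pderiv_X,
    Pi.single_apply]
  refine Finset.sum_congr rfl fun i _ => ?_
  simp [pow_two]

lemma dirDeriv_linForm_pow (x : Fin d → ℝ) (hx : ∑ i, x i ^ 2 = 1) (n : ℕ) :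
    dirDeriv x (linForm x ^ n) = (n : MvPolynomial (Fin d) ℝ) * linForm x ^ (n - 1) := by
  induction n with
  | zero => simp [dirDeriv]
  | succ n ih =>
    rw [pow_succ, dirDeriv_mul, ih, dirDeriv_linForm, hx, map_one]
    cases n with
    | zero => simp
    | succ n => push_cast; ring

lemma isHomogeneous_linForm (x : Fin d → ℝ) : (linForm x).IsHomogeneous 1 :=
  MvPolynomial.IsHomogeneous.sum _ _ _ fun i _ =>
    MvPolynomial.IsHomogeneous.C_mul (MvPolynomial.isHomogeneous_X ℝ i) (x i)

lemma isHomogeneous_sqNorm : (sqNorm d).IsHomogeneous 2 :=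
  MvPolynomial.IsHomogeneous.sum _ _ _ fun i _ => MvPolynomial.isHomogeneous_X_pow i 2

lemma IsHarm.dirDeriv {k : ℕ} {f : MvPolynomial (Fin d) ℝ} (hf : IsHarm k f) (x : Fin d → ℝ) :
    IsHarm (k - 1) (dirDeriv x f) := by
  refine ⟨MvPolynomial.IsHomogeneous.sum _ _ _ fun i _ => hf.1.pderiv.C_mul (x i), ?_⟩
  simp only [QuasiNN.dirDeriv, map_sum, ← MvPolynomial.smul_eq_C_mul, map_smul, laplacian_pderiv,
    hf.2, map_zero, smul_zero, Finset.sum_const_zero]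

lemma laplacian_mul (f g : MvPolynomial (Fin d) ℝ) :
    laplacian d (f * g) = laplacian d f * g
      + 2 * ∑ i, MvPolynomial.pderiv i f * MvPolynomial.pderiv i g + f * laplacian d g := by
  simp only [laplacian_apply, MvPolynomial.pderiv_mul, map_add, Finset.sum_mul, Finset.mul_sum,
    ← Finset.sum_add_distrib]
  exact Finset.sum_congr rfl fun i _ => by ring

lemma pderiv_linForm (x : Fin d → ℝ) (i : Fin d) :
    MvPolynomial.pderiv i (linForm x) = MvPolynomial.C (x i) := by
  simp [linForm, MvPolynomial.pderiv_X, Pi.single_apply]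

lemma pderiv_sqNorm (i : Fin d) :
    MvPolynomial.pderiv i (sqNorm d) = 2 * MvPolynomial.X i := by
  simp [sqNorm, MvPolynomial.pderiv_X, Pi.single_apply]

lemma laplacian_linForm_mul {f : MvPolynomial (Fin d) ℝ} (hf : laplacian d f = 0)
    (x : Fin d → ℝ) : laplacian d (linForm x * f) = 2 * dirDeriv x f := by
  rw [laplacian_mul, hf, laplacian_apply]
  simp [pderiv_linForm, dirDeriv]

lemma laplacian_sqNorm_mul {k : ℕ} {f : MvPolynomial (Fin d) ℝ} (hf : IsHarm k f) :
    laplacian d (sqNorm d * f) = MvPolynomial.C (2 * d + 4 * k : ℝ) * f := by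
  have he := hf.1.sum_X_mul_pderiv
  have hs : laplacian d (sqNorm d) = MvPolynomial.C (2 * d : ℝ) := by
    rw [laplacian_apply]
    have : ∀ i : Fin d, MvPolynomial.pderiv i (MvPolynomial.pderiv i (sqNorm d))
        = MvPolynomial.C 2 := fun i => by
      rw [pderiv_sqNorm, show (2 : MvPolynomial (Fin d) ℝ) = MvPolynomial.C 2 from rfl,
        MvPolynomial.pderiv_C_mul, MvPolynomial.pderiv_X_self, mul_one]
    simp only [this, Finset.sum_const, Finset.card_univ, Fintype.card_fin]
    rw [← map_nsmul]; simp [mul_comm]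
  rw [laplacian_mul, hf.2, hs]
  simp only [pderiv_sqNorm, mul_assoc, ← Finset.mul_sum, he]
  simp only [map_add, map_mul, map_natCast, map_ofNat, nsmul_eq_mul]
  ring

/-- Multiplication by a linear form changes the degree of a harmonic polynomial by at most one, up
to a multiple of the squared norm. -/
lemma IsHarm.linForm_mul (hd : 2 ≤ d) {k : ℕ} {f : MvPolynomial (Fin d) ℝ} (hf : IsHarm k f)
    (x : Fin d → ℝ) :
    ∃ g h : MvPolynomial (Fin d) ℝ, IsHarm (k + 1) g ∧ IsHarm (k - 1) h ∧
      linForm x * f = g + sqNorm d * h := by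
  obtain rfl | hk := Nat.eq_zero_or_pos k
  · refine ⟨linForm x * f, 0, ⟨?_, ?_⟩, ⟨MvPolynomial.isHomogeneous_zero _ _ _, map_zero _⟩, by simp⟩
    · rw [zero_add]; exact (isHomogeneous_linForm x).mul hf.1
    · have h0 : f = MvPolynomial.C (MvPolynomial.coeff 0 f) :=
        MvPolynomial.totalDegree_eq_zero_iff_eq_C.1
          ((MvPolynomial.totalDegree_zero_iff_isHomogeneous (Fin d)).2 hf.1)
      rw [laplacian_linForm_mul hf.2, h0]
      simp [QuasiNN.dirDeriv]
  · -- The harmonic part is `⟨x, y⟩ f - |y|² ∂ₓ f / (d + 2 k - 2)`.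
    set a : ℝ := d + 2 * k - 2 with ha
    have ha0 : a ≠ 0 := by
      have : (2 : ℝ) ≤ d := by exact_mod_cast hd
      have : (1 : ℝ) ≤ k := by exact_mod_cast hk
      have : 0 < a := by rw [ha]; linarith
      exact this.ne'
    have hD := hf.dirDeriv x
    have hh : IsHarm (k - 1) (MvPolynomial.C a⁻¹ * QuasiNN.dirDeriv x f) :=
      ⟨hD.1.C_mul _, by rw [← MvPolynomial.smul_eq_C_mul, map_smul, hD.2, smul_zero]⟩
    refine ⟨linForm x * f - sqNorm d * (MvPolynomial.C a⁻¹ * QuasiNN.dirDeriv x f), _,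
      ⟨?_, ?_⟩, hh, by ring⟩
    · refine MvPolynomial.IsHomogeneous.sub ?_ ?_
      · rw [add_comm]; exact (isHomogeneous_linForm x).mul hf.1
      · have := isHomogeneous_sqNorm.mul hh.1
        rwa [show 2 + (k - 1) = k + 1 by omega] at this
    · rw [map_sub, laplacian_linForm_mul hf.2, laplacian_sqNorm_mul hh, ← mul_assoc, ← map_mul,
        show (2 * d + 4 * ((k - 1 : ℕ) : ℝ)) * a⁻¹ = 2 by
          rw [Nat.cast_pred hk]; field_simp; rw [ha]; ring]
      change 2 * _ - MvPolynomial.C 2 * _ = 0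
      rw [map_ofNat, sub_self]

/-- A harmonic polynomial of positive degree has Gaussian mean zero. -/
lemma IsHarm.gaussInt_eq_zero {k : ℕ} {f : MvPolynomial (Fin d) ℝ} (hf : IsHarm (k + 1) f) :
    gaussInt d f = 0 := by
  have h := congrArg (gaussInt d) hf.1.sum_X_mul_pderiv
  simp only [map_sum, gaussInt_X_mul, map_nsmul] at h
  rw [← map_sum, ← laplacian_apply, hf.2, map_zero, nsmul_eq_mul, eq_comm, mul_eq_zero] at h
  exact h.resolve_left (by positivity)

/-- Harmonic polynomials of different degrees are orthogonal: integration by parts evaluates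
`∫ ∇f · ∇g` as `deg f * ∫ f g` and as `deg g * ∫ f g`. -/
lemma IsHarm.gaussInt_mul_eq_zero {k l : ℕ} {f g : MvPolynomial (Fin d) ℝ} (hf : IsHarm k f)
    (hg : IsHarm l g) (hkl : k ≠ l) : gaussInt d (f * g) = 0 := by
  have key : ∀ {k : ℕ} {f g : MvPolynomial (Fin d) ℝ}, IsHarm k f → k * gaussInt d (f * g)
      = gaussInt d (∑ i, MvPolynomial.pderiv i f * MvPolynomial.pderiv i g) := by
    intro k f g hf
    have h := congrArg (fun p => gaussInt d (p * g)) hf.1.sum_X_mul_pderiv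
    simp only [Finset.sum_mul, mul_assoc, map_sum, gaussInt_X_mul, MvPolynomial.pderiv_mul,
      map_add, Finset.sum_add_distrib, smul_mul_assoc, map_nsmul] at h
    rw [← map_sum (gaussInt d), ← Finset.sum_mul, ← laplacian_apply, hf.2, zero_mul, map_zero,
      zero_add] at h
    rw [← nsmul_eq_mul, ← h, map_sum]
  have h1 := key (g := g) hf
  have h2 := key (g := f) hg
  rw [mul_comm g f] at h2
  simp only [mul_comm (MvPolynomial.pderiv _ g)] at h2
  have h3 : ((k : ℝ) - l) * gaussInt d (f * g) = 0 := by rw [sub_mul, h1, h2, sub_self]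
  exact (mul_eq_zero.1 h3).resolve_left (sub_ne_zero.2 (by exact_mod_cast hkl))

/-- The coefficients of the Gaussian Funk–Hecke formula for `⟨x, y⟩ ^ n` on harmonic polynomials of
degree `k`, defined through the recursion which integration by parts gives. -/
def fhCoeff : ℕ → ℕ → ℝ
  | 0, 0 => 1
  | 0, _ + 1 => 0
  | 1, k => k * fhCoeff 0 (k - 1)
  | n + 2, k => (n + 1) * fhCoeff n k + k * fhCoeff (n + 1) (k - 1)

/-- The solution of the recursion: `n! / (2 ^ j * j!)` if `n = k + 2 j` and zero if `n` is not of
this form. -/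
lemma fhCoeff_aux (n : ℕ) : ∀ k,
    (∀ j, n = k + 2 * j → fhCoeff n k = (n.factorial : ℝ) / (2 ^ j * j.factorial)) ∧
      ((∀ j, n ≠ k + 2 * j) → fhCoeff n k = 0) := by
  induction n using Nat.strong_induction_on with
  | _ n ih =>
    intro k
    match n with
    | 0 =>
      cases k with
      | zero =>
        refine ⟨fun j hj => ?_, fun h => absurd rfl (h 0)⟩
        obtain rfl : j = 0 := by omega
        simp [fhCoeff]
      | succ k => exact ⟨fun j hj => by omega, fun _ => rfl⟩
    | 1 =>
      rw [fhCoeff]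
      obtain ⟨h1, h2⟩ := ih 0 (by omega) (k - 1)
      constructor
      · intro j hj
        obtain rfl : j = 0 := by omega
        obtain rfl : k = 1 := by omega
        rw [h1 0 rfl]; simp
      · intro h
        by_cases hk : k = 0
        · simp [hk]
        · rw [h2 fun j hj => h j (by omega), mul_zero]
    | n + 2 =>
      rw [fhCoeff]
      obtain ⟨h1, h2⟩ := ih n (by omega) k
      obtain ⟨h3, h4⟩ := ih (n + 1) (by omega) (k - 1)
      constructor
      · intro j hj
        have hfac : (((n + 2).factorial : ℕ) : ℝ) = (n + 2) * ((n + 1) * n.factorial) := by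
          rw [Nat.factorial_succ, Nat.factorial_succ]; push_cast; ring
        have hfac' : (((n + 1).factorial : ℕ) : ℝ) = (n + 1) * n.factorial := by
          rw [Nat.factorial_succ]; push_cast; ring
        have hk : (k : ℝ) * fhCoeff (n + 1) (k - 1)
            = k * (((n + 1) * n.factorial) / (2 ^ j * j.factorial)) := by
          by_cases hk : k = 0
          · simp [hk]
          · rw [h3 j (by omega), hfac']
        have hn : (n : ℝ) + 2 = k + 2 * j := by exact_mod_cast hj
        rw [hk, hfac]
        cases j with
        | zero =>
          rw [h2 fun i hi => by omega]
          have : (n : ℝ) + 2 = k := by simpa using hn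
          rw [this]; simp
        | succ j =>
          rw [h1 j (by omega), Nat.factorial_succ, pow_succ, hn]
          push_cast
          field_simp
          ring
      · intro h
        rw [h2 fun j hj => h (j + 1) (by omega)]
        by_cases hk : k = 0
        · simp [hk]
        · rw [h4 fun j hj => h j (by omega)]; simp

lemma fhCoeff_add_two_mul (k j : ℕ) :
    fhCoeff (k + 2 * j) k = ((k + 2 * j).factorial : ℝ) / (2 ^ j * j.factorial) :=
  (fhCoeff_aux _ k).1 j rfl

lemma fhCoeff_eq_zero {n k : ℕ} (h : ∀ j, n ≠ k + 2 * j) : fhCoeff n k = 0 := (fhCoeff_aux n k).2 h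

lemma fhCoeff_nonneg (n k : ℕ) : 0 ≤ fhCoeff n k := by
  by_cases h : ∃ j, n = k + 2 * j
  · obtain ⟨j, rfl⟩ := h
    rw [fhCoeff_add_two_mul]; positivity
  · rw [fhCoeff_eq_zero (not_exists.1 h)]

lemma eval_dirDeriv {k : ℕ} {f : MvPolynomial (Fin d) ℝ} (hf : f.IsHomogeneous k)
    (x : Fin d → ℝ) :
    MvPolynomial.eval x (dirDeriv x f) = k * MvPolynomial.eval x f := by
  have := congrArg (MvPolynomial.eval x) hf.sum_X_mul_pderiv
  simpa [dirDeriv] using this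

lemma gaussInt_linForm_mul (x : Fin d → ℝ) (p : MvPolynomial (Fin d) ℝ) :
    gaussInt d (linForm x * p) = gaussInt d (dirDeriv x p) := by
  simp only [linForm, dirDeriv, Finset.sum_mul, map_sum, ← MvPolynomial.smul_eq_C_mul,
    map_smul, gaussInt_X_mul, smul_mul_assoc]

/-- Gaussian integration by parts in the direction of a unit vector. -/
lemma gaussInt_linForm_pow_succ_mul {x : Fin d → ℝ} (hx : ∑ i, x i ^ 2 = 1) (n : ℕ)
    (f : MvPolynomial (Fin d) ℝ) :
    gaussInt d (linForm x ^ (n + 1) * f) = n * gaussInt d (linForm x ^ (n - 1) * f)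
      + gaussInt d (linForm x ^ n * dirDeriv x f) := by
  rw [pow_succ', mul_assoc, gaussInt_linForm_mul, dirDeriv_mul, dirDeriv_linForm_pow x hx, map_add,
    mul_assoc, ← nsmul_eq_mul, map_nsmul, nsmul_eq_mul]

/-- The **Funk–Hecke formula** for powers, in its Gaussian form. -/
lemma IsHarm.gaussInt_linForm_pow_mul {x : Fin d → ℝ} (hx : ∑ i, x i ^ 2 = 1) (n : ℕ) :
    ∀ {k : ℕ} {f : MvPolynomial (Fin d) ℝ}, IsHarm k f →
      gaussInt d (linForm x ^ n * f) = fhCoeff n k * MvPolynomial.eval x f * gaussInt d 1 := by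
  induction n using Nat.strong_induction_on with
  | _ n ih =>
    intro k f hf
    have hD := hf.dirDeriv x
    have he := eval_dirDeriv hf.1 x
    match n with
    | 0 =>
      rw [pow_zero, one_mul]
      cases k with
      | zero =>
        have h0 : f = MvPolynomial.C (MvPolynomial.coeff 0 f) :=
          MvPolynomial.totalDegree_eq_zero_iff_eq_C.1
            ((MvPolynomial.totalDegree_zero_iff_isHomogeneous (Fin d)).2 hf.1)
        rw [h0, MvPolynomial.eval_C, fhCoeff, one_mul, ← mul_one (MvPolynomial.C _),
          ← MvPolynomial.smul_eq_C_mul, map_smul, smul_eq_mul]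
      | succ k => rw [hf.gaussInt_eq_zero, fhCoeff]; simp
    | 1 =>
      rw [gaussInt_linForm_pow_succ_mul hx, ih 0 (by omega) hD, he, fhCoeff]
      push_cast; ring
    | n + 2 =>
      rw [gaussInt_linForm_pow_succ_mul hx, ih (n + 1) (by omega) hD, Nat.add_sub_cancel,
        ih n (by omega) hf, he, fhCoeff]
      push_cast
      ring

end harmonic

/-! ### Mercer decomposition of zonal kernels -/

lemma restrictToSphere_mul {d : ℕ} (p q : MvPolynomial (Fin d) ℝ) :
    restrictToSphere d (p * q) = restrictToSphere d p * restrictToSphere d q := by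
  ext x; simp [restrictToSphere]

/-- The average over the sphere, as a linear functional on polynomials. -/
def sphAvg (d : ℕ) : MvPolynomial (Fin d) ℝ →ₗ[ℝ] ℝ where
  toFun p := ⨍ x, restrictToSphere d p x ∂(sphMeasure d)
  map_add' p q := by
    simp only [map_add, Pi.add_apply, average_eq]
    rw [integral_add (integrable_of_continuous_sphere (continuous_restrictToSphere p))
      (integrable_of_continuous_sphere (continuous_restrictToSphere q)), smul_add]
  map_smul' a p := by
    simp only [map_smul, Pi.smul_apply, average_eq, integral_smul, RingHom.id_apply]
    rw [smul_comm]

lemma sphAvg_apply {d : ℕ} (p : MvPolynomial (Fin d) ℝ) :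
    sphAvg d p = ⨍ x, restrictToSphere d p x ∂(sphMeasure d) := rfl

lemma sphAvg_mul_congr {d : ℕ} {p q : MvPolynomial (Fin d) ℝ}
    (h : restrictToSphere d p = restrictToSphere d q) (r : MvPolynomial (Fin d) ℝ) :
    sphAvg d (p * r) = sphAvg d (q * r) := by
  simp only [sphAvg_apply, restrictToSphere_mul, h]

/-- The eigenvalue of the kernel `⟨x, y⟩ ^ n` on the spherical harmonics of order `k`: the Gaussian
coefficient, times the radial factor which turns Gaussian averages of homogeneous polynomials of
degree `n + k` into averages over the sphere. -/
def powEigenvalue (d n k : ℕ) : ℝ := fhCoeff n k * (radialInt d 0 / radialInt d (n + k))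

lemma sum_sq_eq_one {d : ℕ} (x : Sph d) : ∑ i, x.1 i ^ 2 = 1 := by
  have h : ‖x.1‖ = 1 := by simp
  rw [← EuclideanSpace.real_norm_sq_eq, h, one_pow]

lemma restrictToSphere_linForm {d : ℕ} (x y : Sph d) :
    restrictToSphere d (linForm fun i => x.1 i) y = inner ℝ x.1 y.1 := by
  simp [restrictToSphere, linForm, PiLp.inner_apply, mul_comm]

/-- The **Funk–Hecke formula** for powers. -/
lemma sphAvg_linForm_pow_mul {d k : ℕ} (hd : 1 ≤ d) {f : MvPolynomial (Fin d) ℝ}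
    (hf : IsHarm k f) (x : Sph d) (n : ℕ) :
    sphAvg d ((linForm fun i => x.1 i) ^ n * f) = powEigenvalue d n k * restrictToSphere d f x := by
  have hom : ((linForm fun i => x.1 i) ^ n * f).IsHomogeneous (n + k) := by
    have := ((isHomogeneous_linForm fun i => x.1 i).pow n).mul hf.1
    rwa [one_mul] at this
  rw [sphAvg_apply, average_restrictToSphere hd hom, hf.gaussInt_linForm_pow_mul (sum_sq_eq_one x)]
  have := (gaussInt_one_pos d).ne'
  change _ = _ * MvPolynomial.eval (fun i => x.1 i) f
  rw [powEigenvalue]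
  field_simp

lemma IsHarm.sphAvg_mul_eq_zero {d k l : ℕ} (hd : 1 ≤ d) {f g : MvPolynomial (Fin d) ℝ}
    (hf : IsHarm k f) (hg : IsHarm l g) (hkl : k ≠ l) : sphAvg d (f * g) = 0 := by
  rw [sphAvg_apply, average_restrictToSphere hd (hf.1.mul hg.1), hf.gaussInt_mul_eq_zero hg hkl]
  simp

lemma mem_sphericalHarmonics {d k : ℕ} {φ : Sph d → ℝ} :
    φ ∈ sphericalHarmonics d k ↔ ∃ f, IsHarm k f ∧ restrictToSphere d f = φ := by
  simp [sphericalHarmonics, Submodule.mem_map, IsHarm]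

/-- The restriction of `⟨x, ·⟩ ^ n` to the sphere is a sum of spherical harmonics of order at
most `n`. -/
lemma exists_isHarm_sum_eq_linForm_pow {d : ℕ} (hd : 2 ≤ d) (x : Fin d → ℝ) (n : ℕ) :
    ∃ h : ℕ → MvPolynomial (Fin d) ℝ, (∀ k, IsHarm k (h k)) ∧
      restrictToSphere d (linForm x ^ n)
        = restrictToSphere d (∑ k ∈ Finset.range (n + 1), h k) := by
  set U : ℕ → Submodule ℝ (Sph d → ℝ) :=
    fun n => ⨆ k ∈ Finset.range (n + 1), sphericalHarmonics d k with hU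
  have hle : ∀ {k n : ℕ}, k ≤ n → sphericalHarmonics d k ≤ U n := fun {k n} hkn =>
    le_biSup (fun k => sphericalHarmonics d k) (Finset.mem_range.2 (by omega))
  -- On the sphere, the factor `|y|²` in `IsHarm.linForm_mul` is one.
  have hmul : ∀ n, (U n).map (LinearMap.mulLeft ℝ (restrictToSphere d (linForm x))) ≤ U (n + 1) := by
    intro n
    simp only [hU, Submodule.map_iSup]
    refine iSup₂_le fun k hk => ?_
    rintro _ ⟨φ, hφ, rfl⟩
    obtain ⟨f, hf, rfl⟩ := mem_sphericalHarmonics.1 hφ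
    obtain ⟨g, h, hg, hh, e⟩ := hf.linForm_mul hd x
    have hk' := Finset.mem_range.1 hk
    have hq : restrictToSphere d (sqNorm d) = 1 := by
      ext y; simpa [restrictToSphere, sqNorm] using sum_sq_eq_one y
    rw [LinearMap.mulLeft_apply, ← restrictToSphere_mul, e, map_add, restrictToSphere_mul, hq,
      one_mul]
    exact add_mem (hle (by omega) (mem_sphericalHarmonics.2 ⟨g, hg, rfl⟩))
      (hle (by omega) (mem_sphericalHarmonics.2 ⟨h, hh, rfl⟩))
  have hmem : restrictToSphere d (linForm x ^ n) ∈ U n := by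
    induction n with
    | zero =>
      refine hle le_rfl (mem_sphericalHarmonics.2 ⟨1, ⟨MvPolynomial.isHomogeneous_one _ _, ?_⟩, ?_⟩)
      · simp [laplacian_apply]
      · rw [pow_zero]
    | succ n ih =>
      rw [pow_succ', restrictToSphere_mul]
      exact hmul n ⟨_, ih, rfl⟩
  obtain ⟨μ, hμ⟩ := (Submodule.mem_iSup_finset_iff_exists_sum _ _).1 hmem
  choose h hh1 hh2 using fun k => mem_sphericalHarmonics.1 (μ k).2
  refine ⟨h, hh1, ?_⟩
  rw [map_sum, ← hμ]
  exact Finset.sum_congr rfl fun k _ => (hh2 k).symm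

instance finiteDimensional_sphericalHarmonics (d k : ℕ) :
    FiniteDimensional ℝ (sphericalHarmonics d k) := by
  have : FiniteDimensional ℝ (MvPolynomial.homogeneousSubmodule (Fin d) ℝ k) :=
    Module.Finite.iff_fg.2 (MvPolynomial.homogeneousSubmodule_fg _ _ k)
  have : FiniteDimensional ℝ ((MvPolynomial.homogeneousSubmodule (Fin d) ℝ k ⊓
      LinearMap.ker (laplacian d) : Submodule ℝ (MvPolynomial (Fin d) ℝ))) :=
    Submodule.finiteDimensional_inf_left _ _
  exact Module.Finite.map _ _

/-- Expansion of a spherical harmonic of order `k` in an orthonormal basis. -/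
lemma IsHarmonicBasis.expand {d : ℕ} {Y : (k : ℕ) → Fin (numHarmonics d k) → Sph d → ℝ}
    (hY : IsHarmonicBasis d Y) {k : ℕ} {f : MvPolynomial (Fin d) ℝ} (hf : IsHarm k f)
    {p : Fin (numHarmonics d k) → MvPolynomial (Fin d) ℝ}
    (hp : ∀ j, restrictToSphere d (p j) = Y k j) (y : Sph d) :
    restrictToSphere d f y = ∑ j, sphAvg d (f * p j) * Y k j y := by
  have horth : ∀ i j, sphAvg d (p i * p j) = if i = j then 1 else 0 := fun i j => by
    rw [← hY.orthonormal k i j, sphAvg_apply, restrictToSphere_mul, hp, hp]; rfl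
  -- By orthonormality the `Y k j` are linearly independent, so by their number they span.
  have hcoef : ∀ (c : Fin (numHarmonics d k) → ℝ) (i), sphAvg d ((∑ j, c j • p j) * p i) = c i := by
    intro c i
    simp [Finset.sum_mul, horth]
  have hli : LinearIndependent ℝ (fun j => (⟨Y k j, hY.mem k j⟩ : sphericalHarmonics d k)) := by
    rw [Fintype.linearIndependent_iff]
    intro c hc i
    have h0 : restrictToSphere d (∑ j, c j • p j) = restrictToSphere d 0 := by
      have := congrArg Subtype.val hc
      simpa [hp] using this
    rw [← hcoef c i, sphAvg_mul_congr h0]; simp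
  have htop := hli.span_eq_top_of_card_eq_finrank' (by rw [Fintype.card_fin]; rfl)
  have hmem : (⟨restrictToSphere d f, mem_sphericalHarmonics.2 ⟨f, hf, rfl⟩⟩ :
      sphericalHarmonics d k) ∈ Submodule.span ℝ (Set.range fun j =>
        (⟨Y k j, hY.mem k j⟩ : sphericalHarmonics d k)) := by rw [htop]; trivial
  obtain ⟨c, hc⟩ := (Submodule.mem_span_range_iff_exists_fun ℝ).1 hmem
  have hc' : restrictToSphere d f = restrictToSphere d (∑ j, c j • p j) := by
    have := congrArg Subtype.val hc
    simpa [hp] using this.symm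
  simp only [sphAvg_mul_congr hc', hcoef]
  rw [hc']
  simp [hp]

/-- The Mercer decomposition of the kernel `⟨x, y⟩ ^ n`. -/
lemma IsHarmonicBasis.inner_pow_eq {d : ℕ} (hd : 2 ≤ d)
    {Y : (k : ℕ) → Fin (numHarmonics d k) → Sph d → ℝ} (hY : IsHarmonicBasis d Y)
    (x y : Sph d) (n : ℕ) :
    inner ℝ x.1 y.1 ^ n
      = ∑ k ∈ Finset.range (n + 1), powEigenvalue d n k * ∑ j, Y k j x * Y k j y := by
  have hd1 : 1 ≤ d := by omega
  obtain ⟨h, hh, he⟩ := exists_isHarm_sum_eq_linForm_pow hd (fun i => x.1 i) n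
  choose p hp1 hp2 using fun k j => mem_sphericalHarmonics.1 (hY.mem k j)
  have hL : inner ℝ x.1 y.1 ^ n = restrictToSphere d (linForm (fun i => x.1 i) ^ n) y := by
    rw [← restrictToSphere_linForm]; simp [restrictToSphere]
  rw [hL, he, map_sum, Finset.sum_apply]
  refine Finset.sum_congr rfl fun k hk => ?_
  rw [hY.expand (hh k) (hp2 k), Finset.mul_sum]
  refine Finset.sum_congr rfl fun j _ => ?_
  have h1 := sphAvg_linForm_pow_mul hd1 (hp1 k j) x n
  rw [sphAvg_mul_congr he, Finset.sum_mul, map_sum, Finset.sum_eq_single k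
    (fun l _ hl => (hh l).sphAvg_mul_eq_zero hd1 (hp1 k j) hl) (fun h => absurd hk h), hp2] at h1
  rw [h1, mul_assoc]

lemma powEigenvalue_nonneg {d : ℕ} (hd : 1 ≤ d) (n k : ℕ) : 0 ≤ powEigenvalue d n k :=
  mul_nonneg (fhCoeff_nonneg n k) (div_pos (radialInt_pos hd _) (radialInt_pos hd _)).le

lemma powEigenvalue_eq_zero {d n k : ℕ} (h : ∀ j, n ≠ k + 2 * j) : powEigenvalue d n k = 0 := by
  rw [powEigenvalue, fhCoeff_eq_zero h, zero_mul]

/-- The eigenvalue is the probability that a simple random walk of length `k + 2 j` ends at `k`,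
times a product which, for `d ≥ 2`, is at most one and decays at most polynomially. -/
lemma powEigenvalue_add_two_mul {d : ℕ} (hd : 1 ≤ d) (k j : ℕ) :
    powEigenvalue d (k + 2 * j) k = ((k + 2 * j).choose j : ℝ) / 2 ^ (k + 2 * j)
      * (∏ i ∈ Finset.range (k + j), (2 * (i + 1) / ((d : ℝ) + 2 * i))) := by
  have hfac : ∏ i ∈ Finset.range (k + j), (2 * ((i : ℝ) + 1))
      = 2 ^ (k + j) * (k + j).factorial := by
    rw [Finset.prod_mul_distrib, Finset.prod_const, Finset.card_range,
      ← Finset.prod_range_add_one_eq_factorial]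
    push_cast; rfl
  have hch : ((k + 2 * j).choose j : ℝ) * j.factorial * (k + j).factorial
      = (k + 2 * j).factorial := by
    have := Nat.choose_mul_factorial_mul_factorial (n := k + 2 * j) (k := j) (by omega)
    rw [show k + 2 * j - j = k + j by omega] at this
    exact_mod_cast this
  rw [powEigenvalue, fhCoeff_add_two_mul, show k + 2 * j + k = 2 * (k + j) by ring,
    radialInt_zero_div hd, Finset.prod_div_distrib, hfac, ← hch,
    show k + 2 * j = (k + j) + j by ring, pow_add]
  field_simp

lemma powEigenvalue_le {d : ℕ} (hd : 2 ≤ d) (k j : ℕ) :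
    powEigenvalue d (k + 2 * j) k ≤ ((k + 2 * j).choose j : ℝ) / 2 ^ (k + 2 * j) := by
  rw [powEigenvalue_add_two_mul (by omega)]
  refine mul_le_of_le_one_right (by positivity) (Finset.prod_le_one (fun i _ => by positivity) ?_)
  intro i _
  have : (2 : ℝ) ≤ d := by exact_mod_cast hd
  rw [div_le_one (by positivity)]
  linarith

lemma powEigenvalue_le_one {d : ℕ} (hd : 2 ≤ d) (n k : ℕ) : powEigenvalue d n k ≤ 1 := by
  by_cases h : ∃ j, n = k + 2 * j
  · obtain ⟨j, rfl⟩ := h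
    refine (powEigenvalue_le hd k j).trans ?_
    rw [div_le_one (by positivity)]
    exact_mod_cast Nat.choose_le_two_pow _ _
  · rw [powEigenvalue_eq_zero (not_exists.1 h)]; exact zero_le_one

lemma le_powEigenvalue {d : ℕ} (hd : 2 ≤ d) (k j : ℕ) :
    ((k + 2 * j).choose j : ℝ) / 2 ^ (k + 2 * j) / ((k + j + d : ℕ) : ℝ) ^ d
      ≤ powEigenvalue d (k + 2 * j) k := by
  rw [powEigenvalue_add_two_mul (by omega), div_eq_mul_inv _ (_ ^ d)]
  gcongr
  generalize k + j = l
  -- The factors are at least `(i + 1) / (d + i)`, whose product is an inverse binomial coefficient.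
  have h1 : ∏ i ∈ Finset.range l, (((i : ℝ) + 1) / (d + i))
      ≤ ∏ i ∈ Finset.range l, (2 * (i + 1) / ((d : ℝ) + 2 * i)) := by
    refine Finset.prod_le_prod (fun i _ => by positivity) fun i _ => ?_
    have : (2 : ℝ) ≤ d := by exact_mod_cast hd
    rw [div_le_div_iff₀ (by positivity) (by positivity)]
    have : (0 : ℝ) ≤ i := Nat.cast_nonneg i
    nlinarith
  refine le_trans ?_ h1
  have h2 : (∏ i ∈ Finset.range l, (((i : ℝ) + 1) / (d + i))) * (((d - 1 + l).choose l : ℕ) : ℝ) = 1 := by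
    have e1 : ∏ i ∈ Finset.range l, ((i : ℝ) + 1) = l.factorial := by
      rw [← Finset.prod_range_add_one_eq_factorial]; push_cast; rfl
    have e2 : ∏ i ∈ Finset.range l, ((d : ℝ) + i) = (d.ascFactorial l : ℕ) := by
      rw [Nat.ascFactorial_eq_prod_range]; push_cast; rfl
    have e3 : (d.ascFactorial l : ℝ) = l.factorial * (d - 1 + l).choose l := by
      have := Nat.ascFactorial_eq_factorial_mul_choose (d - 1) l
      rw [show d - 1 + 1 = d by omega] at this
      exact_mod_cast this
    have h0 : (((d - 1 + l).choose l : ℕ) : ℝ) ≠ 0 := by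
      have := Nat.choose_pos (n := d - 1 + l) (k := l) (by omega)
      positivity
    rw [Finset.prod_div_distrib, e1, e2, e3]
    field_simp
  have h3 : (((d - 1 + l).choose l : ℕ) : ℝ) ≤ ((l + d : ℕ) : ℝ) ^ d := by
    have : (d - 1 + l).choose l ≤ (l + d) ^ d := by
      rw [Nat.choose_symm_add.symm]
      calc _ ≤ (d - 1 + l) ^ (d - 1) := Nat.choose_le_pow _ _
        _ ≤ (l + d) ^ (d - 1) := Nat.pow_le_pow_left (by omega) _
        _ ≤ (l + d) ^ d := Nat.pow_le_pow_right (by omega) (by omega)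
    exact_mod_cast this
  have h4 : (0 : ℝ) < (((d - 1 + l).choose l : ℕ) : ℝ) := by
    have := Nat.choose_pos (n := d - 1 + l) (k := l) (by omega)
    positivity
  rw [← one_div, div_le_iff₀ (by positivity)]
  have h5 : 0 ≤ ∏ i ∈ Finset.range l, (((i : ℝ) + 1) / (d + i)) :=
    Finset.prod_nonneg fun i _ => by positivity
  nlinarith

/-- The eigenvalues of the zonal kernel `∑ₙ g n ⟨x, y⟩ ^ n`. -/
def zonalEigenvalue (d : ℕ) (g : ℕ → ℝ) (k : ℕ) : ℝ := ∑' n, g n * powEigenvalue d n k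

lemma summable_zonalEigenvalue {d : ℕ} (hd : 2 ≤ d) {g : ℕ → ℝ} (hg : ∀ n, 0 ≤ g n)
    (hs : Summable g) (k : ℕ) : Summable fun n => g n * powEigenvalue d n k :=
  .of_nonneg_of_le (fun n => mul_nonneg (hg n) (powEigenvalue_nonneg (by omega) n k))
    (fun n => mul_le_of_le_one_right (hg n) (powEigenvalue_le_one hd n k)) hs

lemma zonalEigenvalue_nonneg {d : ℕ} (hd : 2 ≤ d) {g : ℕ → ℝ} (hg : ∀ n, 0 ≤ g n) (k : ℕ) :
    0 ≤ zonalEigenvalue d g k :=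
  tsum_nonneg fun n => mul_nonneg (hg n) (powEigenvalue_nonneg (by omega) n k)

/-- Mercer decomposition of a zonal kernel with nonnegative summable Taylor coefficients. The double
series may be rearranged because `|Z k x y| ≤ (Z k x x + Z k y y) / 2` for
`Z k x y = ∑ⱼ Y k j x * Y k j y`, while the diagonal series consist of nonnegative terms. -/
lemma IsHarmonicBasis.hasSum_zonal {d : ℕ} (hd : 2 ≤ d)
    {Y : (k : ℕ) → Fin (numHarmonics d k) → Sph d → ℝ} (hY : IsHarmonicBasis d Y)
    {g : ℕ → ℝ} (hg : ∀ n, 0 ≤ g n) (hs : Summable g) (x y : Sph d) :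
    HasSum (fun k => zonalEigenvalue d g k * ∑ j, Y k j x * Y k j y)
      (∑' n, g n * inner ℝ x.1 y.1 ^ n) := by
  have hd1 : 1 ≤ d := by omega
  set Z : ℕ → Sph d → Sph d → ℝ := fun k x y => ∑ j, Y k j x * Y k j y with hZ
  set F : Sph d → Sph d → ℕ × ℕ → ℝ :=
    fun x y p => g p.1 * (powEigenvalue d p.1 p.2 * Z p.2 x y) with hF
  have hzero : ∀ n k, k ∉ Finset.range (n + 1) → powEigenvalue d n k = 0 := fun n k hk =>
    powEigenvalue_eq_zero fun j hj => hk (Finset.mem_range.2 (by omega))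
  have hfiber : ∀ x y n, HasSum (fun k => F x y (n, k)) (g n * inner ℝ x.1 y.1 ^ n) := by
    intro x y n
    rw [hY.inner_pow_eq hd x y n]
    refine HasSum.mul_left _ (hasSum_sum_of_ne_finset_zero fun k hk => ?_)
    rw [hzero n k hk, zero_mul]
  have hdiag : ∀ x, Summable (F x x) := by
    intro x
    have hnn : 0 ≤ F x x := fun p => mul_nonneg (hg _) (mul_nonneg (powEigenvalue_nonneg hd1 _ _)
      (Finset.sum_nonneg fun j _ => mul_self_nonneg _))
    refine (summable_prod_of_nonneg hnn).2 ⟨fun n => (hfiber x x n).summable, ?_⟩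
    simp only [fun n => (hfiber x x n).tsum_eq]
    have : inner ℝ x.1 x.1 = (1 : ℝ) := by simp
    simpa [this] using hs
  have hsum : Summable (F x y) := by
    refine .of_norm_bounded (((hdiag x).add (hdiag y)).mul_right (1 / 2)) fun p => ?_
    have hZb : |Z p.2 x y| ≤ (Z p.2 x x + Z p.2 y y) * (1 / 2) := by
      simp only [hZ, ← Finset.sum_add_distrib, Finset.sum_mul]
      refine (Finset.abs_sum_le_sum_abs _ _).trans (Finset.sum_le_sum fun j _ => ?_)
      rw [abs_le]
      constructor <;> nlinarith [sq_nonneg (Y p.2 j x + Y p.2 j y), sq_nonneg (Y p.2 j x - Y p.2 j y)]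
    have h0 := hg p.1
    have h1 := powEigenvalue_nonneg hd1 p.1 p.2
    rw [Real.norm_eq_abs]
    simp only [hF, abs_mul, abs_of_nonneg h0, abs_of_nonneg h1]
    calc _ ≤ g p.1 * (powEigenvalue d p.1 p.2 * ((Z p.2 x x + Z p.2 y y) * (1 / 2))) := by gcongr
      _ = _ := by ring
  have hswap := (hsum.hasSum).prod_fiberwise (hfiber x y)
  have hs2 : HasSum (F x y ∘ Prod.swap) (∑' n, g n * inner ℝ x.1 y.1 ^ n) := by
    rw [hswap.tsum_eq]
    exact (Equiv.prodComm ℕ ℕ).hasSum_iff.2 hsum.hasSum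
  refine hs2.prod_fiberwise fun k => ?_
  have := ((summable_zonalEigenvalue hd hg hs k).hasSum).mul_right (Z k x y)
  simp only [mul_assoc] at this
  exact this

/-! ### Decay of the eigenvalues of zonal kernels -/

/-- Only the powers with exponents `k + 2 j` contribute to the eigenvalue of order `k`. -/
lemma zonalEigenvalue_eq_tsum (d : ℕ) (g : ℕ → ℝ) (k : ℕ) :
    zonalEigenvalue d g k = ∑' j, g (k + 2 * j) * powEigenvalue d (k + 2 * j) k := by
  have hinj : Function.Injective fun j : ℕ => k + 2 * j := fun i j h => by
    simp only at h; omega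
  refine (hinj.tsum_eq (f := fun n => g n * powEigenvalue d n k) fun n hn => ?_).symm
  by_contra h
  refine hn ?_
  show g n * powEigenvalue d n k = 0
  rw [powEigenvalue_eq_zero fun j hj => h ⟨j, hj.symm⟩, mul_zero]

lemma zonalEigenvalue_le {d : ℕ} (hd : 2 ≤ d) {V : ℝ} (h0 : 0 < V) (h1 : V < 1) {g : ℕ → ℝ}
    (hg : ∀ n, 0 ≤ g n) {B : ℝ} (hB : 0 ≤ B) (hgB : ∀ n, g n ≤ B * V ^ n) (k : ℕ) :
    zonalEigenvalue d g k ≤ B * pathSum (V / 2) 0 * decayRate V ^ k := by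
  rw [mul_assoc, ← pathSum_eq h0 h1, zonalEigenvalue_eq_tsum, pathSum, ← tsum_mul_left]
  have hs := (summable_pathSum (x := V / 2) (by positivity) (by linarith) k).mul_left B
  have hle : ∀ j, g (k + 2 * j) * powEigenvalue d (k + 2 * j) k
      ≤ B * (((k + 2 * j).choose j : ℝ) * (V / 2) ^ (k + 2 * j)) := fun j => by
    calc _ ≤ B * V ^ (k + 2 * j) * (((k + 2 * j).choose j : ℝ) / 2 ^ (k + 2 * j)) :=
          mul_le_mul (hgB _) (powEigenvalue_le hd k j) (powEigenvalue_nonneg (by omega) _ _)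
            (by positivity)
      _ = _ := by rw [div_pow]; ring
  exact Summable.tsum_le_tsum hle (.of_nonneg_of_le
    (fun j => mul_nonneg (hg _) (powEigenvalue_nonneg (by omega) _ _)) hle hs) hs

/-- Lower bound for the eigenvalues of zonal kernels. Half of the path sum comes from indices
`j < M k`, for which the polynomial losses are powers of `k`; the threshold `K` does not depend on
`d`. -/
lemma exists_le_zonalEigenvalue {V : ℝ} (h0 : 0 < V) (h1 : V < 1) :
    ∃ K : ℕ, 1 ≤ K ∧ ∀ d : ℕ, 2 ≤ d → ∃ A : ℝ, 0 < A ∧ ∀ (g : ℕ → ℝ) (b : ℝ),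
      (∀ n, 0 ≤ g n) → Summable g → 0 ≤ b → (∀ n : ℕ, b * V ^ n / ((n : ℝ) + 1) ^ 2 ≤ g n) →
      ∀ k : ℕ, K ≤ k → b * A / (k : ℝ) ^ (d + 2) * decayRate V ^ k ≤ zonalEigenvalue d g k := by
  obtain ⟨M, K, hK⟩ := exists_half_pathSum_le_sum h0 h1
  refine ⟨max 1 K, le_max_left _ _, fun d hd => ?_⟩
  have hS0 := pathSum_zero_pos (x := V / 2) (by positivity) (by linarith)
  set D : ℝ := ((2 * M + 1 + d : ℕ) : ℝ) with hD
  have hD0 : 0 < D := by rw [hD]; positivity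
  refine ⟨pathSum (V / 2) 0 / 2 / D ^ (d + 2), by positivity, fun g b hg hs hb hgb k hk => ?_⟩
  have hk1 : 1 ≤ k := (le_max_left _ _).trans hk
  have hk0 : (0 : ℝ) < k := by exact_mod_cast hk1
  have hpath := hK k ((le_max_right _ _).trans hk)
  have hinj : Function.Injective fun j : ℕ => k + 2 * j := fun i j h => by
    simp only at h; omega
  rw [zonalEigenvalue_eq_tsum]
  have hsum : Summable fun j => g (k + 2 * j) * powEigenvalue d (k + 2 * j) k :=
    (summable_zonalEigenvalue hd hg hs k).comp_injective hinj
  refine le_trans ?_ (hsum.sum_le_tsum (Finset.range (M * k)) fun j _ =>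
    mul_nonneg (hg _) (powEigenvalue_nonneg (by omega) _ _))
  calc b * (pathSum (V / 2) 0 / 2 / D ^ (d + 2)) / (k : ℝ) ^ (d + 2) * decayRate V ^ k
      = b / (D * k) ^ (d + 2) * (pathSum (V / 2) 0 / 2 * decayRate V ^ k) := by
        rw [mul_pow]; field_simp
    _ ≤ b / (D * k) ^ (d + 2) * ∑ j ∈ Finset.range (M * k),
          ((k + 2 * j).choose j : ℝ) * (V / 2) ^ (k + 2 * j) := by gcongr
    _ ≤ _ := by
        rw [Finset.mul_sum]
        refine Finset.sum_le_sum fun j hj => ?_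
        have hj' : j < M * k := Finset.mem_range.1 hj
        have e1 : ((k + 2 * j : ℕ) : ℝ) + 1 ≤ D * k := by
          have : k + 2 * j + 1 ≤ (2 * M + 1 + d) * k := by nlinarith
          rw [hD]; exact_mod_cast this
        have e2 : ((k + j + d : ℕ) : ℝ) ≤ D * k := by
          have : k + j + d ≤ (2 * M + 1 + d) * k := by nlinarith
          rw [hD]; exact_mod_cast this
        have e3 : (0 : ℝ) < ((k + j + d : ℕ) : ℝ) := by exact_mod_cast (by omega)
        calc b / (D * k) ^ (d + 2) * (((k + 2 * j).choose j : ℝ) * (V / 2) ^ (k + 2 * j))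
            = b * V ^ (k + 2 * j) / (D * k) ^ 2
              * (((k + 2 * j).choose j : ℝ) / 2 ^ (k + 2 * j) / (D * k) ^ d) := by
              rw [div_pow, pow_add (D * k) d 2]; field_simp
          _ ≤ b * V ^ (k + 2 * j) / (((k + 2 * j : ℕ) : ℝ) + 1) ^ 2
              * (((k + 2 * j).choose j : ℝ) / 2 ^ (k + 2 * j) / ((k + j + d : ℕ) : ℝ) ^ d) := by
              gcongr
          _ ≤ _ := mul_le_mul (hgb _) (le_powEigenvalue hd k j) (by positivity) (hg _)

/-! ### The Taylor series of the arc-cosine kernels -/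

/-- The coefficients of `(1 - y) ^ (-1/2)`. -/
def invSqrtCoeff (n : ℕ) : ℝ := ∏ i ∈ Finset.range n, ((2 * i + 1 : ℝ) / (2 * i + 2))

lemma invSqrtCoeff_nonneg (n : ℕ) : 0 ≤ invSqrtCoeff n :=
  Finset.prod_nonneg fun i _ => by positivity

lemma invSqrtCoeff_le_one (n : ℕ) : invSqrtCoeff n ≤ 1 :=
  Finset.prod_le_one (fun i _ => by positivity) fun i _ => by
    rw [div_le_one (by positivity)]; linarith

lemma le_invSqrtCoeff (n : ℕ) : 1 / (2 * n + 1 : ℝ) ≤ invSqrtCoeff n := by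
  induction n with
  | zero => simp [invSqrtCoeff]
  | succ n ih =>
    rw [invSqrtCoeff, Finset.prod_range_succ]
    refine le_trans ?_ (mul_le_mul_of_nonneg_right ih (by positivity))
    rw [div_mul_div_comm, div_le_div_iff₀ (by positivity) (by positivity)]
    push_cast
    have : (0 : ℝ) ≤ n := Nat.cast_nonneg n
    nlinarith

lemma descPochhammer_smeval_eq_prod (r : ℝ) (n : ℕ) :
    (descPochhammer ℤ n).smeval r = ∏ i ∈ Finset.range n, (r - i) := by
  induction n with
  | zero => simp [Polynomial.smeval_one]
  | succ n ih =>
    rw [descPochhammer_succ_right, Polynomial.smeval_mul, ih, Finset.prod_range_succ,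
      Polynomial.smeval_sub, Polynomial.smeval_X, Polynomial.smeval_natCast]
    simp

lemma ring_choose_eq_invSqrtCoeff (n : ℕ) :
    Ring.choose (1 / 2 + (n : ℝ) - 1) n = invSqrtCoeff n := by
  have h := Ring.descPochhammer_eq_factorial_smul_choose (1 / 2 + (n : ℝ) - 1) n
  rw [descPochhammer_smeval_eq_prod, nsmul_eq_mul] at h
  have h0 : ((n.factorial : ℕ) : ℝ) ≠ 0 := by positivity
  apply mul_left_cancel₀ h0
  rw [← h, invSqrtCoeff, ← Finset.prod_range_add_one_eq_factorial, ← Finset.prod_range_reflect]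
  push_cast
  rw [← Finset.prod_mul_distrib]
  refine Finset.prod_congr rfl fun i hi => ?_
  have : i < n := Finset.mem_range.1 hi
  have e : ((n - 1 - i : ℕ) : ℝ) = n - 1 - i := by
    rw [Nat.sub_sub, Nat.cast_sub (by omega)]; push_cast; ring
  rw [e]
  have : (2 * (i : ℝ) + 2) ≠ 0 := by positivity
  field_simp
  ring

lemma hasSum_invSqrtCoeff {y : ℝ} (hy : |y| < 1) :
    HasSum (fun n => invSqrtCoeff n * y ^ n) (1 / √(1 - y)) := by
  have h := (Real.one_div_one_sub_rpow_hasFPowerSeriesOnBall_zero (1 / 2)).hasSum (y := y)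
    (by simpa [enorm_eq_nnnorm, ← NNReal.coe_lt_one] using hy)
  simp only [FormalMultilinearSeries.ofScalars_apply_eq, ring_choose_eq_invSqrtCoeff, zero_add,
    ← Real.sqrt_eq_rpow, smul_eq_mul] at h
  exact h

/-- Termwise integration of a power series with bounded coefficients. -/
lemma hasSum_of_hasDerivAt {f f' : ℝ → ℝ} {b : ℕ → ℝ} (hb0 : ∀ n, 0 ≤ b n) (hb : ∀ n, b n ≤ 1)
    (hf : ∀ x, |x| < 1 → HasDerivAt f (f' x) x)
    (hf' : ∀ x, |x| < 1 → HasSum (fun n => b n * x ^ n) (f' x)) {x : ℝ} (hx : |x| < 1) :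
    HasSum (fun n => b n / (n + 1) * x ^ (n + 1)) (f x - f 0) := by
  obtain ⟨ρ, hxρ, hρ1⟩ := exists_between hx
  have hρ0 : 0 < ρ := (abs_nonneg x).trans_lt hxρ
  set t : Set ℝ := Metric.ball 0 ρ with ht
  have hmem : ∀ {y}, y ∈ t ↔ |y| < ρ := by simp [ht]
  have hder : ∀ n y, y ∈ t → HasDerivAt (fun y => b n / (n + 1) * y ^ (n + 1)) (b n * y ^ n) y := by
    intro n y _
    refine ((hasDerivAt_pow (n + 1) y).const_mul (b n / (n + 1))).congr_deriv ?_
    push_cast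
    have : (n : ℝ) + 1 ≠ 0 := by positivity
    field_simp
  have hbound : ∀ n y, y ∈ t → ‖b n * y ^ n‖ ≤ ρ ^ n := by
    intro n y hy
    rw [norm_mul, norm_pow, Real.norm_eq_abs, Real.norm_eq_abs, abs_of_nonneg (hb0 n)]
    calc b n * |y| ^ n ≤ 1 * ρ ^ n := by
          gcongr
          · exact hb n
          · exact (hmem.1 hy).le
      _ = _ := one_mul _
  have hgeo : Summable fun n : ℕ => ρ ^ n := summable_geometric_of_lt_one hρ0.le hρ1
  have h0t : (0 : ℝ) ∈ t := hmem.2 (by simpa using hρ0)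
  have hs0 : Summable fun n => b n / (n + 1) * (0 : ℝ) ^ (n + 1) := by simp
  have hpre : IsPreconnected t := (convex_ball 0 ρ).isPreconnected
  set S : ℝ → ℝ := fun y => ∑' n, b n / (n + 1) * y ^ (n + 1) with hS
  have hSder : ∀ y ∈ t, HasDerivAt S (f' y) y := by
    intro y hy
    have := hasDerivAt_tsum_of_isPreconnected hgeo Metric.isOpen_ball hpre hder hbound h0t hs0 hy
    rwa [(hf' y ((hmem.1 hy).trans hρ1)).tsum_eq] at this
  have hsum := summable_of_summable_hasDerivAt_of_isPreconnected hgeo Metric.isOpen_ball hpre hder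
    hbound h0t hs0 (hmem.2 hxρ)
  have hconst : (f - S) x = (f - S) 0 := by
    have hd : ∀ y ∈ t, HasDerivAt (f - S) 0 y := fun y hy =>
      ((hf y ((hmem.1 hy).trans hρ1)).sub (hSder y hy)).congr_deriv (sub_self _)
    exact Metric.isOpen_ball.is_const_of_deriv_eq_zero hpre
      (fun y hy => (hd y hy).differentiableAt.differentiableWithinAt)
      (fun y hy => (hd y hy).deriv) (hmem.2 hxρ) h0t
  have hS0 : S 0 = 0 := by simp [hS]
  have : f x - f 0 = S x := by
    simp only [Pi.sub_apply, hS0] at hconst; linarith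
  rw [this]
  exact hsum.hasSum

/-- The arc-cosine kernel of order zero: the probability that two standard Gaussian variables with
correlation `ρ` are both positive. -/
def arcKernel0 (ρ : ℝ) : ℝ := 1 / 4 + Real.arcsin ρ / (2 * Real.pi)

/-- The arc-cosine kernel of order one: the mean of the product of the positive parts of two
standard Gaussian variables with correlation `ρ`. -/
def arcKernel1 (ρ : ℝ) : ℝ :=
  (√(1 - ρ ^ 2) + ρ * (Real.pi / 2 + Real.arcsin ρ)) / (2 * Real.pi)

/-- Taylor coefficients of `1 / √(1 - x²)`. -/
def arcsinDerivCoeff (n : ℕ) : ℝ := if Even n then invSqrtCoeff (n / 2) else 0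

/-- Taylor coefficients of `arcKernel0`. -/
def arcCoeff0 : ℕ → ℝ
  | 0 => 1 / 4
  | n + 1 => arcsinDerivCoeff n / (n + 1) / (2 * Real.pi)

/-- Taylor coefficients of `arcKernel1`. -/
def arcCoeff1 : ℕ → ℝ
  | 0 => 1 / (2 * Real.pi)
  | n + 1 => arcCoeff0 n / (n + 1)

lemma arcsinDerivCoeff_nonneg (n : ℕ) : 0 ≤ arcsinDerivCoeff n := by
  unfold arcsinDerivCoeff; split_ifs
  exacts [invSqrtCoeff_nonneg _, le_rfl]

lemma arcsinDerivCoeff_le_one (n : ℕ) : arcsinDerivCoeff n ≤ 1 := by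
  unfold arcsinDerivCoeff; split_ifs
  exacts [invSqrtCoeff_le_one _, zero_le_one]

lemma one_le_two_pi : 1 ≤ 2 * Real.pi := by linarith [Real.pi_gt_three]

lemma arcCoeff0_nonneg (n : ℕ) : 0 ≤ arcCoeff0 n := by
  cases n with
  | zero => norm_num [arcCoeff0]
  | succ n =>
    have := arcsinDerivCoeff_nonneg n
    rw [arcCoeff0]; positivity

lemma arcCoeff0_le_one (n : ℕ) : arcCoeff0 n ≤ 1 := by
  cases n with
  | zero => norm_num [arcCoeff0]
  | succ n =>
    have h0 := arcsinDerivCoeff_nonneg n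
    have h1 := arcsinDerivCoeff_le_one n
    rw [arcCoeff0]
    have : (0 : ℝ) ≤ n := Nat.cast_nonneg n
    exact div_le_one_of_le₀ ((div_le_one_of_le₀ (by linarith) (by positivity)).trans one_le_two_pi)
      (by positivity)

lemma arcCoeff1_nonneg (n : ℕ) : 0 ≤ arcCoeff1 n := by
  cases n with
  | zero => rw [arcCoeff1]; positivity
  | succ n =>
    have := arcCoeff0_nonneg n
    rw [arcCoeff1]; positivity

lemma arcCoeff1_le_one (n : ℕ) : arcCoeff1 n ≤ 1 := by
  cases n with
  | zero => rw [arcCoeff1]; exact div_le_one_of_le₀ one_le_two_pi (by positivity)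
  | succ n =>
    have h0 := arcCoeff0_nonneg n
    have h1 := arcCoeff0_le_one n
    have : (0 : ℝ) ≤ n := Nat.cast_nonneg n
    rw [arcCoeff1]
    exact div_le_one_of_le₀ (by linarith) (by positivity)

/-- Apart from the constant term, `arcKernel0` is a multiple of the arcsine, so that only its odd
coefficients are bounded below. -/
lemma le_arcCoeff0_of_odd {n : ℕ} (hn : Odd n) :
    1 / (2 * Real.pi) / ((n : ℝ) + 1) ^ 2 ≤ arcCoeff0 n := by
  obtain ⟨m, rfl⟩ := hn
  have h := le_invSqrtCoeff m
  simp only [arcCoeff0]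
  rw [arcsinDerivCoeff, if_pos (even_two_mul m), Nat.mul_div_cancel_left _ two_pos,
    div_right_comm _ (2 * Real.pi)]
  refine div_le_div_of_nonneg_right ?_ (by positivity)
  refine le_trans ?_ (div_le_div_of_nonneg_right h (by positivity))
  push_cast
  have : (0 : ℝ) ≤ m := Nat.cast_nonneg m
  rw [div_div]
  refine one_div_le_one_div_of_le (by positivity) ?_
  nlinarith

lemma hasSum_of_hasSum_succ {f g : ℕ → ℝ} {a b : ℝ} (h : HasSum g b) (hfg : ∀ n, f (n + 1) = g n)
    (hab : a - f 0 = b) : HasSum f a := by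
  rw [← hasSum_nat_add_iff' 1, Finset.sum_range_one, hab]
  exact (funext hfg : (fun n => f (n + 1)) = g) ▸ h

lemma hasSum_arcsinDerivCoeff {x : ℝ} (hx : |x| < 1) :
    HasSum (fun n => arcsinDerivCoeff n * x ^ n) (1 / √(1 - x ^ 2)) := by
  have h := hasSum_invSqrtCoeff (y := x ^ 2)
    (by rw [abs_pow]; exact pow_lt_one₀ (abs_nonneg x) hx (by norm_num))
  have hinj : Function.Injective fun j : ℕ => 2 * j := fun i j h => by simp only at h; omega
  rw [← hinj.hasSum_iff]
  · convert h using 2 with j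
    simp only [Function.comp_apply, arcsinDerivCoeff, even_two_mul, if_true,
      Nat.mul_div_cancel_left j two_pos, pow_mul]
  · intro n hn
    have : ¬ Even n := fun ⟨m, hm⟩ => hn ⟨m, by simp only; omega⟩
    simp [arcsinDerivCoeff, this]

lemma hasSum_arcKernel0 {x : ℝ} (hx : |x| < 1) :
    HasSum (fun n => arcCoeff0 n * x ^ n) (arcKernel0 x) := by
  have h := hasSum_of_hasDerivAt arcsinDerivCoeff_nonneg arcsinDerivCoeff_le_one
    (f := Real.arcsin) (f' := fun x => 1 / √(1 - x ^ 2))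
    (fun x hx => Real.hasDerivAt_arcsin (abs_lt.1 hx).1.ne' (abs_lt.1 hx).2.ne)
    (fun x hx => hasSum_arcsinDerivCoeff hx) hx
  refine hasSum_of_hasSum_succ (h.div_const (2 * Real.pi)) (fun n => ?_) ?_
  · simp only [arcCoeff0]
    ring
  · simp [arcKernel0, arcCoeff0]

/-- The second arc-cosine kernel is a primitive of the first one, so its Taylor series arises by
termwise integration. -/
lemma hasDerivAt_arcKernel1 {x : ℝ} (hx : |x| < 1) : HasDerivAt arcKernel1 (arcKernel0 x) x := by
  have hx2 : 0 < 1 - x ^ 2 := by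
    have := (sq_lt_one_iff_abs_lt_one x).2 hx
    linarith
  have h1 : HasDerivAt (fun x : ℝ => √(1 - x ^ 2)) (-(2 * x) / (2 * √(1 - x ^ 2))) x := by
    have := ((hasDerivAt_pow 2 x).const_sub 1).sqrt hx2.ne'
    simpa using this
  have h2 := Real.hasDerivAt_arcsin (abs_lt.1 hx).1.ne' (abs_lt.1 hx).2.ne
  have h3 := (h1.add ((hasDerivAt_id x).mul (h2.const_add (Real.pi / 2)))).div_const (2 * Real.pi)
  refine h3.congr_deriv ?_
  have : √(1 - x ^ 2) ≠ 0 := (Real.sqrt_pos.2 hx2).ne'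
  rw [arcKernel0]
  simp only [id]
  field_simp
  ring

lemma hasSum_arcKernel1 {x : ℝ} (hx : |x| < 1) :
    HasSum (fun n => arcCoeff1 n * x ^ n) (arcKernel1 x) := by
  have h := hasSum_of_hasDerivAt arcCoeff0_nonneg arcCoeff0_le_one
    (fun x hx => hasDerivAt_arcKernel1 hx) (fun x hx => hasSum_arcKernel0 hx) hx
  refine hasSum_of_hasSum_succ h (fun n => ?_) ?_
  · simp only [arcCoeff1]
  · simp [arcKernel1, arcCoeff1]

/-! ### The power series of the limiting kernel -/

/-- The limit of the neural tangent kernel at two points of the unit sphere of `ℝᵈ` with inner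
product `t`. -/
def limitKernel (d : ℕ) (c β V t : ℝ) : ℝ :=
  (c * t / d + β ^ 2) * arcKernel0 (V * t) + c / d * arcKernel1 (V * t)

/-- Taylor coefficients of `limitKernel d c β V`. -/
def limitCoeff (d : ℕ) (c β V : ℝ) : ℕ → ℝ
  | 0 => β ^ 2 * arcCoeff0 0 + c / d * arcCoeff1 0
  | n + 1 => β ^ 2 * (arcCoeff0 (n + 1) * V ^ (n + 1)) + c / d * (arcCoeff0 n * V ^ n)
      + c / d * (arcCoeff1 (n + 1) * V ^ (n + 1))

section limitCoeff

variable {d : ℕ} {c β V : ℝ}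

lemma limitCoeff_nonneg (hc : 0 < c) (h0 : 0 < V) (n : ℕ) : 0 ≤ limitCoeff d c β V n := by
  have h := arcCoeff0_nonneg
  have h' := arcCoeff1_nonneg
  cases n with
  | zero =>
    simp only [limitCoeff]
    have := h 0; have := h' 0; positivity
  | succ n =>
    simp only [limitCoeff]
    have := h (n + 1); have := h' (n + 1); have := h n; positivity

lemma limitCoeff_le (hc : 0 < c) (h0 : 0 < V) (n : ℕ) :
    limitCoeff d c β V n ≤ (β ^ 2 + c / d / V + c / d) * V ^ n := by
  have hp : ∀ {a b : ℝ}, a ≤ 1 → 0 ≤ b → a * b ≤ b := fun ha hb => mul_le_of_le_one_left hb ha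
  have hcd : 0 ≤ c / d := by positivity
  cases n with
  | zero =>
    simp only [limitCoeff, pow_zero, mul_one]
    have h1 := mul_le_of_le_one_right (sq_nonneg β) (arcCoeff0_le_one 0)
    have h2 := mul_le_of_le_one_right hcd (arcCoeff1_le_one 0)
    have : 0 ≤ c / d / V := by positivity
    linarith
  | succ n =>
    simp only [limitCoeff]
    have e : (β ^ 2 + c / d / V + c / d) * V ^ (n + 1)
        = β ^ 2 * V ^ (n + 1) + c / d * V ^ n + c / d * V ^ (n + 1) := by
      field_simp
      ring
    rw [e]
    gcongr
    exacts [hp (arcCoeff0_le_one _) (by positivity), hp (arcCoeff0_le_one _) (by positivity),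
      hp (arcCoeff1_le_one _) (by positivity)]

lemma summable_limitCoeff (hc : 0 < c) (h0 : 0 < V) (h1 : V < 1) :
    Summable (limitCoeff d c β V) :=
  .of_nonneg_of_le (limitCoeff_nonneg hc h0) (limitCoeff_le hc h0)
    ((summable_geometric_of_lt_one h0.le h1).mul_left _)

/-- The odd coefficients are bounded below through the bias term `β² arcKernel0 (V t)` and the even
ones through `c t / d * arcKernel0 (V t)`. -/
lemma le_limitCoeff (hc : 0 < c) (h0 : 0 < V) (h1 : V < 1) (n : ℕ) :
    min (β ^ 2) (c / d) / (2 * Real.pi) * V ^ n / ((n : ℝ) + 1) ^ 2 ≤ limitCoeff d c β V n := by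
  have hcd : 0 ≤ c / d := by positivity
  have hm : 0 ≤ min (β ^ 2) (c / d) := le_min (sq_nonneg β) hcd
  have hq := arcCoeff0_nonneg
  have hr := arcCoeff1_nonneg
  have key : ∀ {a q v : ℝ} {m : ℕ}, min (β ^ 2) (c / d) ≤ a → Odd m → m ≤ n → V ^ n ≤ v →
      q = arcCoeff0 m →
      min (β ^ 2) (c / d) / (2 * Real.pi) * V ^ n / ((n : ℝ) + 1) ^ 2 ≤ a * (q * v) := by
    rintro a q v m ha hm' hmn hv rfl
    have ha0 : 0 ≤ a := hm.trans ha
    calc _ = min (β ^ 2) (c / d) * (1 / (2 * Real.pi) / ((n : ℝ) + 1) ^ 2 * V ^ n) := by ring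
      _ ≤ a * (1 / (2 * Real.pi) / ((m : ℝ) + 1) ^ 2 * v) := by gcongr
      _ ≤ _ := by
        have := le_arcCoeff0_of_odd hm'
        have : 0 ≤ v := (pow_nonneg h0.le n).trans hv
        gcongr
  cases n with
  | zero =>
    simp only [limitCoeff, arcCoeff0, arcCoeff1, pow_zero, Nat.cast_zero, zero_add, one_pow, mul_one,
      div_one]
    have : min (β ^ 2) (c / d) / (2 * Real.pi) ≤ c / d * (1 / (2 * Real.pi)) := by
      rw [mul_one_div]; gcongr; exact min_le_right _ _
    have : 0 ≤ β ^ 2 * (1 / 4) := by positivity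
    linarith
  | succ n =>
    simp only [limitCoeff]
    have t1 : 0 ≤ β ^ 2 * (arcCoeff0 (n + 1) * V ^ (n + 1)) := by have := hq (n + 1); positivity
    have t2 : 0 ≤ c / d * (arcCoeff0 n * V ^ n) := by have := hq n; positivity
    have t3 : 0 ≤ c / d * (arcCoeff1 (n + 1) * V ^ (n + 1)) := by
      have := hr (n + 1); positivity
    rcases Nat.even_or_odd n with he | ho
    · have := key (min_le_left _ _) he.add_one le_rfl le_rfl rfl
      linarith
    · have := key (min_le_right _ _) ho n.le_succ
        (pow_le_pow_of_le_one h0.le h1.le n.le_succ) rfl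
      linarith

lemma hasSum_limitCoeff (h0 : 0 < V) (h1 : V < 1) {t : ℝ} (ht : |t| ≤ 1) :
    HasSum (fun n => limitCoeff d c β V n * t ^ n) (limitKernel d c β V t) := by
  have hVt : |V * t| < 1 := by
    rw [abs_mul, abs_of_pos h0]
    nlinarith [abs_nonneg t]
  have hA := hasSum_arcKernel0 hVt
  have hB := hasSum_arcKernel1 hVt
  have hA' := (hasSum_nat_add_iff' 1).2 hA
  have hB' := (hasSum_nat_add_iff' 1).2 hB
  refine hasSum_of_hasSum_succ
    (((hA'.mul_left (β ^ 2)).add (hA.mul_left (c / d * t))).add (hB'.mul_left (c / d)))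
    (fun n => ?_) ?_
  · simp only [limitCoeff, mul_pow]
    ring
  · simp only [limitKernel, Finset.sum_range_one, pow_zero, limitCoeff]
    ring

end limitCoeff

/-! ### The activation of the quasi neural network -/

/-- `Φ (ν / ς)`, the derivative of the activation of the quasi neural network. -/
def quasiActDeriv (ς ν : ℝ) : ℝ := cdf (gaussianReal 0 1) (ν / ς)

lemma cdf_gaussian_eq_integral (t : ℝ) :
    cdf (gaussianReal 0 1) t = ∫ x in Set.Iic t, gaussianPDFReal 0 1 x := by
  rw [cdf_eq_real, measureReal_def, gaussianReal_apply_eq_integral _ one_ne_zero,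
    ENNReal.toReal_ofReal]
  exact integral_nonneg fun x => gaussianPDFReal_nonneg _ _ _

lemma continuous_gaussianPDFReal : Continuous (gaussianPDFReal 0 1) := by
  unfold gaussianPDFReal
  fun_prop

lemma hasDerivAt_gaussianPDFReal (t : ℝ) :
    HasDerivAt (gaussianPDFReal 0 1) (-t * gaussianPDFReal 0 1 t) t := by
  have h := (((hasDerivAt_pow 2 t).neg.div_const 2).exp).const_mul (√(2 * Real.pi))⁻¹
  have e : gaussianPDFReal 0 1 = fun x : ℝ => (√(2 * Real.pi))⁻¹ * Real.exp (-x ^ 2 / 2) := by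
    funext x; simp [gaussianPDFReal]
  rw [e]
  refine h.congr_deriv ?_
  simp only [Pi.neg_apply]
  push_cast
  ring

lemma hasDerivAt_cdf_gaussian (t : ℝ) :
    HasDerivAt (cdf (gaussianReal 0 1)) (gaussianPDFReal 0 1 t) t := by
  have hi := integrable_gaussianPDFReal 0 1
  have e : (cdf (gaussianReal 0 1) : ℝ → ℝ) = fun t => (∫ x in (0 : ℝ)..t, gaussianPDFReal 0 1 x)
      + ∫ x in Set.Iic 0, gaussianPDFReal 0 1 x := by
    funext t
    rw [cdf_gaussian_eq_integral, ← intervalIntegral.integral_Iic_sub_Iic hi.integrableOn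
      hi.integrableOn, sub_add_cancel]
  rw [e]
  exact (intervalIntegral.integral_hasDerivAt_right hi.intervalIntegrable
    (continuous_gaussianPDFReal.stronglyMeasurableAtFilter _ _)
    continuous_gaussianPDFReal.continuousAt).add_const _

lemma hasDerivAt_quasiAct {ς : ℝ} (hς : 0 < ς) (ν : ℝ) :
    HasDerivAt (quasiAct ς) (quasiActDeriv ς ν) ν := by
  have hd : HasDerivAt (fun ν : ℝ => ν / ς) (1 / ς) ν := (hasDerivAt_id ν).div_const ς
  have h1 := ((hasDerivAt_gaussianPDFReal (ν / ς)).comp ν hd).const_mul ς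
  have h2 := (hasDerivAt_id ν).mul ((hasDerivAt_cdf_gaussian (ν / ς)).comp ν hd)
  refine (h1.add h2).congr_deriv ?_
  simp only [quasiActDeriv, Function.comp_apply, id]
  field_simp
  ring

lemma continuous_quasiAct {ς : ℝ} (hς : 0 < ς) : Continuous (quasiAct ς) :=
  continuous_iff_continuousAt.2 fun ν => (hasDerivAt_quasiAct hς ν).continuousAt

lemma continuous_quasiActDeriv (ς : ℝ) : Continuous (quasiActDeriv ς) := by
  have : Continuous (cdf (gaussianReal 0 1) : ℝ → ℝ) :=
    continuous_iff_continuousAt.2 fun ν => (hasDerivAt_cdf_gaussian ν).continuousAt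
  exact this.comp (continuous_id.div_const ς)

lemma quasiActDeriv_nonneg (ς ν : ℝ) : 0 ≤ quasiActDeriv ς ν := cdf_nonneg _ _

lemma quasiActDeriv_le_one (ς ν : ℝ) : quasiActDeriv ς ν ≤ 1 := cdf_le_one _ _

lemma gaussianPDFReal_le_one (t : ℝ) : gaussianPDFReal 0 1 t ≤ 1 := by
  have h1 : (√(2 * Real.pi))⁻¹ ≤ 1 := inv_le_one_of_one_le₀ (by
    rw [Real.one_le_sqrt]; exact one_le_two_pi)
  have h2 : Real.exp (-(t - 0) ^ 2 / (2 * ((1 : NNReal) : ℝ))) ≤ 1 := Real.exp_le_one_iff.2 (by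
    have := sq_nonneg t
    simp only [sub_zero, NNReal.coe_one]; linarith)
  simp only [gaussianPDFReal, NNReal.coe_one, mul_one] at h2 ⊢
  exact mul_le_one₀ h1 (Real.exp_nonneg _) h2

lemma abs_quasiAct_le {ς : ℝ} (hς : 0 < ς) (ν : ℝ) : |quasiAct ς ν| ≤ |ν| + ς := by
  rw [quasiAct]
  refine (abs_add_le _ _).trans ?_
  rw [abs_mul, abs_mul, abs_of_pos hς, abs_of_nonneg (gaussianPDFReal_nonneg _ _ _),
    abs_of_nonneg (cdf_nonneg _ _), add_comm |ν|]
  exact add_le_add (mul_le_of_le_one_right hς.le (gaussianPDFReal_le_one _))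
    (mul_le_of_le_one_right (abs_nonneg _) (cdf_le_one _ _))

/-- The derivative of the activation is the probability that a Gaussian variable with mean `ν` and
standard deviation `ς` is nonnegative. -/
lemma quasiActDeriv_eq_integral {ς : ℝ} (hς : 0 < ς) (ν : ℝ) :
    quasiActDeriv ς ν
      = ∫ z, (Set.Ici (0 : ℝ)).indicator (fun _ => (1 : ℝ)) (ν - ς * z) ∂gaussianReal 0 1 := by
  have e : (fun z => (Set.Ici (0 : ℝ)).indicator (fun _ => (1 : ℝ)) (ν - ς * z))
      = (Set.Iic (ν / ς)).indicator fun _ => (1 : ℝ) := by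
    funext z
    have : 0 ≤ ν - ς * z ↔ z ≤ ν / ς := by rw [le_div_iff₀ hς, sub_nonneg, mul_comm]
    simp only [Set.indicator, Set.mem_Ici, Set.mem_Iic, this]
  rw [e, integral_indicator measurableSet_Iic, quasiActDeriv, cdf_eq_real]
  simp

/-- The activation is the mean of the positive part of a Gaussian variable with mean `ν` and
standard deviation `ς`. -/
lemma quasiAct_eq_integral {ς : ℝ} (hς : 0 < ς) (ν : ℝ) :
    quasiAct ς ν = ∫ z, max (ν - ς * z) 0 ∂gaussianReal 0 1 := by
  have hi := integrable_gaussianPDFReal 0 1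
  have hzi : Integrable (fun z => z * gaussianPDFReal 0 1 z) := by
    have h := (integrable_mul_exp_neg_mul_sq (b := 1 / 2) (by norm_num)).const_mul
      (√(2 * Real.pi))⁻¹
    refine h.congr (ae_of_all _ fun z => ?_)
    simp only [gaussianPDFReal, NNReal.coe_one, sub_zero, mul_one]
    rw [show -z ^ 2 / 2 = -(1 / 2) * z ^ 2 by ring]
    ring
  have htail : Tendsto (gaussianPDFReal 0 1) atBot (𝓝 0) := by
    have h : Tendsto (fun x : ℝ => -x ^ 2 / 2) atBot atBot := by
      have : Tendsto (fun x : ℝ => x ^ 2 / 2) atBot atTop := by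
        refine Tendsto.atTop_div_const two_pos ?_
        have := (tendsto_pow_atTop (α := ℝ) two_ne_zero).comp tendsto_neg_atBot_atTop
        exact this.congr fun x => by simp
      exact (tendsto_neg_atTop_atBot.comp this).congr fun x => by simp [neg_div]
    have := (Real.tendsto_exp_atBot.comp h).const_mul (√(2 * Real.pi))⁻¹
    rw [mul_zero] at this
    exact this.congr fun x => by simp [gaussianPDFReal]
  have hz : ∫ z in Set.Iic (ν / ς), z * gaussianPDFReal 0 1 z = -gaussianPDFReal 0 1 (ν / ς) := by
    have := integral_Iic_of_hasDerivAt_of_tendsto' (a := ν / ς)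
      (f := fun z => -gaussianPDFReal 0 1 z) (f' := fun z => z * gaussianPDFReal 0 1 z) (m := 0)
      (fun x _ => ((hasDerivAt_gaussianPDFReal x).neg).congr_deriv (by ring))
      hzi.integrableOn (by simpa using htail.neg)
    rw [this, sub_zero]
  have e : ∀ z, gaussianPDFReal 0 1 z * max (ν - ς * z) 0
      = (Set.Iic (ν / ς)).indicator
        (fun z => ν * gaussianPDFReal 0 1 z - ς * (z * gaussianPDFReal 0 1 z)) z := by
    intro z
    have : 0 ≤ ν - ς * z ↔ z ≤ ν / ς := by rw [le_div_iff₀ hς, sub_nonneg, mul_comm]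
    by_cases h : z ≤ ν / ς
    · rw [Set.indicator_of_mem (Set.mem_Iic.2 h), max_eq_left (this.2 h)]; ring
    · rw [Set.indicator_of_notMem (by simpa using h), max_eq_right, mul_zero]
      exact (not_le.1 fun h' => h (this.1 h')).le
  rw [integral_gaussianReal_eq_integral_smul one_ne_zero]
  simp only [smul_eq_mul, e]
  rw [integral_indicator measurableSet_Iic, integral_sub (hi.const_mul _).integrableOn
    (hzi.const_mul _).integrableOn, integral_const_mul, integral_const_mul, hz,
    ← cdf_gaussian_eq_integral, quasiAct]
  ring

lemma quasiAct_nonneg {ς : ℝ} (hς : 0 < ς) (ν : ℝ) : 0 ≤ quasiAct ς ν := by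
  rw [quasiAct_eq_integral hς]
  exact integral_nonneg fun z => le_max_right _ _

/-! ### The neural tangent kernel at finite width -/

section ntk

variable {d d₁ d₂ : ℕ} {c β ς : ℝ}

lemma dθ_eq (hς : 0 < ς) (p : Params d d₁ d₂) (x : EuclideanSpace ℝ (Fin d)) (i : Fin d₁)
    (j : Fin d₂) :
    dθ c β ς p x i j = 1 / √d₂ * (p.w₂ j * (quasiActDeriv ς (preAct c β p x j) *
      (√(c / d₁) * layerOne p x i))) := by
  set q : ℝ → Params d d₁ d₂ := fun s =>
    { p with θ := Function.update p.θ i (Function.update (p.θ i) j s) } with hq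
  have hself : q (p.θ i j) = p := by simp [hq]
  have hpre : ∀ j', HasDerivAt (fun s => preAct c β (q s) x j')
      (if j' = j then √(c / d₁) * layerOne p x i else 0) (p.θ i j) := by
    intro j'
    have hterm : ∀ i' : Fin d₁, HasDerivAt (fun s => (q s).θ i' j' * layerOne (q s) x i')
        (if i' = i then (if j' = j then layerOne p x i' else 0) else 0) (p.θ i j) := by
      intro i'
      have hl : ∀ s, layerOne (q s) x i' = layerOne p x i' := fun s => rfl
      simp only [hl]
      by_cases hi : i' = i
      · subst hi
        by_cases hj : j' = j
        · subst hj
          simpa [hq] using (hasDerivAt_id (p.θ i' j')).mul_const (layerOne p x i')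
        · simpa [hq, hj] using hasDerivAt_const (p.θ i' j) (p.θ i' j' * layerOne p x i')
      · simpa [hq, hi] using hasDerivAt_const (p.θ i j) (p.θ i' j' * layerOne p x i')
    have hs := HasDerivAt.fun_sum (u := Finset.univ) fun i' _ => hterm i'
    rw [Finset.sum_ite_eq' Finset.univ i, if_pos (Finset.mem_univ i)] at hs
    refine ((hs.const_mul (√(c / d₁))).add_const (β * p.b₁ j')).congr_deriv ?_
    split_ifs <;> simp
  have hout : HasDerivAt (fun s => output c β ς (q s) x)
      (1 / √d₂ * ∑ j', p.w₂ j' * (quasiActDeriv ς (preAct c β p x j') *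
        (if j' = j then √(c / d₁) * layerOne p x i else 0))) (p.θ i j) := by
    refine HasDerivAt.add_const (β * p.b₂) (HasDerivAt.const_mul _ (HasDerivAt.fun_sum fun j' _ => ?_))
    refine HasDerivAt.const_mul (p.w₂ j') ?_
    have := (hasDerivAt_quasiAct hς (preAct c β (q (p.θ i j)) x j')).comp (p.θ i j) (hpre j')
    rwa [hself] at this
  rw [dθ, hout.deriv]
  simp

lemma db₁_eq (hς : 0 < ς) (p : Params d d₁ d₂) (x : EuclideanSpace ℝ (Fin d)) (j : Fin d₂) :
    db₁ c β ς p x j = 1 / √d₂ * (p.w₂ j * (quasiActDeriv ς (preAct c β p x j) * β)) := by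
  set q : ℝ → Params d d₁ d₂ := fun s => { p with b₁ := Function.update p.b₁ j s } with hq
  have hself : q (p.b₁ j) = p := by simp [hq]
  have hpre : ∀ j', HasDerivAt (fun s => preAct c β (q s) x j') (if j' = j then β else 0)
      (p.b₁ j) := by
    intro j'
    have hb : HasDerivAt (fun s => β * (q s).b₁ j') (if j' = j then β else 0) (p.b₁ j) := by
      by_cases hj : j' = j
      · subst hj
        simpa [hq] using (hasDerivAt_id (p.b₁ j')).const_mul β
      · simpa [hq, hj] using hasDerivAt_const (p.b₁ j) (β * p.b₁ j')
    exact hb.const_add (√(c / d₁) * ∑ i, p.θ i j' * layerOne p x i)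
  have hout : HasDerivAt (fun s => output c β ς (q s) x)
      (1 / √d₂ * ∑ j', p.w₂ j' * (quasiActDeriv ς (preAct c β p x j') *
        (if j' = j then β else 0))) (p.b₁ j) := by
    refine HasDerivAt.add_const (β * p.b₂) (HasDerivAt.const_mul _ (HasDerivAt.fun_sum fun j' _ => ?_))
    refine HasDerivAt.const_mul (p.w₂ j') ?_
    have := (hasDerivAt_quasiAct hς (preAct c β (q (p.b₁ j)) x j')).comp (p.b₁ j) (hpre j')
    rwa [hself] at this
  rw [db₁, hout.deriv]
  simp

lemma dw₂_eq (p : Params d d₁ d₂) (x : EuclideanSpace ℝ (Fin d)) (j : Fin d₂) :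
    dw₂ c β ς p x j = 1 / √d₂ * quasiAct ς (preAct c β p x j) := by
  have hout : HasDerivAt (fun s => output c β ς { p with w₂ := Function.update p.w₂ j s } x)
      (1 / √d₂ * ∑ j', if j' = j then quasiAct ς (preAct c β p x j') else 0) (p.w₂ j) := by
    refine HasDerivAt.add_const (β * p.b₂) (HasDerivAt.const_mul _ (HasDerivAt.fun_sum fun j' _ => ?_))
    have hpre : ∀ s, preAct c β { p with w₂ := Function.update p.w₂ j s } x j' = preAct c β p x j' :=
      fun s => rfl
    simp only [hpre]
    by_cases hj : j' = j
    · subst hj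
      simpa using (hasDerivAt_id (p.w₂ j')).mul_const (quasiAct ς (preAct c β p x j'))
    · simpa [hj] using hasDerivAt_const (p.w₂ j) (p.w₂ j' * quasiAct ς (preAct c β p x j'))
  rw [dw₂, hout.deriv]
  simp

/-- The neural tangent kernel as an explicit combination of averages over the two hidden layers. -/
lemma ntk_eq (hς : 0 < ς) (hc : 0 < c) (p : Params d d₁ d₂) (x x' : EuclideanSpace ℝ (Fin d)) :
    ntk c β ς p x x' =
      (c * (1 / d₁ * ∑ i, layerOne p x i * layerOne p x' i) + β ^ 2) *
        (1 / d₂ * ∑ j, p.w₂ j ^ 2 *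
          (quasiActDeriv ς (preAct c β p x j) * quasiActDeriv ς (preAct c β p x' j)))
      + 1 / d₂ * ∑ j, quasiAct ς (preAct c β p x j) * quasiAct ς (preAct c β p x' j) := by
  have hd2 : (1 / √(d₂ : ℝ)) * (1 / √(d₂ : ℝ)) = 1 / d₂ := by
    rw [div_mul_div_comm, one_mul, Real.mul_self_sqrt (Nat.cast_nonneg _)]
  have hd1 : √(c / d₁) * √(c / d₁) = c / d₁ := Real.mul_self_sqrt (by positivity)
  have e1 : ∀ i j, dθ c β ς p x i j * dθ c β ς p x' i j
      = (c * (1 / d₁ * (layerOne p x i * layerOne p x' i))) * (1 / d₂ * (p.w₂ j ^ 2 *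
        (quasiActDeriv ς (preAct c β p x j) * quasiActDeriv ς (preAct c β p x' j)))) := by
    intro i j
    rw [dθ_eq hς, dθ_eq hς, ← hd2]
    calc _ = (√(c / d₁) * √(c / d₁)) * (layerOne p x i * layerOne p x' i) *
          ((1 / √d₂) * (1 / √d₂) * (p.w₂ j ^ 2 * (quasiActDeriv ς (preAct c β p x j) *
            quasiActDeriv ς (preAct c β p x' j)))) := by ring
      _ = _ := by rw [hd1]; ring
  have e2 : ∀ j, db₁ c β ς p x j * db₁ c β ς p x' j
      = β ^ 2 * (1 / d₂ * (p.w₂ j ^ 2 *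
        (quasiActDeriv ς (preAct c β p x j) * quasiActDeriv ς (preAct c β p x' j)))) := by
    intro j
    rw [db₁_eq hς, db₁_eq hς, ← hd2]
    ring
  have e3 : ∀ j, dw₂ c β ς p x j * dw₂ c β ς p x' j
      = 1 / d₂ * (quasiAct ς (preAct c β p x j) * quasiAct ς (preAct c β p x' j)) := by
    intro j
    rw [dw₂_eq, dw₂_eq, ← hd2]
    ring
  simp only [ntk, e1, e2, e3]
  simp only [← Finset.mul_sum, ← Finset.sum_mul]
  ring

end ntk

/-! ### Gaussian means of products of ramps -/

/-- The standard Gaussian law on `ℝ × ℝ`. -/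
abbrev stdGauss2 : Measure (ℝ × ℝ) := (gaussianReal 0 1).prod (gaussianReal 0 1)

/-- The ramp `x ↦ x ^ m` on `[0, ∞)`, extended by zero. -/
def ramp (m : ℕ) (x : ℝ) : ℝ := if 0 ≤ x then x ^ m else 0

lemma ramp_nonneg (m : ℕ) (x : ℝ) : 0 ≤ ramp m x := by
  unfold ramp; split_ifs with h <;> positivity

lemma ramp_zero_eq (x : ℝ) : ramp 0 x = (Set.Ici (0 : ℝ)).indicator (fun _ => (1 : ℝ)) x := by
  simp [ramp, Set.indicator]

lemma ramp_one_eq (x : ℝ) : ramp 1 x = max x 0 := by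
  unfold ramp
  split_ifs with h
  · rw [pow_one, max_eq_left h]
  · rw [max_eq_right (not_le.1 h).le]

lemma ramp_mul {a : ℝ} (ha : 0 < a) (m : ℕ) (x : ℝ) : ramp m (a * x) = a ^ m * ramp m x := by
  simp only [ramp, mul_nonneg_iff_of_pos_left ha, mul_pow, mul_ite, mul_zero]

lemma measurable_ramp (m : ℕ) : Measurable (ramp m) :=
  Measurable.ite measurableSet_Ici (measurable_id.pow_const m) measurable_const

lemma ramp_le {m : ℕ} (hm : m ≤ 1) (x : ℝ) : ramp m x ≤ 1 + |x| := by
  unfold ramp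
  have := abs_nonneg x
  split_ifs
  · interval_cases m
    · simp
    · rw [pow_one]; linarith [le_abs_self x]
  · positivity

lemma integral_stdGauss2 (f : ℝ × ℝ → ℝ) :
    ∫ p, f p ∂stdGauss2
      = 1 / (2 * Real.pi) * ∫ p : ℝ × ℝ, Real.exp (-(p.1 ^ 2 + p.2 ^ 2) / 2) * f p := by
  rw [stdGauss2, gaussianReal_of_var_ne_zero 0 one_ne_zero,
    prod_withDensity (measurable_gaussianPDF _ _) (measurable_gaussianPDF _ _),
    integral_withDensity_eq_integral_toReal_smul
      (f := fun z : ℝ × ℝ => gaussianPDF 0 1 z.1 * gaussianPDF 0 1 z.2)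
      (((measurable_gaussianPDF _ _).comp measurable_fst).mul
        ((measurable_gaussianPDF _ _).comp measurable_snd))
      (ae_of_all _ fun _ => ENNReal.mul_lt_top gaussianPDF_lt_top gaussianPDF_lt_top),
    ← integral_const_mul]
  rw [← Measure.volume_eq_prod]
  refine integral_congr_ae (ae_of_all _ fun p => ?_)
  simp only [ENNReal.toReal_mul, toReal_gaussianPDF, gaussianPDFReal, NNReal.coe_one, mul_one,
    sub_zero, smul_eq_mul]
  have h : (√(2 * Real.pi))⁻¹ * (√(2 * Real.pi))⁻¹ = 1 / (2 * Real.pi) := by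
    rw [← mul_inv, Real.mul_self_sqrt (by positivity), one_div]
  rw [show -(p.1 ^ 2 + p.2 ^ 2) / 2 = -p.1 ^ 2 / 2 + -p.2 ^ 2 / 2 by ring, Real.exp_add, ← h]
  ring

/-- The two half-planes `cos θ ≥ 0` and `cos (θ - φ) ≥ 0` meet in a single sector. -/
lemma cos_nonneg_and_cos_sub_nonneg_iff {φ θ : ℝ} (hφ0 : 0 < φ) (hφ1 : φ < Real.pi)
    (hθ : θ ∈ Set.Ioo (-Real.pi) Real.pi) :
    (0 ≤ Real.cos θ ∧ 0 ≤ Real.cos (θ - φ)) ↔ θ ∈ Set.Icc (φ - Real.pi / 2) (Real.pi / 2) := by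
  obtain ⟨h1, h2⟩ := hθ
  have hπ := Real.pi_pos
  constructor
  · rintro ⟨ha, hb⟩
    have hθ2 : θ ≤ Real.pi / 2 := by
      by_contra h
      exact absurd ha (not_le.2 (Real.cos_neg_of_pi_div_two_lt_of_lt (not_le.1 h) (by linarith)))
    have hθ1 : -(Real.pi / 2) ≤ θ := by
      by_contra h
      have := Real.cos_neg_of_pi_div_two_lt_of_lt (x := -θ) (by linarith) (by linarith)
      rw [Real.cos_neg] at this
      linarith
    refine ⟨?_, hθ2⟩
    by_contra h
    have := Real.cos_neg_of_pi_div_two_lt_of_lt (x := -(θ - φ)) (by linarith) (by linarith)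
    rw [Real.cos_neg] at this
    linarith
  · rintro ⟨ha, hb⟩
    exact ⟨Real.cos_nonneg_of_mem_Icc ⟨by linarith, hb⟩,
      Real.cos_nonneg_of_mem_Icc ⟨by linarith, by linarith⟩⟩

/-- Polar coordinates for two standard Gaussian variables with correlation `cos φ`. -/
lemma integral_ramp_mul_ramp (m : ℕ) {φ : ℝ} (hφ0 : 0 < φ) (hφ1 : φ < Real.pi) :
    ∫ p, ramp m p.1 * ramp m (Real.cos φ * p.1 + Real.sin φ * p.2) ∂stdGauss2
      = 1 / (2 * Real.pi) * ((∫ r in Set.Ioi (0 : ℝ), r ^ (2 * m + 1) * Real.exp (-r ^ 2 / 2)) *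
        ∫ θ in (φ - Real.pi / 2)..(Real.pi / 2), (Real.cos θ * Real.cos (θ - φ)) ^ m) := by
  have hπ := Real.pi_pos
  rw [integral_stdGauss2, ← integral_comp_polarCoord_symm, polarCoord_target]
  congr 1
  have hle : φ - Real.pi / 2 ≤ Real.pi / 2 := by linarith
  have hang : ∫ θ in (φ - Real.pi / 2)..(Real.pi / 2), (Real.cos θ * Real.cos (θ - φ)) ^ m
      = ∫ θ in Set.Ioo (-Real.pi) Real.pi, ramp m (Real.cos θ) * ramp m (Real.cos (θ - φ)) := by
    have hsub : Set.Icc (φ - Real.pi / 2) (Real.pi / 2) ⊆ Set.Ioo (-Real.pi) Real.pi :=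
      fun θ hθ => ⟨by linarith [hθ.1], by linarith [hθ.2]⟩
    rw [intervalIntegral.integral_of_le hle, ← integral_Icc_eq_integral_Ioc,
      ← Set.inter_eq_self_of_subset_right hsub, ← setIntegral_indicator measurableSet_Icc]
    refine setIntegral_congr_fun measurableSet_Ioo fun θ hθ => ?_
    have hiff := cos_nonneg_and_cos_sub_nonneg_iff hφ0 hφ1 hθ
    by_cases h : θ ∈ Set.Icc (φ - Real.pi / 2) (Real.pi / 2)
    · simp only [Set.indicator_of_mem h, ramp, if_pos (hiff.2 h).1, if_pos (hiff.2 h).2, mul_pow]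
    · rw [Set.indicator_of_notMem h]
      rcases not_and_or.1 (fun h' => h (hiff.1 h')) with h' | h' <;> simp [ramp, h']
  rw [hang, ← setIntegral_prod_mul, ← Measure.volume_eq_prod]
  refine setIntegral_congr_fun (measurableSet_Ioi.prod measurableSet_Ioo) fun p hp => ?_
  have hr : 0 < p.1 := hp.1
  have e : Real.cos φ * (p.1 * Real.cos p.2) + Real.sin φ * (p.1 * Real.sin p.2)
      = p.1 * Real.cos (p.2 - φ) := by rw [Real.cos_sub]; ring
  have e2 : (p.1 * Real.cos p.2) ^ 2 + (p.1 * Real.sin p.2) ^ 2 = p.1 ^ 2 := by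
    rw [mul_pow, mul_pow, ← mul_add, Real.cos_sq_add_sin_sq, mul_one]
  simp only [polarCoord_symm_apply, smul_eq_mul]
  rw [e, e2, ramp_mul hr, ramp_mul hr]
  ring

lemma integral_radial (m : ℕ) :
    ∫ r in Set.Ioi (0 : ℝ), r ^ (2 * m + 1) * Real.exp (-r ^ 2 / 2) = 2 ^ m * m.factorial := by
  have h := integral_rpow_mul_exp_neg_mul_rpow (p := 2) (q := (2 * m + 1 : ℕ)) (b := 1 / 2) two_pos
    (by have : (0 : ℝ) ≤ ((2 * m + 1 : ℕ) : ℝ) := by positivity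
        linarith) (by norm_num)
  have e1 : (((2 * m + 1 : ℕ) : ℝ) + 1) / 2 = m + 1 := by push_cast; ring
  have e2 : -(((2 * m + 1 : ℕ) : ℝ) + 1) / 2 = -((m + 1 : ℕ) : ℝ) := by push_cast; ring
  rw [e1, Real.Gamma_nat_eq_factorial, e2, Real.rpow_neg (by norm_num), Real.rpow_natCast] at h
  calc _ = ∫ x in Set.Ioi (0 : ℝ), x ^ ((2 * m + 1 : ℕ) : ℝ) * Real.exp (-(1 / 2) * x ^ (2 : ℝ)) := by
        refine setIntegral_congr_fun measurableSet_Ioi fun r _ => ?_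
        simp only [Real.rpow_natCast, Real.rpow_two]
        rw [show -r ^ 2 / 2 = -(1 / 2) * r ^ 2 by ring]
    _ = _ := by
        rw [h, one_div, inv_pow, inv_inv, pow_succ]
        ring

lemma integral_ramp_zero {ρ : ℝ} (h0 : -1 < ρ) (h1 : ρ < 1) :
    ∫ p, ramp 0 p.1 * ramp 0 (ρ * p.1 + √(1 - ρ ^ 2) * p.2) ∂stdGauss2 = arcKernel0 ρ := by
  have h := integral_ramp_mul_ramp 0 (Real.arccos_pos.2 h1) (φ := Real.arccos ρ)
    (lt_of_le_of_ne (Real.arccos_le_pi _) fun h => by rw [Real.arccos_eq_pi] at h; linarith)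
  rw [Real.cos_arccos h0.le h1.le, Real.sin_arccos, integral_radial] at h
  rw [h, arcKernel0, Real.arcsin_eq_pi_div_two_sub_arccos]
  simp
  field_simp
  ring

lemma integral_ramp_one {ρ : ℝ} (h0 : -1 < ρ) (h1 : ρ < 1) :
    ∫ p, ramp 1 p.1 * ramp 1 (ρ * p.1 + √(1 - ρ ^ 2) * p.2) ∂stdGauss2 = arcKernel1 ρ := by
  have h := integral_ramp_mul_ramp 1 (Real.arccos_pos.2 h1) (φ := Real.arccos ρ)
    (lt_of_le_of_ne (Real.arccos_le_pi _) fun h => by rw [Real.arccos_eq_pi] at h; linarith)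
  rw [Real.cos_arccos h0.le h1.le, Real.sin_arccos, integral_radial] at h
  rw [h, arcKernel1, Real.arcsin_eq_pi_div_two_sub_arccos]
  set φ := Real.arccos ρ with hφ
  have hc : Real.cos φ = ρ := Real.cos_arccos h0.le h1.le
  have hs : Real.sin φ = √(1 - ρ ^ 2) := Real.sin_arccos ρ
  have hint : ∫ θ in (φ - Real.pi / 2)..(Real.pi / 2), (Real.cos θ * Real.cos (θ - φ)) ^ 1
      = (√(1 - ρ ^ 2) + (Real.pi - φ) * ρ) / 2 := by
    have hder : ∀ θ : ℝ, HasDerivAt (fun θ => (Real.sin (2 * θ - φ) / 2 + θ * ρ) / 2)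
        ((Real.cos θ * Real.cos (θ - φ)) ^ 1) θ := by
      intro θ
      have h1 : HasDerivAt (fun θ : ℝ => 2 * θ - φ) 2 θ := by
        simpa using ((hasDerivAt_id θ).const_mul 2).sub_const φ
      refine ((((Real.hasDerivAt_sin _).comp θ h1).div_const 2).add
        ((hasDerivAt_id θ).mul_const ρ) |>.div_const 2).congr_deriv ?_
      have e1 : Real.cos (2 * θ - φ) = _ :=
        (congrArg Real.cos (by ring : 2 * θ - φ = θ + (θ - φ))).trans (Real.cos_add θ (θ - φ))
      have e2 : Real.cos (θ - (θ - φ)) = _ := Real.cos_sub θ (θ - φ)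
      rw [sub_sub_cancel, hc] at e2
      linear_combination e1 / 2 + e2 / 2
    rw [intervalIntegral.integral_eq_sub_of_hasDerivAt (fun θ _ => hder θ)
      (by apply Continuous.intervalIntegrable; fun_prop)]
    have e3 : Real.sin (2 * (Real.pi / 2) - φ) = √(1 - ρ ^ 2) := by
      rw [mul_div_cancel₀ _ two_ne_zero, Real.sin_pi_sub, hs]
    have e4 : Real.sin (2 * (φ - Real.pi / 2) - φ) = -√(1 - ρ ^ 2) := by
      rw [show 2 * (φ - Real.pi / 2) - φ = -(Real.pi - φ) by ring, Real.sin_neg, Real.sin_pi_sub, hs]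
    rw [e3, e4]
    ring
  rw [hint]
  simp
  field_simp
  ring

/-! ### Joint Gaussian laws -/

lemma map_add_prod {α α' : Type*} [MeasurableSpace α] [MeasurableSpace α'] (μ : Measure α)
    (ν : Measure α') [IsFiniteMeasure μ] [IsFiniteMeasure ν] {f : α → ℝ} {g : α' → ℝ}
    (hf : Measurable f) (hg : Measurable g) :
    (μ.prod ν).map (fun p => f p.1 + g p.2) = (μ.map f).conv (ν.map g) := by
  rw [Measure.conv, Measure.map_prod_map _ _ hf hg, Measure.map_map (by fun_prop) (by fun_prop)]
  rfl

lemma map_linear_stdGauss2 (a b : ℝ) :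
    stdGauss2.map (fun p => a * p.1 + b * p.2) = gaussianReal 0 (Real.toNNReal (a ^ 2 + b ^ 2)) := by
  rw [map_add_prod (gaussianReal 0 1) (gaussianReal 0 1) (f := fun x => a * x) (g := fun x => b * x)
    (by fun_prop) (by fun_prop), gaussianReal_map_const_mul, gaussianReal_map_const_mul,
    gaussianReal_conv_gaussianReal, mul_zero, mul_zero, add_zero]
  congr 1
  rw [Real.toNNReal_add (sq_nonneg _) (sq_nonneg _), mul_one, mul_one]
  congr 1 <;> exact (Real.toNNReal_of_nonneg (sq_nonneg _)).symm

lemma map_linear_stdGauss4 (a b a' b' : ℝ) :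
    (stdGauss2.prod stdGauss2).map
        (fun w => (a * w.1.1 + b * w.1.2) + (a' * w.2.1 + b' * w.2.2))
      = gaussianReal 0 (Real.toNNReal (a ^ 2 + b ^ 2 + (a' ^ 2 + b' ^ 2))) := by
  rw [map_add_prod stdGauss2 stdGauss2 (f := fun p => a * p.1 + b * p.2)
    (g := fun p => a' * p.1 + b' * p.2) (by fun_prop) (by fun_prop), map_linear_stdGauss2,
    map_linear_stdGauss2, gaussianReal_conv_gaussianReal, add_zero,
    ← Real.toNNReal_add (by positivity) (by positivity)]

/-- Adding independent Gaussian noise of variance `ς²` to two Gaussian variables with variance `σ²`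
and correlation `t` yields Gaussian variables with correlation `V t`, where
`V = σ² / (σ² + ς²)`. -/
lemma map_smoothed_stdGauss {τ σ ς t V : ℝ} (hV : σ ^ 2 = τ ^ 2 * V)
    (hς : ς ^ 2 = τ ^ 2 * (1 - V)) (h0 : 0 < V) (h1 : V < 1) (ht : |t| ≤ 1) :
    (stdGauss2.prod stdGauss2).map (fun w =>
        (σ * w.1.1 - ς * w.2.1, σ * (t * w.1.1 + √(1 - t ^ 2) * w.1.2) - ς * w.2.2))
      = stdGauss2.map fun p =>
        (τ * p.1, τ * (V * t * p.1 + √(1 - (V * t) ^ 2) * p.2)) := by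
  have hm1 : Measurable fun w : (ℝ × ℝ) × (ℝ × ℝ) =>
      (σ * w.1.1 - ς * w.2.1, σ * (t * w.1.1 + √(1 - t ^ 2) * w.1.2) - ς * w.2.2) := by fun_prop
  have hm2 : Measurable fun p : ℝ × ℝ =>
      (τ * p.1, τ * (V * t * p.1 + √(1 - (V * t) ^ 2) * p.2)) := by fun_prop
  have := Measure.isProbabilityMeasure_map (μ := stdGauss2.prod stdGauss2) hm1.aemeasurable
  have := Measure.isProbabilityMeasure_map (μ := stdGauss2) hm2.aemeasurable
  have ht2 : t ^ 2 ≤ 1 := (sq_le_one_iff_abs_le_one t).2 ht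
  have hVt2 : (V * t) ^ 2 ≤ 1 := by
    rw [mul_pow]; nlinarith [sq_nonneg t]
  refine Measure.ext_of_charFunDual ?_
  funext L
  rw [charFunDual_eq_charFun_map_one, charFunDual_eq_charFun_map_one,
    Measure.map_map (by fun_prop) hm1, Measure.map_map (by fun_prop) hm2]
  set a := L (1, 0) with ha
  set b := L (0, 1) with hb
  have hL : ∀ p : ℝ × ℝ, L p = a * p.1 + b * p.2 := by
    intro p
    have : p = p.1 • ((1 : ℝ), (0 : ℝ)) + p.2 • ((0 : ℝ), (1 : ℝ)) := by ext <;> simp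
    conv_lhs => rw [this]
    rw [map_add, map_smul, map_smul, smul_eq_mul, smul_eq_mul, ← ha, ← hb]
    ring
  have e1 : (L ∘ fun w : (ℝ × ℝ) × (ℝ × ℝ) =>
      (σ * w.1.1 - ς * w.2.1, σ * (t * w.1.1 + √(1 - t ^ 2) * w.1.2) - ς * w.2.2))
      = fun w => ((a * σ + b * (σ * t)) * w.1.1 + b * (σ * √(1 - t ^ 2)) * w.1.2)
        + (-(a * ς) * w.2.1 + -(b * ς) * w.2.2) := by
    funext w
    simp only [Function.comp_apply, hL]
    ring
  have e2 : (L ∘ fun p : ℝ × ℝ => (τ * p.1, τ * (V * t * p.1 + √(1 - (V * t) ^ 2) * p.2)))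
      = fun p => (a * τ + b * (τ * (V * t))) * p.1 + b * (τ * √(1 - (V * t) ^ 2)) * p.2 := by
    funext w
    simp only [Function.comp_apply, hL]
    ring
  rw [e1, e2, map_linear_stdGauss4, map_linear_stdGauss2]
  congr 3
  have q1 : √(1 - t ^ 2) ^ 2 = 1 - t ^ 2 := Real.sq_sqrt (by linarith)
  have q2 : √(1 - (V * t) ^ 2) ^ 2 = 1 - (V * t) ^ 2 := Real.sq_sqrt (by linarith)
  linear_combination b ^ 2 * σ ^ 2 * q1 + (a ^ 2 + 2 * a * b * t + b ^ 2) * hV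
    + (a ^ 2 + b ^ 2) * hς - b ^ 2 * τ ^ 2 * q2

/-- The mean of the product of two ramps smoothed by Gaussian noise: the noises of the two factors
may be taken independent, and then `map_smoothed_stdGauss` applies. -/
lemma integral_smoothed_ramp {m : ℕ} (hm : m ≤ 1) {τ σ ς t V : ℝ} (hτ : 0 < τ)
    (hV : σ ^ 2 = τ ^ 2 * V) (hς : ς ^ 2 = τ ^ 2 * (1 - V)) (h0 : 0 < V) (h1 : V < 1)
    (ht : |t| ≤ 1) :
    ∫ p, (∫ z, ramp m (σ * p.1 - ς * z) ∂gaussianReal 0 1) *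
        (∫ z, ramp m (σ * (t * p.1 + √(1 - t ^ 2) * p.2) - ς * z) ∂gaussianReal 0 1) ∂stdGauss2
      = (τ ^ 2) ^ m *
        ∫ p, ramp m p.1 * ramp m (V * t * p.1 + √(1 - (V * t) ^ 2) * p.2) ∂stdGauss2 := by
  have hr := measurable_ramp m
  have hm1 : Measurable fun w : (ℝ × ℝ) × (ℝ × ℝ) =>
      (σ * w.1.1 - ς * w.2.1, σ * (t * w.1.1 + √(1 - t ^ 2) * w.1.2) - ς * w.2.2) := by fun_prop
  have hm2 : Measurable fun p : ℝ × ℝ =>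
      (τ * p.1, τ * (V * t * p.1 + √(1 - (V * t) ^ 2) * p.2)) := by fun_prop
  have hF : Measurable fun q : ℝ × ℝ => ramp m q.1 * ramp m q.2 :=
    (hr.comp measurable_fst).mul (hr.comp measurable_snd)
  have hid : MemLp (fun x : ℝ => x) 2 (gaussianReal 0 1) := memLp_id_gaussianReal' 2 (by simp)
  have hu : MemLp (fun w : (ℝ × ℝ) × (ℝ × ℝ) => w.1.1) 2 (stdGauss2.prod stdGauss2) :=
    (hid.comp_fst (gaussianReal 0 1)).comp_fst stdGauss2
  have hv : MemLp (fun w : (ℝ × ℝ) × (ℝ × ℝ) => w.1.2) 2 (stdGauss2.prod stdGauss2) :=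
    (hid.comp_snd (gaussianReal 0 1)).comp_fst stdGauss2
  have hz : MemLp (fun w : (ℝ × ℝ) × (ℝ × ℝ) => w.2.1) 2 (stdGauss2.prod stdGauss2) :=
    (hid.comp_fst (gaussianReal 0 1)).comp_snd stdGauss2
  have hz' : MemLp (fun w : (ℝ × ℝ) × (ℝ × ℝ) => w.2.2) 2 (stdGauss2.prod stdGauss2) :=
    (hid.comp_snd (gaussianReal 0 1)).comp_snd stdGauss2
  have hramp : ∀ {X : (ℝ × ℝ) × (ℝ × ℝ) → ℝ}, MemLp X 2 (stdGauss2.prod stdGauss2) →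
      MemLp (fun w => ramp m (X w)) 2 (stdGauss2.prod stdGauss2) := by
    intro X hX
    refine ((memLp_const (1 : ℝ)).add hX.norm).mono
      (hr.comp_aemeasurable hX.aestronglyMeasurable.aemeasurable).aestronglyMeasurable
      (ae_of_all _ fun w => ?_)
    rw [Real.norm_of_nonneg (ramp_nonneg _ _)]
    exact (ramp_le hm _).trans (le_abs_self _)
  have hint : Integrable (fun w : (ℝ × ℝ) × (ℝ × ℝ) => ramp m (σ * w.1.1 - ς * w.2.1) *
      ramp m (σ * (t * w.1.1 + √(1 - t ^ 2) * w.1.2) - ς * w.2.2)) (stdGauss2.prod stdGauss2) :=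
    (hramp ((hu.const_mul σ).sub (hz.const_mul ς))).integrable_mul
      (hramp ((((hu.const_mul t).add (hv.const_mul _)).const_mul σ).sub (hz'.const_mul ς)))
  calc _ = ∫ p, ∫ q : ℝ × ℝ, ramp m (σ * p.1 - ς * q.1) *
          ramp m (σ * (t * p.1 + √(1 - t ^ 2) * p.2) - ς * q.2) ∂stdGauss2 ∂stdGauss2 := by
        refine integral_congr_ae (ae_of_all _ fun p => ?_)
        exact (integral_prod_mul (μ := gaussianReal 0 1) (ν := gaussianReal 0 1)
          (fun z => ramp m (σ * p.1 - ς * z))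
          (fun z => ramp m (σ * (t * p.1 + √(1 - t ^ 2) * p.2) - ς * z))).symm
    _ = ∫ q, ramp m q.1 * ramp m q.2 ∂((stdGauss2.prod stdGauss2).map fun w =>
          (σ * w.1.1 - ς * w.2.1, σ * (t * w.1.1 + √(1 - t ^ 2) * w.1.2) - ς * w.2.2)) := by
        rw [integral_map hm1.aemeasurable hF.aestronglyMeasurable, ← integral_prod _ hint]
    _ = ∫ p : ℝ × ℝ, ramp m (τ * p.1) * ramp m (τ * (V * t * p.1 + √(1 - (V * t) ^ 2) * p.2))
          ∂stdGauss2 := by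
        rw [map_smoothed_stdGauss hV hς h0 h1 ht,
          integral_map hm2.aemeasurable hF.aestronglyMeasurable]
    _ = _ := by
        rw [← integral_const_mul]
        refine integral_congr_ae (ae_of_all _ fun p => ?_)
        simp only [ramp_mul hτ]
        ring

section condStd

variable {d : ℕ} {c V t : ℝ}

lemma condStd_pos (hd : 1 ≤ d) (hc : 0 < c) (h1 : V < 1) : 0 < condStd d c V := by
  have : (0 : ℝ) < d := by exact_mod_cast hd
  have : 0 < 1 - V := by linarith
  exact Real.sqrt_pos.2 (by positivity)

lemma abs_mul_lt_one (h0 : 0 < V) (h1 : V < 1) (ht : |t| ≤ 1) : |V * t| < 1 := by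
  rw [abs_mul, abs_of_pos h0]
  nlinarith [abs_nonneg t]

/-- The variance `c V / d` of the limiting pre-activations and the variance `c (1 - V) / d` of the
smoothing noise add up to `c / d`. -/
lemma integral_quasiActDeriv_mul (hd : 1 ≤ d) (hc : 0 < c) (h0 : 0 < V) (h1 : V < 1)
    (ht : |t| ≤ 1) :
    ∫ p, quasiActDeriv (condStd d c V) (√(c / d * V) * p.1) *
        quasiActDeriv (condStd d c V) (√(c / d * V) * (t * p.1 + √(1 - t ^ 2) * p.2)) ∂stdGauss2
      = arcKernel0 (V * t) := by
  have hd' : (0 : ℝ) < d := by exact_mod_cast hd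
  have hV' : 0 ≤ 1 - V := by linarith
  have hς := condStd_pos hd hc h1
  have hVt := abs_lt.1 (abs_mul_lt_one h0 h1 ht)
  have h := integral_smoothed_ramp (m := 0) zero_le_one (τ := √(c / d)) (σ := √(c / d * V))
    (ς := condStd d c V) (Real.sqrt_pos.2 (by positivity))
    (by rw [Real.sq_sqrt (by positivity), Real.sq_sqrt (by positivity)])
    (by rw [condStd, Real.sq_sqrt (by positivity), Real.sq_sqrt (by positivity)]) h0 h1 ht
  rw [pow_zero, one_mul, integral_ramp_zero hVt.1 hVt.2] at h
  simpa only [quasiActDeriv_eq_integral hς, ← ramp_zero_eq] using h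

lemma integral_quasiAct_mul (hd : 1 ≤ d) (hc : 0 < c) (h0 : 0 < V) (h1 : V < 1)
    (ht : |t| ≤ 1) :
    ∫ p, quasiAct (condStd d c V) (√(c / d * V) * p.1) *
        quasiAct (condStd d c V) (√(c / d * V) * (t * p.1 + √(1 - t ^ 2) * p.2)) ∂stdGauss2
      = c / d * arcKernel1 (V * t) := by
  have hd' : (0 : ℝ) < d := by exact_mod_cast hd
  have hV' : 0 ≤ 1 - V := by linarith
  have hς := condStd_pos hd hc h1
  have hVt := abs_lt.1 (abs_mul_lt_one h0 h1 ht)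
  have h := integral_smoothed_ramp (m := 1) le_rfl (τ := √(c / d)) (σ := √(c / d * V))
    (ς := condStd d c V) (Real.sqrt_pos.2 (by positivity))
    (by rw [Real.sq_sqrt (by positivity), Real.sq_sqrt (by positivity)])
    (by rw [condStd, Real.sq_sqrt (by positivity), Real.sq_sqrt (by positivity)]) h0 h1 ht
  rw [pow_one, Real.sq_sqrt (by positivity), integral_ramp_one hVt.1 hVt.2] at h
  simpa only [quasiAct_eq_integral hς, ← ramp_one_eq] using h

end condStd

/-! ### Convergence in probability to constants -/

section TendstoInMeasure

variable {Ω : Type*} [MeasurableSpace Ω] {Q : Measure Ω} {ι : Type*} {l : Filter ι}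

lemma tendstoInMeasure_const_iff [IsFiniteMeasure Q] {f : ι → Ω → ℝ} {a : ℝ} :
    TendstoInMeasure Q f l (fun _ => a) ↔
      ∀ ε, 0 < ε → Tendsto (fun i => Q.real {ω | ε ≤ |f i ω - a|}) l (𝓝 0) := by
  simp only [tendstoInMeasure_iff_measureReal_dist, Real.dist_eq]

/-- Continuous functions preserve convergence in probability to constants. -/
lemma tendstoInMeasure_continuous₃ [IsFiniteMeasure Q] {f g h : ι → Ω → ℝ} {a b e : ℝ}
    (hf : TendstoInMeasure Q f l (fun _ => a)) (hg : TendstoInMeasure Q g l (fun _ => b))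
    (hh : TendstoInMeasure Q h l (fun _ => e)) {φ : ℝ → ℝ → ℝ → ℝ}
    (hφ : Continuous fun p : ℝ × ℝ × ℝ => φ p.1 p.2.1 p.2.2) :
    TendstoInMeasure Q (fun i ω => φ (f i ω) (g i ω) (h i ω)) l (fun _ => φ a b e) := by
  rw [tendstoInMeasure_const_iff] at *
  intro ε hε
  obtain ⟨δ, hδ, H⟩ := Metric.continuousAt_iff.1 (hφ.continuousAt (x := (a, b, e))) ε hε
  have hsum := ((hf δ hδ).add (hg δ hδ)).add (hh δ hδ)
  rw [add_zero, add_zero] at hsum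
  refine squeeze_zero (fun _ => measureReal_nonneg) (fun i => ?_) hsum
  have hsub : {ω | ε ≤ |φ (f i ω) (g i ω) (h i ω) - φ a b e|} ⊆
      ({ω | δ ≤ |f i ω - a|} ∪ {ω | δ ≤ |g i ω - b|}) ∪ {ω | δ ≤ |h i ω - e|} := by
    intro ω hω
    by_contra hcon
    simp only [Set.mem_union, Set.mem_ofPred_eq, not_or, not_le] at hcon
    have := H (x := (f i ω, g i ω, h i ω)) (by
      simp only [Prod.dist_eq, Real.dist_eq, max_lt_iff]
      exact ⟨hcon.1.1, hcon.1.2, hcon.2⟩)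
    rw [Real.dist_eq] at this
    exact absurd hω (not_le.2 this)
  exact (measureReal_mono hsub).trans ((measureReal_union_le _ _).trans
    (add_le_add_left (measureReal_union_le _ _) _))

lemma measureReal_abs_ge_le [IsFiniteMeasure Q] {f : Ω → ℝ} (hf : Integrable f Q) {ε : ℝ}
    (hε : 0 < ε) : Q.real {ω | ε ≤ |f ω|} ≤ (∫ ω, |f ω| ∂Q) / ε := by
  rw [le_div_iff₀ hε, mul_comm]
  exact mul_meas_ge_le_integral_of_nonneg (ae_of_all _ fun _ => abs_nonneg _) hf.abs ε

/-- A family that can be approximated in `L¹`, with arbitrarily small error, by families converging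
in probability converges in probability. -/
lemma tendstoInMeasure_of_approx [IsFiniteMeasure Q] {f : ι → Ω → ℝ} {a : ℝ}
    (H : ∀ δ, 0 < δ → ∃ (f' : ι → Ω → ℝ) (a' : ℝ), TendstoInMeasure Q f' l (fun _ => a') ∧
      |a' - a| ≤ δ ∧ ∀ᶠ i in l, Integrable (fun ω => f i ω - f' i ω) Q ∧
        ∫ ω, |f i ω - f' i ω| ∂Q ≤ δ) :
    TendstoInMeasure Q f l (fun _ => a) := by
  rw [tendstoInMeasure_const_iff]
  intro ε hε
  rw [Metric.tendsto_nhds]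
  intro η hη
  obtain ⟨f', a', hf', ha', hev⟩ := H (min (ε / 4) (ε / 3 * (η / 2))) (by positivity)
  have h1 := tendstoInMeasure_const_iff.1 hf' (ε / 3) (by positivity)
  filter_upwards [hev, (tendsto_order.1 h1).2 (η / 2) (by positivity)] with i hi hi'
  rw [Real.dist_eq, sub_zero, abs_of_nonneg measureReal_nonneg]
  have hsub : {ω | ε ≤ |f i ω - a|} ⊆
      {ω | ε / 3 ≤ |f' i ω - a'|} ∪ {ω | ε / 3 ≤ |f i ω - f' i ω|} := by
    intro ω hω
    by_contra hcon
    simp only [Set.mem_union, Set.mem_ofPred_eq, not_or, not_le] at hcon hω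
    have e : f i ω - a = (f' i ω - a') + (f i ω - f' i ω) + (a' - a) := by ring
    rw [e] at hω
    have := abs_add_three (f' i ω - a') (f i ω - f' i ω) (a' - a)
    have := ha'.trans (min_le_left _ _)
    linarith [hcon.1, hcon.2]
  have h2 : Q.real {ω | ε / 3 ≤ |f i ω - f' i ω|} ≤ η / 2 := by
    refine (measureReal_abs_ge_le hi.1 (by positivity)).trans ?_
    rw [div_le_iff₀ (by positivity), mul_comm]
    exact hi.2.trans (min_le_right _ _)
  calc _ ≤ _ := (measureReal_mono hsub).trans (measureReal_union_le _ _)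
    _ < η := by linarith

/-- Weak law of large numbers for arrays with exchangeable rows: the averages converge as soon as
the means and the means of the products of two distinct entries converge to `a` and `a²`. -/
lemma tendstoInMeasure_average [IsProbabilityMeasure Q] {Z : ℕ → ℕ → Ω → ℝ} {m s : ℕ → ℝ}
    {a B : ℝ} (hZ : ∀ n j, MemLp (Z n j) 2 Q) (hm : ∀ n j, ∫ ω, Z n j ω ∂Q = m n)
    (hs : ∀ n j k, j ≠ k → ∫ ω, Z n j ω * Z n k ω ∂Q = s n)
    (hB : ∀ n j, ∫ ω, Z n j ω * Z n j ω ∂Q ≤ B) (hma : Tendsto m atTop (𝓝 a))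
    (hsa : Tendsto s atTop (𝓝 (a ^ 2))) :
    TendstoInMeasure Q (fun (p : ℕ × ℕ) ω => 1 / p.2 * ∑ j ∈ Finset.range p.2, Z p.1 j ω)
      (atTop ×ˢ atTop) (fun _ => a) := by
  set A : ℕ × ℕ → Ω → ℝ := fun p ω => 1 / p.2 * ∑ j ∈ Finset.range p.2, Z p.1 j ω with hA
  have hAL : ∀ p, MemLp (A p) 2 Q := fun p =>
    (memLp_finsetSum _ fun j _ => hZ p.1 j).const_mul _
  have hZi : ∀ n j, Integrable (Z n j) Q := fun n j => (hZ n j).integrable one_le_two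
  have hAi : ∀ p, Integrable (A p) Q := fun p => (hAL p).integrable one_le_two
  have hmean : ∀ p : ℕ × ℕ, 0 < p.2 → ∫ ω, A p ω ∂Q = m p.1 := by
    intro p hp
    have : (p.2 : ℝ) ≠ 0 := by exact_mod_cast hp.ne'
    rw [hA, integral_const_mul, integral_finsetSum _ fun j _ => hZi _ _]
    simp only [hm, Finset.sum_const, Finset.card_range, nsmul_eq_mul]
    field_simp
  have hsq : ∀ p : ℕ × ℕ, 0 < p.2 →
      ∫ ω, A p ω * A p ω ∂Q ≤ B / p.2 + (1 - 1 / p.2) * s p.1 := by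
    intro p hp
    have hp' : (0 : ℝ) < p.2 := by exact_mod_cast hp
    have e : ∀ ω, A p ω * A p ω = (1 / p.2) ^ 2 *
        ∑ j ∈ Finset.range p.2, ∑ k ∈ Finset.range p.2, Z p.1 j ω * Z p.1 k ω := by
      intro ω
      rw [← Finset.sum_mul_sum, hA]
      ring
    have hii : ∀ j k, Integrable (fun ω => Z p.1 j ω * Z p.1 k ω) Q := fun j k =>
      (hZ _ _).integrable_mul (hZ _ _)
    simp only [e]
    rw [integral_const_mul, integral_finsetSum _ fun j _ => integrable_finsetSum _ fun k _ => hii j k]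
    have hrow : ∀ j ∈ Finset.range p.2,
        ∫ ω, ∑ k ∈ Finset.range p.2, Z p.1 j ω * Z p.1 k ω ∂Q ≤ B + (p.2 - 1) * s p.1 := by
      intro j hj
      rw [integral_finsetSum _ fun k _ => hii j k, ← Finset.add_sum_erase _ _ hj]
      refine add_le_add (hB _ _) (le_of_eq ?_)
      rw [Finset.sum_congr rfl fun k hk => hs p.1 j k (Finset.ne_of_mem_erase hk).symm,
        Finset.sum_const, Finset.card_erase_of_mem hj, Finset.card_range, nsmul_eq_mul,
        Nat.cast_pred hp]
    calc _ ≤ (1 / (p.2 : ℝ)) ^ 2 * ∑ j ∈ Finset.range p.2, (B + (p.2 - 1) * s p.1) := by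
          gcongr with j hj
          exact hrow j hj
      _ = _ := by
          rw [Finset.sum_const, Finset.card_range, nsmul_eq_mul]
          field_simp
  -- Chebyshev's inequality for `E (A - a)² ≤ B / n₂ + (1 - 1 / n₂) s - 2 a m + a²`
  rw [tendstoInMeasure_const_iff]
  intro ε hε
  have hfst : Tendsto (fun p : ℕ × ℕ => p.1) (atTop ×ˢ atTop : Filter (ℕ × ℕ)) atTop := tendsto_fst
  have hsnd : Tendsto (fun p : ℕ × ℕ => p.2) (atTop ×ˢ atTop : Filter (ℕ × ℕ)) atTop := tendsto_snd
  have hinv : Tendsto (fun p : ℕ × ℕ => 1 / (p.2 : ℝ)) (atTop ×ˢ atTop) (𝓝 0) :=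
    tendsto_one_div_atTop_nhds_zero_nat.comp hsnd
  have hlim : Tendsto (fun p : ℕ × ℕ => (B * (1 / p.2) + (1 - 1 / p.2) * s p.1
      - 2 * a * m p.1 + a ^ 2) / ε ^ 2) (atTop ×ˢ atTop) (𝓝 0) := by
    have := ((((hinv.const_mul B).add ((hinv.const_sub 1).mul (hsa.comp hfst))).sub
      ((hma.comp hfst).const_mul (2 * a))).add_const (a ^ 2)).div_const (ε ^ 2)
    rwa [show (B * 0 + (1 - 0) * a ^ 2 - 2 * a * a + a ^ 2) / ε ^ 2 = 0 by ring] at this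
  refine squeeze_zero' (.of_forall fun _ => measureReal_nonneg) ?_ hlim
  filter_upwards [hsnd.eventually (eventually_gt_atTop 0)] with p hp
  have hi2 : Integrable (fun ω => (A p ω - a) ^ 2) Q := ((hAL p).sub (memLp_const a)).integrable_sq
  have hset : {ω | ε ≤ |A p ω - a|} = {ω | ε ^ 2 ≤ |(A p ω - a) ^ 2|} := by
    ext ω
    rw [Set.mem_ofPred_eq, Set.mem_ofPred_eq, abs_pow, pow_le_pow_iff_left₀ hε.le (abs_nonneg _)
      two_ne_zero]
  rw [hset]
  refine (measureReal_abs_ge_le hi2 (by positivity)).trans ?_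
  gcongr
  have e : ∀ ω, |(A p ω - a) ^ 2| = (A p ω * A p ω - 2 * a * A p ω) + a ^ 2 := by
    intro ω; rw [abs_of_nonneg (sq_nonneg _)]; ring
  simp only [e]
  have hAA : Integrable (fun ω => A p ω * A p ω) Q := (hAL p).integrable_mul (hAL p)
  have hA1 : Integrable (fun ω => 2 * a * A p ω) Q := (hAi p).const_mul _
  rw [integral_add (f := fun ω => A p ω * A p ω - 2 * a * A p ω) (hAA.sub hA1)
    (integrable_const _), integral_sub hAA hA1, integral_const_mul, hmean p hp]
  have := hsq p hp
  simp only [integral_const, probReal_univ, one_smul]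
  rw [div_eq_mul_one_div] at this
  linarith

/-- Convergence in probability to a constant depends on the laws of the variables only. -/
lemma tendstoInMeasure_comp_of_map {Ω' : Type*} [MeasurableSpace Ω'] {P : Measure Ω'}
    [IsProbabilityMeasure P] {ξ : Ω' → Ω} (hξ : AEMeasurable ξ P) {f : ι → Ω → ℝ}
    (hf : ∀ i, Measurable (f i)) {a : ℝ} (h : TendstoInMeasure (P.map ξ) f l (fun _ => a)) :
    TendstoInMeasure P (fun i ω => f i (ξ ω)) l (fun _ => a) := by
  have := Measure.isProbabilityMeasure_map hξ
  rw [tendstoInMeasure_const_iff] at *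
  intro ε hε
  refine (h ε hε).congr fun i => ?_
  rw [measureReal_def, measureReal_def, Measure.map_apply_of_aemeasurable hξ
    (measurableSet_le measurable_const ((hf i).sub_const a).abs)]
  rfl

end TendstoInMeasure

/-! ### Independence in infinite product measures -/

section infinitePi

variable {ι : Type*} {μ : ι → Measure ℝ} [∀ i, IsProbabilityMeasure (μ i)]

/-- Disjoint blocks of coordinates are independent. -/
lemma iIndepFun_blocks {α κ : Type*} {f : α × κ → ι} (hf : Function.Injective f) :
    iIndepFun (fun a (ω : ι → ℝ) k => ω (f (a, k))) (Measure.infinitePi μ) := by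
  rw [iIndepFun_iff_map_fun_eq_infinitePi_map (by fun_prop)]
  have h1 := Measure.map_infinitePi_infinitePi_of_inj (P := μ) hf
  have h2 := Measure.infinitePi_map_curry (fun a k => μ (f (a, k)))
  rw [show (fun p : α × κ => μ (f (p.1, p.2))) = fun p => μ (f p) from rfl, ← h1,
    Measure.map_map (by fun_prop) (by fun_prop)] at h2
  refine h2.trans (congrArg _ (funext fun a => ?_))
  exact (Measure.map_infinitePi_infinitePi_of_inj (P := μ) (f := fun k => f (a, k))
    fun k k' h => by simpa using hf h).symm

lemma comap_coordinates {ι κ : Type*} (f : κ → ι) :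
    MeasurableSpace.comap (fun (ω : ι → ℝ) a => ω (f a)) MeasurableSpace.pi
      = ⨆ i ∈ Set.range f, MeasurableSpace.comap (fun ω : ι → ℝ => ω i) inferInstance := by
  rw [iSup_range, MeasurableSpace.pi, MeasurableSpace.comap_iSup]
  simp only [MeasurableSpace.comap_comp]
  rfl

/-- Two disjoint blocks of coordinates are independent. -/
lemma indepFun_blocks {α κ : Type*} {f : α → ι} {g : κ → ι} (hfg : ∀ a k, f a ≠ g k) :
    IndepFun (fun (ω : ι → ℝ) a => ω (f a)) (fun ω k => ω (g k)) (Measure.infinitePi μ) := by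
  have hind : iIndepFun (fun i (ω : ι → ℝ) => ω i) (Measure.infinitePi μ) :=
    iIndepFun_infinitePi (X := fun _ x => x) fun _ => measurable_id
  have hdis : Disjoint (Set.range f) (Set.range g) := by
    rw [Set.disjoint_left]
    rintro _ ⟨a, rfl⟩ ⟨k, hk⟩
    exact hfg a k hk.symm
  have h := indep_iSup_of_disjoint (fun i => (measurable_pi_apply i).comap_le) hind hdis
  rw [IndepFun_iff_Indep, comap_coordinates, comap_coordinates]
  exact h

end infinitePi

/-! ### The canonical model of the random initialization -/

/-- Indices of the initial weights: the entries of `w₀`, of `θ` and of `w₂`. -/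
abbrev InitIdx (d : ℕ) : Type := (Fin d × ℕ) ⊕ ((ℕ × ℕ) ⊕ ℕ)

/-- The laws of the initial weights, where `τ` is the law of the entries of `θ`. -/
def coordLaw (d : ℕ) (τ : Measure ℝ) : InitIdx d → Measure ℝ :=
  Sum.elim (fun _ => gaussianReal 0 1) (Sum.elim (fun _ => τ) fun _ => gaussianReal 0 1)

instance (d : ℕ) (τ : Measure ℝ) [IsProbabilityMeasure τ] (a : InitIdx d) :
    IsProbabilityMeasure (coordLaw d τ a) := by
  rcases a with a | a | a <;> simp only [coordLaw, Sum.elim_inl, Sum.elim_inr] <;> infer_instance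

/-- The joint law of the initial weights. -/
abbrev initLaw (d : ℕ) (τ : Measure ℝ) [IsProbabilityMeasure τ] : Measure (InitIdx d → ℝ) :=
  Measure.infinitePi (coordLaw d τ)

/-- Laws on `[-1, 1]` with mean zero and variance `V`. -/
structure IsWeightLaw (V : ℝ) (τ : Measure ℝ) : Prop where
  bound : ∀ᵐ x ∂τ, |x| ≤ 1
  mean : ∫ x, x ∂τ = 0
  var : ∫ x, x * x ∂τ = V

/-- The output of the fixed layer, as a function of the array of weights. -/
def feature {d : ℕ} (x : EuclideanSpace ℝ (Fin d)) (i : ℕ) (ω : InitIdx d → ℝ) : ℝ :=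
  1 / √d * ∑ k, ω (.inl (k, i)) * x k

/-- The conditional means of the pre-activations at width `n`, as functions of the array of
weights. -/
def field {d : ℕ} (c : ℝ) (x : EuclideanSpace ℝ (Fin d)) (n j : ℕ) (ω : InitIdx d → ℝ) : ℝ :=
  √(c / n) * ∑ i ∈ Finset.range n, ω (.inr (.inl (i, j))) * feature x i ω

section

variable {d : ℕ} {τ : Measure ℝ} [IsProbabilityMeasure τ] {V c : ℝ}

@[fun_prop]
lemma measurable_feature (x : EuclideanSpace ℝ (Fin d)) (i : ℕ) : Measurable (feature x i) := by
  unfold feature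
  fun_prop

@[fun_prop]
lemma measurable_field (x : EuclideanSpace ℝ (Fin d)) (n j : ℕ) :
    Measurable (field c x n j) := by
  unfold field
  fun_prop

lemma feature_linear (a b : ℝ) (x x' : EuclideanSpace ℝ (Fin d)) (i : ℕ) (ω : InitIdx d → ℝ) :
    feature (a • x + b • x') i ω = a * feature x i ω + b * feature x' i ω := by
  simp only [feature, PiLp.add_apply, PiLp.smul_apply, smul_eq_mul, mul_add, Finset.sum_add_distrib]
  rw [Finset.mul_sum, Finset.mul_sum, Finset.mul_sum, Finset.mul_sum, Finset.mul_sum, Finset.mul_sum]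
  congr 1 <;> exact Finset.sum_congr rfl fun k _ => by ring

lemma memLp_coord {p : ENNReal} {f : ℝ → ℝ} {a : InitIdx d} (hf : MemLp f p (coordLaw d τ a)) :
    MemLp (fun ω => f (ω a)) p (initLaw d τ) :=
  hf.comp_measurePreserving (measurePreserving_eval_infinitePi _ a)

lemma integral_coord {f : ℝ → ℝ} (hf : Measurable f) (a : InitIdx d) :
    ∫ ω, f (ω a) ∂initLaw d τ = ∫ x, f x ∂coordLaw d τ a := by
  rw [← Measure.infinitePi_map_eval (coordLaw d τ) a,
    integral_map (measurable_pi_apply a).aemeasurable hf.aestronglyMeasurable]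

lemma indepFun_coord {a b : InitIdx d} (hab : a ≠ b) :
    IndepFun (fun ω => ω a) (fun ω => ω b) (initLaw d τ) :=
  (iIndepFun_infinitePi (P := coordLaw d τ) (X := fun _ x => x) fun _ => measurable_id).indepFun hab

lemma memLp_gaussian_coord (p : Fin d × ℕ) :
    MemLp (fun ω => ω (.inl p)) 2 (initLaw d τ) :=
  memLp_coord (f := fun x => x) (memLp_id_gaussianReal' 2 (by simp))

lemma integral_sq_gaussianReal : ∫ x, x * x ∂gaussianReal 0 1 = 1 := by
  have h := variance_id_gaussianReal (μ := 0) (v := 1)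
  rw [variance_of_integral_eq_zero (by fun_prop) (by simp)] at h
  simpa [sq] using h

lemma integral_gaussian_coord_mul (p q : Fin d × ℕ) :
    ∫ ω, ω (.inl p) * ω (.inl q) ∂initLaw d τ = if p = q then 1 else 0 := by
  split_ifs with h
  · subst h
    rw [integral_coord (f := fun x => x * x) (by fun_prop)]
    exact integral_sq_gaussianReal
  · rw [(indepFun_coord (by simpa using h)).integral_fun_mul_eq_mul_integral
      (measurable_pi_apply _).aestronglyMeasurable (measurable_pi_apply _).aestronglyMeasurable,
      integral_coord (f := fun x => x) (by fun_prop)]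
    simp [coordLaw]

lemma memLp_feature (x : EuclideanSpace ℝ (Fin d)) (i : ℕ) :
    MemLp (feature x i) 2 (initLaw d τ) :=
  (memLp_finsetSum _ fun k _ => (memLp_gaussian_coord (k, i)).mul_const (x k)).const_mul _

lemma integral_feature_sq (x : EuclideanSpace ℝ (Fin d)) (i : ℕ) :
    ∫ ω, feature x i ω * feature x i ω ∂initLaw d τ = ‖x‖ ^ 2 / d := by
  have e : ∀ ω : InitIdx d → ℝ, feature x i ω * feature x i ω = 1 / d *
      ∑ k, ∑ l, x k * x l * (ω (.inl (k, i)) * ω (.inl (l, i))) := by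
    intro ω
    have hd : (1 / √(d : ℝ)) * (1 / √(d : ℝ)) = 1 / d := by
      rw [div_mul_div_comm, one_mul, Real.mul_self_sqrt (Nat.cast_nonneg _)]
    rw [← hd, feature, mul_mul_mul_comm, Finset.sum_mul_sum]
    congr 1
    exact Finset.sum_congr rfl fun k _ => Finset.sum_congr rfl fun l _ => by ring
  have hi : ∀ k l, Integrable (fun ω => x k * x l * (ω (.inl (k, i)) * ω (.inl (l, i))))
      (initLaw d τ) := fun k l =>
    ((memLp_gaussian_coord (k, i)).integrable_mul (memLp_gaussian_coord (l, i))).const_mul _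
  simp only [e]
  rw [integral_const_mul, integral_finsetSum _ fun k _ => integrable_finsetSum _ fun l _ => hi k l]
  simp only [integral_finsetSum _ fun l _ => hi _ l, integral_const_mul,
    integral_gaussian_coord_mul, Prod.mk.injEq, and_true, mul_ite, mul_one, mul_zero,
    Finset.sum_ite_eq, Finset.mem_univ, if_true]
  rw [EuclideanSpace.norm_sq_eq]
  simp only [Real.norm_eq_abs, sq_abs, ← sq]
  ring

/-- The product of a weight and a feature in the same row of the arrays is centred and square
integrable, and its variance is the product of the variances. -/
lemma memLp_weight_mul_feature (hτ : IsWeightLaw V τ) (x : EuclideanSpace ℝ (Fin d)) (i j : ℕ) :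
    MemLp (fun ω => ω (.inr (.inl (i, j))) * feature x i ω) 2 (initLaw d τ) := by
  refine (memLp_feature x i).mono (by fun_prop) ?_
  have h := (measurePreserving_eval_infinitePi (coordLaw d τ) (.inr (.inl (i, j)))).quasiMeasurePreserving.ae
    hτ.bound
  filter_upwards [h] with ω hω
  rw [norm_mul]
  exact mul_le_of_le_one_left (norm_nonneg _) hω

lemma indepFun_weight_feature (x : EuclideanSpace ℝ (Fin d)) (i j : ℕ) :
    IndepFun (fun ω => ω (.inr (.inl (i, j)))) (feature x i) (initLaw d τ) := by
  have h := indepFun_blocks (μ := coordLaw d τ) (f := fun _ : Unit => .inr (.inl (i, j)))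
    (g := fun k : Fin d => .inl (k, i)) (by simp)
  exact h.comp (φ := fun r : Unit → ℝ => r ()) (ψ := fun r : Fin d → ℝ => 1 / √d * ∑ k, r k * x k)
    (by fun_prop) (by fun_prop)

lemma integral_weight (hτ : IsWeightLaw V τ) (i j : ℕ) :
    ∫ ω, ω (.inr (.inl (i, j))) ∂initLaw d τ = 0 := by
  rw [integral_coord (f := fun x => x) (by fun_prop)]
  exact hτ.mean

lemma integral_weight_mul_feature (hτ : IsWeightLaw V τ) (x : EuclideanSpace ℝ (Fin d)) (i j : ℕ) :
    ∫ ω, ω (.inr (.inl (i, j))) * feature x i ω ∂initLaw d τ = 0 := by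
  rw [(indepFun_weight_feature x i j).integral_fun_mul_eq_mul_integral
    (measurable_pi_apply _).aestronglyMeasurable (by fun_prop), integral_weight hτ, zero_mul]

lemma integral_weight_mul_feature_sq (hτ : IsWeightLaw V τ) (x : EuclideanSpace ℝ (Fin d))
    (i j : ℕ) :
    ∫ ω, (ω (.inr (.inl (i, j))) * feature x i ω) * (ω (.inr (.inl (i, j))) * feature x i ω)
      ∂initLaw d τ = V * (‖x‖ ^ 2 / d) := by
  have h := (indepFun_weight_feature (τ := τ) x i j).comp (φ := fun r => r * r)
    (ψ := fun r => r * r) (by fun_prop) (by fun_prop)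
  have h2 := h.integral_fun_mul_eq_mul_integral (by fun_prop) (by fun_prop)
  simp only [Function.comp_apply] at h2
  rw [integral_feature_sq, integral_coord (f := fun x => x * x) (by fun_prop)] at h2
  rw [← hτ.var, show ∫ x, x * x ∂τ = ∫ x, x * x ∂coordLaw d τ (.inr (.inl (i, j))) from rfl, ← h2]
  exact integral_congr_ae (ae_of_all _ fun ω => by simp only; ring)

lemma integral_weight_mul_feature_mul (hτ : IsWeightLaw V τ) (x x' : EuclideanSpace ℝ (Fin d))
    (i : ℕ) {j j' : ℕ} (hj : j ≠ j') :
    ∫ ω, (ω (.inr (.inl (i, j))) * feature x i ω) * (ω (.inr (.inl (i, j'))) * feature x' i ω)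
      ∂initLaw d τ = 0 := by
  have h := indepFun_blocks (μ := coordLaw d τ) (f := fun _ : Unit => .inr (.inl (i, j)))
    (g := fun k : Option (Fin d) => k.elim (.inr (.inl (i, j'))) fun k => .inl (k, i)) (by
      rintro - (_ | k)
      · simpa using hj
      · simp)
  have h1 := h.comp (φ := fun r : Unit → ℝ => r ()) (ψ := fun r : Option (Fin d) → ℝ =>
    (1 / √d * ∑ k, r (some k) * x k) * (r none * (1 / √d * ∑ k, r (some k) * x' k)))
    (measurable_pi_apply () : Measurable fun r : Unit → ℝ => r ()) (by fun_prop)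
  have h2 := h1.integral_fun_mul_eq_mul_integral
    ((measurable_pi_apply ()).comp (measurable_pi_iff.2 fun _ =>
      measurable_pi_apply _)).aestronglyMeasurable
    (Measurable.comp (by fun_prop) (measurable_pi_iff.2 fun _ =>
      measurable_pi_apply _)).aestronglyMeasurable
  simp only [Function.comp_apply, integral_weight hτ, zero_mul] at h2
  rw [← h2]
  refine integral_congr_ae (ae_of_all _ fun ω => ?_)
  simp only [feature, Option.elim]
  ring

/-- The contribution of row `i` of the arrays to a linear combination of two columns of
pre-activations. -/
def rowTerm (v v' : EuclideanSpace ℝ (Fin d)) (i : ℕ) (ω : InitIdx d → ℝ) : ℝ :=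
  ω (.inr (.inl (i, 0))) * feature v i ω + ω (.inr (.inl (i, 1))) * feature v' i ω

lemma memLp_rowTerm (hτ : IsWeightLaw V τ) (v v' : EuclideanSpace ℝ (Fin d)) (i : ℕ) :
    MemLp (rowTerm v v' i) 2 (initLaw d τ) :=
  (memLp_weight_mul_feature hτ v i 0).add (memLp_weight_mul_feature hτ v' i 1)

lemma integral_rowTerm (hτ : IsWeightLaw V τ) (v v' : EuclideanSpace ℝ (Fin d)) (i : ℕ) :
    ∫ ω, rowTerm v v' i ω ∂initLaw d τ = 0 := by
  unfold rowTerm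
  rw [integral_add ((memLp_weight_mul_feature hτ v i 0).integrable one_le_two)
    ((memLp_weight_mul_feature hτ v' i 1).integrable one_le_two), integral_weight_mul_feature hτ,
    integral_weight_mul_feature hτ, add_zero]

lemma variance_rowTerm (hτ : IsWeightLaw V τ) (v v' : EuclideanSpace ℝ (Fin d)) (i : ℕ) :
    variance (rowTerm v v' i) (initLaw d τ) = V * (‖v‖ ^ 2 + ‖v'‖ ^ 2) / d := by
  have h0 := memLp_weight_mul_feature (d := d) hτ v i 0
  have h1 := memLp_weight_mul_feature (d := d) hτ v' i 1
  rw [variance_of_integral_eq_zero (memLp_rowTerm hτ v v' i).aemeasurable (integral_rowTerm hτ v v' i)]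
  have e : ∀ ω : InitIdx d → ℝ, rowTerm v v' i ω ^ 2 =
      ((ω (.inr (.inl (i, 0))) * feature v i ω) * (ω (.inr (.inl (i, 0))) * feature v i ω)
      + 2 * ((ω (.inr (.inl (i, 0))) * feature v i ω) * (ω (.inr (.inl (i, 1))) * feature v' i ω)))
      + (ω (.inr (.inl (i, 1))) * feature v' i ω) * (ω (.inr (.inl (i, 1))) * feature v' i ω) := by
    intro ω; unfold rowTerm; ring
  simp only [e]
  have i1 := h0.integrable_mul h0
  have i2 := (h0.integrable_mul h1).const_mul 2
  have i3 := h1.integrable_mul h1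
  simp only [Pi.mul_def] at i1 i2 i3
  have i12 := i1.add i2
  simp only [Pi.add_def] at i12
  rw [integral_add i12 i3, integral_add i1 i2, integral_const_mul,
    integral_weight_mul_feature_sq hτ, integral_weight_mul_feature_sq hτ,
    integral_weight_mul_feature_mul hτ _ _ _ zero_ne_one]
  ring

/-- The position of the entries of row `i` in the array of all weights. -/
def rowIdx (p : ℕ × (Fin d ⊕ ℕ)) : InitIdx d :=
  p.2.elim (fun k => .inl (k, p.1)) fun j => .inr (.inl (p.1, j))

lemma rowIdx_injective : Function.Injective (rowIdx (d := d)) := by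
  rintro ⟨i, k | j⟩ ⟨i', k' | j'⟩ h <;> simp_all [rowIdx]

lemma iIndepFun_rows {G : (Fin d ⊕ ℕ → ℝ) → ℝ} (hG : Measurable G) :
    iIndepFun (fun i (ω : InitIdx d → ℝ) => G fun k => ω (rowIdx (i, k))) (initLaw d τ) :=
  (iIndepFun_blocks rowIdx_injective).comp (fun _ => G) fun _ => hG

lemma identDistrib_rows {G : (Fin d ⊕ ℕ → ℝ) → ℝ} (hG : Measurable G) (i : ℕ) :
    IdentDistrib (fun ω : InitIdx d → ℝ => G fun k => ω (rowIdx (i, k)))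
      (fun ω => G fun k => ω (rowIdx (0, k))) (initLaw d τ) (initLaw d τ) := by
  have hinj : ∀ i, Function.Injective fun k : Fin d ⊕ ℕ => rowIdx (i, k) := fun i k k' h => by
    simpa using rowIdx_injective h
  refine IdentDistrib.comp (u := G) ⟨(measurable_pi_iff.2 fun k => measurable_pi_apply _).aemeasurable,
    (measurable_pi_iff.2 fun k => measurable_pi_apply _).aemeasurable, ?_⟩ hG
  rw [Measure.map_infinitePi_infinitePi_of_inj (hinj i),
    Measure.map_infinitePi_infinitePi_of_inj (hinj 0)]
  congr 1
  funext k
  rcases k with k | j <;> rfl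

lemma iIndepFun_rowTerm (v v' : EuclideanSpace ℝ (Fin d)) :
    iIndepFun (rowTerm v v') (initLaw d τ) :=
  iIndepFun_rows (G := fun r => r (.inr 0) * (1 / √d * ∑ k, r (.inl k) * v k)
    + r (.inr 1) * (1 / √d * ∑ k, r (.inl k) * v' k)) (by fun_prop)

lemma identDistrib_rowTerm (v v' : EuclideanSpace ℝ (Fin d)) (i : ℕ) :
    IdentDistrib (rowTerm v v' i) (rowTerm v v' 0) (initLaw d τ) (initLaw d τ) :=
  identDistrib_rows (G := fun r => r (.inr 0) * (1 / √d * ∑ k, r (.inl k) * v k)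
    + r (.inr 1) * (1 / √d * ∑ k, r (.inl k) * v' k)) (by fun_prop) i

/-! ### The central limit theorem for the pre-activations -/

/-- The central limit theorem for linear combinations of two columns of pre-activations. -/
lemma tendsto_charFun_rowTerm (hτ : IsWeightLaw V τ) (v v' : EuclideanSpace ℝ (Fin d)) (s : ℝ) :
    Tendsto (fun n : ℕ => charFun ((initLaw d τ).map fun ω =>
        (√n)⁻¹ * ∑ i ∈ Finset.range n, rowTerm v v' i ω) s) atTop
      (𝓝 (charFun (gaussianReal 0 (V * (‖v‖ ^ 2 + ‖v'‖ ^ 2) / d).toNNReal) s)) := by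
  have h := tendstoInDistribution_inv_sqrt_mul_sum_sub (P := initLaw d τ) (X := rowTerm v v')
    (Y := id) (P' := gaussianReal 0 (variance (rowTerm v v' 0) (initLaw d τ)).toNNReal)
    ⟨aemeasurable_id, Measure.map_id⟩ (memLp_rowTerm hτ v v' 0) (iIndepFun_rowTerm v v')
    (identDistrib_rowTerm v v')
  have h2 := ProbabilityMeasure.tendsto_iff_tendsto_charFun.1 h.tendsto s
  simp only [integral_rowTerm hτ, mul_zero, sub_zero, Measure.map_id, variance_rowTerm hτ,
    ProbabilityMeasure.coe_mk] at h2
  exact h2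

/-- A linear image of the standard Gaussian law on the plane: the joint law of the limits of the
pre-activations at two points of the sphere with inner product `t`, when `σ² = c V / d`. -/
def limitPair (σ t : ℝ) (p : ℝ × ℝ) : ℝ × ℝ := (σ * p.1, σ * (t * p.1 + √(1 - t ^ 2) * p.2))

/-- The pre-activations of two neurons at two points of the sphere converge jointly in law; the
limits for distinct neurons are independent. -/
lemma tendsto_integral_field (hτ : IsWeightLaw V τ) (hc : 0 < c) (h0 : 0 < V)
    {x x' : EuclideanSpace ℝ (Fin d)} (hx : ‖x‖ = 1) (hx' : ‖x'‖ = 1)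
    {G : (ℝ × ℝ) × (ℝ × ℝ) → ℝ} (hG : Continuous G) {M : ℝ} (hM : ∀ p, |G p| ≤ M) :
    Tendsto (fun n => ∫ ω, G ((field c x n 0 ω, field c x' n 0 ω),
        (field c x n 1 ω, field c x' n 1 ω)) ∂initLaw d τ) atTop
      (𝓝 (∫ w, G (limitPair √(c / d * V) (inner ℝ x x') w.1,
        limitPair √(c / d * V) (inner ℝ x x') w.2) ∂(stdGauss2.prod stdGauss2))) := by
  set t : ℝ := inner ℝ x x' with ht
  set σ : ℝ := √(c / d * V) with hσ
  have htabs : |t| ≤ 1 := by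
    have := abs_real_inner_le_norm x x'
    rwa [hx, hx', one_mul] at this
  have ht2 : t ^ 2 ≤ 1 := (sq_le_one_iff_abs_le_one t).2 htabs
  have hσ2 : σ ^ 2 = c / d * V := Real.sq_sqrt (by positivity)
  have hs2 : √(1 - t ^ 2) ^ 2 = 1 - t ^ 2 := Real.sq_sqrt (by linarith)
  set S : ℕ → (InitIdx d → ℝ) → EuclideanSpace ℝ (Fin 4) := fun n ω =>
    WithLp.toLp 2 ![field c x n 0 ω, field c x' n 0 ω, field c x n 1 ω, field c x' n 1 ω] with hS
  set T : (ℝ × ℝ) × (ℝ × ℝ) → EuclideanSpace ℝ (Fin 4) := fun w =>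
    WithLp.toLp 2 ![(limitPair σ t w.1).1, (limitPair σ t w.1).2, (limitPair σ t w.2).1,
      (limitPair σ t w.2).2] with hT
  have hSm : ∀ n, Measurable (S n) := fun n => by
    refine (WithLp.measurable_toLp 2 _).comp (measurable_pi_iff.2 fun i => ?_)
    fin_cases i <;> simp <;> fun_prop
  have hTm : Measurable T := by
    refine (WithLp.measurable_toLp 2 _).comp (measurable_pi_iff.2 fun i => ?_)
    fin_cases i <;> simp [limitPair] <;> fun_prop
  set μ : ℕ → ProbabilityMeasure (EuclideanSpace ℝ (Fin 4)) := fun n =>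
    ⟨(initLaw d τ).map (S n), Measure.isProbabilityMeasure_map (hSm n).aemeasurable⟩ with hμ
  set μ₀ : ProbabilityMeasure (EuclideanSpace ℝ (Fin 4)) :=
    ⟨(stdGauss2.prod stdGauss2).map T, Measure.isProbabilityMeasure_map hTm.aemeasurable⟩ with hμ₀
  -- Every linear combination of the four pre-activations is a normalized sum of independent
  -- row terms.
  have hconv : Tendsto μ atTop (𝓝 μ₀) := by
    refine ProbabilityMeasure.tendsto_of_tendsto_charFun fun a => ?_
    set v := a 0 • x + a 1 • x' with hv
    set v' := a 2 • x + a 3 • x' with hv'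
    have hnorm : ∀ p q : ℝ, ‖p • x + q • x'‖ ^ 2 = p ^ 2 + 2 * (p * q * t) + q ^ 2 := by
      intro p q
      rw [norm_add_sq_real, norm_smul, norm_smul, hx, hx', real_inner_smul_left,
        real_inner_smul_right, mul_one, mul_one, Real.norm_eq_abs, Real.norm_eq_abs, sq_abs, sq_abs]
      ring
    have hlim := tendsto_charFun_rowTerm hτ v v' √c
    have e1 : ∀ n, charFun (μ n : Measure (EuclideanSpace ℝ (Fin 4))) a
        = charFun ((initLaw d τ).map fun ω =>
          (√n)⁻¹ * ∑ i ∈ Finset.range n, rowTerm v v' i ω) √c := by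
      intro n
      have hm : Measurable fun ω : InitIdx d → ℝ =>
          (√n)⁻¹ * ∑ i ∈ Finset.range n, rowTerm v v' i ω := by
        unfold rowTerm; fun_prop
      rw [charFun_apply, charFun_apply_real]
      simp only [hμ, ProbabilityMeasure.coe_mk]
      rw [integral_map (hSm n).aemeasurable (by fun_prop), integral_map hm.aemeasurable (by fun_prop)]
      refine integral_congr_ae (ae_of_all _ fun ω => ?_)
      have hinner : inner ℝ (S n ω) a
          = √c * ((√n)⁻¹ * ∑ i ∈ Finset.range n, rowTerm v v' i ω) := by
        have hr : ∀ i, rowTerm v v' i ω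
            = a 0 * (ω (.inr (.inl (i, 0))) * feature x i ω)
              + a 1 * (ω (.inr (.inl (i, 0))) * feature x' i ω)
              + a 2 * (ω (.inr (.inl (i, 1))) * feature x i ω)
              + a 3 * (ω (.inr (.inl (i, 1))) * feature x' i ω) := by
          intro i
          rw [rowTerm, hv, hv', feature_linear, feature_linear]
          ring
        simp only [hr, Finset.sum_add_distrib, ← Finset.mul_sum]
        rw [PiLp.inner_apply]
        simp only [hS, Fin.sum_univ_four, field, Real.sqrt_div hc.le]
        simp
        ring
      simp only [hinner]
      push_cast
      rfl
    have e2 : charFun (μ₀ : Measure (EuclideanSpace ℝ (Fin 4))) a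
        = charFun (gaussianReal 0 (V * (‖v‖ ^ 2 + ‖v'‖ ^ 2) / d).toNNReal) √c := by
      have hlin := map_linear_stdGauss4 (a 0 * σ + a 1 * (σ * t)) (a 1 * (σ * √(1 - t ^ 2)))
        (a 2 * σ + a 3 * (σ * t)) (a 3 * (σ * √(1 - t ^ 2)))
      have hm : Measurable fun w : (ℝ × ℝ) × (ℝ × ℝ) =>
          ((a 0 * σ + a 1 * (σ * t)) * w.1.1 + a 1 * (σ * √(1 - t ^ 2)) * w.1.2)
            + ((a 2 * σ + a 3 * (σ * t)) * w.2.1 + a 3 * (σ * √(1 - t ^ 2)) * w.2.2) := by fun_prop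
      have e3 : charFun (μ₀ : Measure (EuclideanSpace ℝ (Fin 4))) a
          = charFun ((stdGauss2.prod stdGauss2).map fun w : (ℝ × ℝ) × (ℝ × ℝ) =>
          ((a 0 * σ + a 1 * (σ * t)) * w.1.1 + a 1 * (σ * √(1 - t ^ 2)) * w.1.2)
            + ((a 2 * σ + a 3 * (σ * t)) * w.2.1 + a 3 * (σ * √(1 - t ^ 2)) * w.2.2)) 1 := by
        rw [charFun_apply, charFun_apply_real]
        simp only [hμ₀, ProbabilityMeasure.coe_mk]
        rw [integral_map hTm.aemeasurable (by fun_prop), integral_map hm.aemeasurable (by fun_prop)]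
        refine integral_congr_ae (ae_of_all _ fun w => ?_)
        have hinner : inner ℝ (T w) a =
            ((a 0 * σ + a 1 * (σ * t)) * w.1.1 + a 1 * (σ * √(1 - t ^ 2)) * w.1.2)
            + ((a 2 * σ + a 3 * (σ * t)) * w.2.1 + a 3 * (σ * √(1 - t ^ 2)) * w.2.2) := by
          rw [PiLp.inner_apply]
          simp only [hT, Fin.sum_univ_four, limitPair]
          simp
          ring
        simp only [hinner, Complex.ofReal_one, one_mul]
      rw [e3, hlin, charFun_gaussianReal, charFun_gaussianReal]
      rw [Real.coe_toNNReal _ (by positivity), Real.coe_toNNReal _ (by positivity), hv, hv', hnorm,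
        hnorm]
      have hvar : (a 0 * σ + a 1 * (σ * t)) ^ 2 + (a 1 * (σ * √(1 - t ^ 2))) ^ 2
          + ((a 2 * σ + a 3 * (σ * t)) ^ 2 + (a 3 * (σ * √(1 - t ^ 2))) ^ 2)
          = V * (a 0 ^ 2 + 2 * (a 0 * a 1 * t) + a 1 ^ 2
            + (a 2 ^ 2 + 2 * (a 2 * a 3 * t) + a 3 ^ 2)) / d * c := by
        linear_combination ((a 0 + a 1 * t) ^ 2 + a 1 ^ 2 * √(1 - t ^ 2) ^ 2
          + (a 2 + a 3 * t) ^ 2 + a 3 ^ 2 * √(1 - t ^ 2) ^ 2) * hσ2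
          + (c / d * V) * (a 1 ^ 2 + a 3 ^ 2) * hs2
      have hcc : ((√c : ℝ) : ℂ) ^ 2 = (c : ℂ) := by
        norm_cast
        exact Real.sq_sqrt hc.le
      rw [hvar, hcc]
      push_cast
      ring_nf
    simp only [e1, e2]
    exact hlim
  rw [ProbabilityMeasure.tendsto_iff_forall_integral_tendsto] at hconv
  have hπ : Continuous fun y : EuclideanSpace ℝ (Fin 4) => ((y 0, y 1), (y 2, y 3)) := by fun_prop
  have hGπ : Continuous fun y : EuclideanSpace ℝ (Fin 4) => G ((y 0, y 1), (y 2, y 3)) := hG.comp hπ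
  have h := hconv (BoundedContinuousFunction.ofNormedAddCommGroup _ hGπ M fun y => hM _)
  simp only [hμ, hμ₀, ProbabilityMeasure.coe_mk, BoundedContinuousFunction.coe_ofNormedAddCommGroup]
    at h
  rw [integral_map hTm.aemeasurable hGπ.aestronglyMeasurable] at h
  simp only [integral_map (hSm _).aemeasurable hGπ.aestronglyMeasurable] at h
  exact h

end

section

variable {d : ℕ} {τ : Measure ℝ} [IsProbabilityMeasure τ] {V c : ℝ}

/-! ### Exchangeability of the neurons -/

/-- Relabelling of the neurons of the second hidden layer. -/
def relabel (g : ℕ → ℕ) : InitIdx d → InitIdx d :=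
  Sum.map id (Sum.map (Prod.map id g) g)

lemma relabel_injective {g : ℕ → ℕ} (hg : Function.Injective g) :
    Function.Injective (relabel (d := d) g) :=
  Sum.map_injective.2 ⟨Function.injective_id,
    Sum.map_injective.2 ⟨Function.injective_id.prodMap hg, hg⟩⟩

/-- The neurons are exchangeable: the law of the weights is invariant under injective relabelling.
-/
lemma integral_comp_relabel {g : ℕ → ℕ} (hg : Function.Injective g) {H : (InitIdx d → ℝ) → ℝ}
    (hH : Measurable H) :
    ∫ ω, H (fun a => ω (relabel g a)) ∂initLaw d τ = ∫ ω, H ω ∂initLaw d τ := by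
  have h := Measure.map_infinitePi_infinitePi_of_inj (P := coordLaw d τ)
    (relabel_injective (d := d) hg)
  have e : (fun a => coordLaw d τ (relabel g a)) = coordLaw d τ := by
    funext a
    rcases a with a | a | a <;> rfl
  rw [e] at h
  have hm : Measurable fun (ω : InitIdx d → ℝ) a => ω (relabel g a) :=
    measurable_pi_iff.2 fun _ => measurable_pi_apply _
  rw [← integral_map hm.aemeasurable hH.aestronglyMeasurable, h]

lemma exists_injective_zero_one {j k : ℕ} (h : j ≠ k) :
    ∃ g : ℕ → ℕ, Function.Injective g ∧ g 0 = j ∧ g 1 = k := by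
  refine ⟨fun m => if m = 0 then j else if m = 1 then k else m + j + k, ?_, by simp, by simp⟩
  intro m m' hm
  simp only at hm
  split_ifs at hm <;> omega

/-- The array of weights with the output weights erased. -/
def eraseOutput (r : (Fin d × ℕ) ⊕ (ℕ × ℕ) → ℝ) : InitIdx d → ℝ :=
  Sum.elim (fun p => r (.inl p)) (Sum.elim (fun p => r (.inr p)) fun _ => 0)

/-- The output weights are independent of the pre-activations. -/
lemma integral_output_mul {A : (ℕ → ℝ) → ℝ} (hA : Measurable A) {H : (InitIdx d → ℝ) → ℝ}
    (hH : Measurable H)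
    (hHe : ∀ ω, H (eraseOutput fun p => ω (p.elim .inl fun q => .inr (.inl q))) = H ω) :
    ∫ ω, A (fun j => ω (.inr (.inr j))) * H ω ∂initLaw d τ
      = (∫ ω, A (fun j => ω (.inr (.inr j))) ∂initLaw d τ) * ∫ ω, H ω ∂initLaw d τ := by
  have hind := indepFun_blocks (μ := coordLaw d τ) (f := fun j : ℕ => .inr (.inr j))
    (g := fun p : (Fin d × ℕ) ⊕ (ℕ × ℕ) => p.elim .inl fun q => .inr (.inl q))
    (by rintro j (p | p) <;> simp)
  have he : Measurable (eraseOutput (d := d)) := by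
    refine measurable_pi_iff.2 fun a => ?_
    rcases a with a | a | a
    · exact measurable_pi_apply (Sum.inl a)
    · exact measurable_pi_apply (Sum.inr a)
    · exact measurable_const
  have h := (hind.comp hA (hH.comp he)).integral_fun_mul_eq_mul_integral
    (hA.comp (measurable_pi_iff.2 fun _ => measurable_pi_apply _)).aestronglyMeasurable
    ((hH.comp he).comp (measurable_pi_iff.2 fun _ => measurable_pi_apply _)).aestronglyMeasurable
  simp only [Function.comp_apply, hHe] at h
  exact h

lemma field_relabel (g : ℕ → ℕ) (x : EuclideanSpace ℝ (Fin d)) (n j : ℕ) (ω : InitIdx d → ℝ) :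
    field c x n j (fun a => ω (relabel g a)) = field c x n (g j) ω := rfl

lemma field_eraseOutput (x : EuclideanSpace ℝ (Fin d)) (n j : ℕ) (ω : InitIdx d → ℝ) :
    field c x n j (eraseOutput fun p => ω (p.elim .inl fun q => .inr (.inl q)))
      = field c x n j ω := rfl

/-! ### Laws of large numbers over the neurons -/

section moments

variable {q : ℝ → ℝ} {F : ℝ × ℝ → ℝ}

/-- By exchangeability the mean does not depend on the neuron, and the output weight factors out. -/
lemma integral_weighted_field (hq : Measurable q) (hF : Measurable F)
    (x x' : EuclideanSpace ℝ (Fin d)) (n j : ℕ) :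
    ∫ ω, q (ω (.inr (.inr j))) * F (field c x n j ω, field c x' n j ω) ∂initLaw d τ
      = (∫ z, q z ∂gaussianReal 0 1) *
        ∫ ω, F (field c x n 0 ω, field c x' n 0 ω) ∂initLaw d τ := by
  obtain ⟨g, hg, hg0, -⟩ := exists_injective_zero_one (Nat.succ_ne_self j).symm
  have hFf : Measurable fun ω : InitIdx d → ℝ => F (field c x n 0 ω, field c x' n 0 ω) :=
    hF.comp (by fun_prop)
  have h1 := integral_comp_relabel (τ := τ) hg (H := fun ω =>
    q (ω (.inr (.inr 0))) * F (field c x n 0 ω, field c x' n 0 ω))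
    ((hq.comp (measurable_pi_apply _)).mul hFf)
  have h2 := integral_output_mul (τ := τ) (A := fun r => q (r 0))
    (hq.comp (measurable_pi_apply 0)) hFf fun ω => by simp only [field_eraseOutput]
  have h3 : ∫ ω, q (ω (.inr (.inr 0))) ∂initLaw d τ = ∫ z, q z ∂gaussianReal 0 1 :=
    integral_coord hq _
  simp only [field_relabel, hg0] at h1
  rw [h2, h3] at h1
  rw [← h1]
  simp only [relabel, Sum.map_inr, hg0]

lemma integral_weighted_field_mul (hq : Measurable q) (hF : Measurable F)
    (x x' : EuclideanSpace ℝ (Fin d)) (n : ℕ) {j k : ℕ} (hjk : j ≠ k) :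
    ∫ ω, (q (ω (.inr (.inr j))) * F (field c x n j ω, field c x' n j ω)) *
        (q (ω (.inr (.inr k))) * F (field c x n k ω, field c x' n k ω)) ∂initLaw d τ
      = (∫ z, q z ∂gaussianReal 0 1) ^ 2 * ∫ ω, F (field c x n 0 ω, field c x' n 0 ω) *
        F (field c x n 1 ω, field c x' n 1 ω) ∂initLaw d τ := by
  obtain ⟨g, hg, hg0, hg1⟩ := exists_injective_zero_one hjk
  have hFf : ∀ j, Measurable fun ω : InitIdx d → ℝ => F (field c x n j ω, field c x' n j ω) :=
    fun j => hF.comp (by fun_prop)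
  have hw : ∀ j, Measurable fun ω : InitIdx d → ℝ => q (ω (.inr (.inr j))) :=
    fun j => hq.comp (measurable_pi_apply _)
  have h1 := integral_comp_relabel (τ := τ) hg (H := fun ω =>
    (q (ω (.inr (.inr 0))) * F (field c x n 0 ω, field c x' n 0 ω)) *
      (q (ω (.inr (.inr 1))) * F (field c x n 1 ω, field c x' n 1 ω)))
    (((hw 0).mul (hFf 0)).mul ((hw 1).mul (hFf 1)))
  have h2 := integral_output_mul (τ := τ) (A := fun r => q (r 0) * q (r 1))
    (H := fun ω => F (field c x n 0 ω, field c x' n 0 ω) * F (field c x n 1 ω, field c x' n 1 ω))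
    ((hq.comp (measurable_pi_apply 0)).mul (hq.comp (measurable_pi_apply 1)))
    ((hFf 0).mul (hFf 1)) fun ω => by simp only [field_eraseOutput]
  have h3 : ∫ ω, q (ω (.inr (.inr 0))) * q (ω (.inr (.inr 1))) ∂initLaw d τ
      = (∫ z, q z ∂gaussianReal 0 1) ^ 2 := by
    have hind := (indepFun_coord (τ := τ) (d := d) (a := .inr (.inr 0)) (b := .inr (.inr 1))
      (by simp)).comp hq hq
    have := hind.integral_fun_mul_eq_mul_integral (hw 0).aestronglyMeasurable
      (hw 1).aestronglyMeasurable
    simp only [Function.comp_apply] at this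
    rw [this, integral_coord hq, integral_coord hq, sq]
    rfl
  rw [h3] at h2
  simp only [field_relabel, hg0, hg1] at h1
  simp only [relabel, Sum.map_inr, hg0, hg1] at h1
  rw [← h2, h1]
  exact integral_congr_ae (ae_of_all _ fun ω => mul_mul_mul_comm _ _ _ _)

end moments

/-- The average over the neurons of a bounded continuous function of the pre-activations, weighted
by functions of the output weights, converges in probability to its mean under the limit law. -/
lemma tendstoInMeasure_weighted_average (hτ : IsWeightLaw V τ) (hc : 0 < c) (h0 : 0 < V)
    {x x' : EuclideanSpace ℝ (Fin d)} (hx : ‖x‖ = 1) (hx' : ‖x'‖ = 1) {q : ℝ → ℝ}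
    (hqm : Measurable q) (hq : MemLp q 2 (gaussianReal 0 1)) {F : ℝ × ℝ → ℝ} (hF : Continuous F)
    {M : ℝ} (hM : ∀ p, |F p| ≤ M) :
    TendstoInMeasure (initLaw d τ) (fun (n : ℕ × ℕ) ω => 1 / n.2 * ∑ j ∈ Finset.range n.2,
        q (ω (.inr (.inr j))) * F (field c x n.1 j ω, field c x' n.1 j ω)) (atTop ×ˢ atTop)
      (fun _ => (∫ z, q z ∂gaussianReal 0 1) *
        ∫ p, F (limitPair √(c / d * V) (inner ℝ x x') p) ∂stdGauss2) := by
  have hM0 : 0 ≤ M := (abs_nonneg _).trans (hM 0)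
  have hFm : Measurable F := hF.measurable
  have hFf : ∀ n j, Measurable fun ω : InitIdx d → ℝ => F (field c x n j ω, field c x' n j ω) :=
    fun n j => hFm.comp (by fun_prop)
  have hw : ∀ j, Measurable fun ω : InitIdx d → ℝ => q (ω (.inr (.inr j))) :=
    fun j => hqm.comp (measurable_pi_apply _)
  have hqw : ∀ j, MemLp (fun ω : InitIdx d → ℝ => q (ω (.inr (.inr j)))) 2 (initLaw d τ) :=
    fun j => memLp_coord (a := .inr (.inr j)) (show MemLp q 2 (coordLaw d τ (.inr (.inr j))) from hq)
  have hZ : ∀ n j, MemLp (fun ω => q (ω (.inr (.inr j))) * F (field c x n j ω, field c x' n j ω)) 2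
      (initLaw d τ) := fun n j => by
    refine ((hqw j).mul_const M).mono ((hw j).mul (hFf n j)).aestronglyMeasurable
      (ae_of_all _ fun ω => ?_)
    rw [norm_mul, norm_mul, Real.norm_of_nonneg hM0]
    exact mul_le_mul_of_nonneg_left (hM _) (norm_nonneg _)
  have hlim1 := tendsto_integral_field hτ hc h0 hx hx' (G := fun w => F w.1)
    (hF.comp continuous_fst) (fun w => hM w.1)
  rw [integral_fun_fst (μ := stdGauss2) (ν := stdGauss2)
    (fun p => F (limitPair √(c / d * V) (inner ℝ x x') p)), probReal_univ, one_smul] at hlim1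
  have hlim2 := tendsto_integral_field hτ hc h0 hx hx' (G := fun w => F w.1 * F w.2)
    ((hF.comp continuous_fst).mul (hF.comp continuous_snd)) (M := M * M) (fun w => by
      rw [abs_mul]; exact mul_le_mul (hM _) (hM _) (abs_nonneg _) hM0)
  rw [integral_prod_mul (μ := stdGauss2) (ν := stdGauss2)
    (fun p => F (limitPair √(c / d * V) (inner ℝ x x') p))
    (fun p => F (limitPair √(c / d * V) (inner ℝ x x') p))] at hlim2
  have hB : ∀ n j, ∫ ω, (q (ω (.inr (.inr j))) * F (field c x n j ω, field c x' n j ω))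
      * (q (ω (.inr (.inr j))) * F (field c x n j ω, field c x' n j ω)) ∂initLaw d τ
        ≤ ∫ z, M ^ 2 * q z ^ 2 ∂gaussianReal 0 1 := fun n j => by
    have h1 : ∫ ω : InitIdx d → ℝ, M ^ 2 * q (ω (.inr (.inr j))) ^ 2 ∂initLaw d τ
        = ∫ z, M ^ 2 * q z ^ 2 ∂gaussianReal 0 1 :=
      integral_coord (f := fun z => M ^ 2 * q z ^ 2) (by fun_prop) (.inr (.inr j))
    rw [← h1]
    refine integral_mono ((hZ n j).integrable_mul (hZ n j)) ((hqw j).integrable_sq.const_mul _)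
      fun ω => ?_
    have := sq_le_sq' (abs_le.1 (hM (field c x n j ω, field c x' n j ω))).1
      (abs_le.1 (hM (field c x n j ω, field c x' n j ω))).2
    simp only
    nlinarith [sq_nonneg (q (ω (.inr (.inr j)))),
      mul_le_mul_of_nonneg_left this (sq_nonneg (q (ω (.inr (.inr j)))))]
  have hlim3 := hlim2.const_mul ((∫ z, q z ∂gaussianReal 0 1) ^ 2)
  rw [← sq, ← mul_pow] at hlim3
  exact tendstoInMeasure_average
    (Z := fun n j ω => q (ω (.inr (.inr j))) * F (field c x n j ω, field c x' n j ω)) hZ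
    (integral_weighted_field hqm hFm x x')
    (fun n j k hjk => integral_weighted_field_mul hqm hFm x x' n hjk) hB
    (hlim1.const_mul _) hlim3

lemma memLp_field (hτ : IsWeightLaw V τ) (x : EuclideanSpace ℝ (Fin d)) (n j : ℕ) :
    MemLp (field c x n j) 2 (initLaw d τ) :=
  (memLp_finsetSum _ fun i _ => memLp_weight_mul_feature hτ x i j).const_mul _

lemma integral_field_sq (hτ : IsWeightLaw V τ) (hc : 0 < c) {x : EuclideanSpace ℝ (Fin d)}
    (hx : ‖x‖ = 1) {n : ℕ} (hn : 0 < n) :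
    ∫ ω, field c x n 0 ω ^ 2 ∂initLaw d τ = c / d * V := by
  have hn' : (0 : ℝ) < n := by exact_mod_cast hn
  have hrow : ∀ i, MemLp (rowTerm x 0 i) 2 (initLaw d τ) := memLp_rowTerm hτ x 0
  have hvar := IndepFun.variance_sum (s := Finset.range n) (fun i _ => hrow i)
    fun i _ j _ hij => (iIndepFun_rowTerm (τ := τ) x 0).indepFun hij
  rw [variance_of_integral_eq_zero (Finset.aemeasurable_sum _ fun i _ => (hrow i).aemeasurable)
    (by
      simp only [Finset.sum_apply]
      rw [integral_finsetSum _ fun i _ => (hrow i).integrable one_le_two]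
      exact Finset.sum_eq_zero fun i _ => integral_rowTerm hτ x 0 i)] at hvar
  simp only [variance_rowTerm hτ, Finset.sum_const, Finset.card_range, nsmul_eq_mul, hx] at hvar
  have e : ∀ ω : InitIdx d → ℝ, field c x n 0 ω ^ 2
      = c / n * (∑ i ∈ Finset.range n, rowTerm x 0 i) ω ^ 2 := by
    intro ω
    rw [field, mul_pow, Real.sq_sqrt (by positivity), Finset.sum_apply]
    simp [rowTerm, feature]
  simp only [e]
  rw [integral_const_mul, hvar]
  simp
  field_simp

lemma memLp_linear_stdGauss2 (a b : ℝ) : MemLp (fun p : ℝ × ℝ => a * p.1 + b * p.2) 2 stdGauss2 := by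
  have hid : MemLp (fun x : ℝ => x) 2 (gaussianReal 0 1) := memLp_id_gaussianReal' 2 (by simp)
  exact ((hid.comp_fst (gaussianReal 0 1)).const_mul a).add
    ((hid.comp_snd (gaussianReal 0 1)).const_mul b)

lemma integral_linear_sq_stdGauss2 (a b : ℝ) :
    ∫ p, (a * p.1 + b * p.2) ^ 2 ∂stdGauss2 = a ^ 2 + b ^ 2 := by
  have hm : Measurable fun p : ℝ × ℝ => a * p.1 + b * p.2 := by fun_prop
  have h := variance_id_gaussianReal (μ := 0) (v := (a ^ 2 + b ^ 2).toNNReal)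
  rw [variance_of_integral_eq_zero (by fun_prop) (by simp), ← map_linear_stdGauss2,
    integral_map hm.aemeasurable (by fun_prop), Real.coe_toNNReal _ (by positivity)] at h
  exact h

/-- The average over the neurons of a continuous function of the pre-activations with quadratic
growth also converges to its mean under the limit law. The truncation error is controlled through
the second moments, which converge. -/
lemma tendstoInMeasure_average_of_le_sq (hτ : IsWeightLaw V τ) (hc : 0 < c) (h0 : 0 < V)
    {x x' : EuclideanSpace ℝ (Fin d)} (hx : ‖x‖ = 1) (hx' : ‖x'‖ = 1) {F : ℝ × ℝ → ℝ}
    (hF : Continuous F) (hF0 : ∀ p, 0 ≤ F p) {B : ℝ} (hB : 0 ≤ B)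
    (hFB : ∀ p, F p ≤ p.1 ^ 2 + p.2 ^ 2 + B) :
    TendstoInMeasure (initLaw d τ) (fun (n : ℕ × ℕ) ω => 1 / n.2 * ∑ j ∈ Finset.range n.2,
        F (field c x n.1 j ω, field c x' n.1 j ω)) (atTop ×ˢ atTop)
      (fun _ => ∫ p, F (limitPair √(c / d * V) (inner ℝ x x') p) ∂stdGauss2) := by
  set t : ℝ := inner ℝ x x' with ht
  set σ : ℝ := √(c / d * V) with hσ
  have hσ2 : σ ^ 2 = c / d * V := Real.sq_sqrt (by positivity)
  have htabs : |t| ≤ 1 := by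
    have := abs_real_inner_le_norm x x'
    rwa [hx, hx', one_mul] at this
  have hs2 : √(1 - t ^ 2) ^ 2 = 1 - t ^ 2 :=
    Real.sq_sqrt (by linarith [(sq_le_one_iff_abs_le_one t).2 htabs])
  set g : ℝ × ℝ → ℝ := fun p => p.1 ^ 2 + p.2 ^ 2 + B with hg
  have hgc : Continuous g := by fun_prop
  have hg0 : ∀ p, 0 ≤ g p := fun p => by positivity
  have hlpm : Measurable (limitPair σ t) := by unfold limitPair; fun_prop
  have hlp1 : ∀ p, (limitPair σ t p).1 = σ * p.1 + 0 * p.2 := fun p => by simp [limitPair]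
  have hlp2 : ∀ p, (limitPair σ t p).2 = σ * t * p.1 + σ * √(1 - t ^ 2) * p.2 := fun p => by
    simp only [limitPair]; ring
  have hgl : Integrable (fun p => g (limitPair σ t p)) stdGauss2 := by
    simp only [hg, hlp1, hlp2]
    exact ((memLp_linear_stdGauss2 _ _).integrable_sq.add
      (memLp_linear_stdGauss2 _ _).integrable_sq).add (integrable_const B)
  have hgli : ∫ p, g (limitPair σ t p) ∂stdGauss2 = c / d * V + c / d * V + B := by
    simp only [hg, hlp1, hlp2]
    rw [integral_add (f := fun p : ℝ × ℝ => (σ * p.1 + 0 * p.2) ^ 2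
        + (σ * t * p.1 + σ * √(1 - t ^ 2) * p.2) ^ 2)
      ((memLp_linear_stdGauss2 _ _).integrable_sq.add
        (memLp_linear_stdGauss2 _ _).integrable_sq) (integrable_const B),
      integral_add (memLp_linear_stdGauss2 _ _).integrable_sq
        (memLp_linear_stdGauss2 _ _).integrable_sq, integral_linear_sq_stdGauss2,
      integral_linear_sq_stdGauss2]
    simp only [integral_const, probReal_univ, one_smul]
    linear_combination 2 * hσ2 + σ ^ 2 * hs2
  have hgf : ∀ n j, Integrable (fun ω => g (field c x n j ω, field c x' n j ω)) (initLaw d τ) :=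
    fun n j => ((memLp_field hτ x n j).integrable_sq.add
      (memLp_field hτ x' n j).integrable_sq).add (integrable_const B)
  have hgfi : ∀ n, 0 < n → ∫ ω, g (field c x n 0 ω, field c x' n 0 ω) ∂initLaw d τ
      = c / d * V + c / d * V + B := by
    intro n hn
    simp only [hg]
    rw [integral_add (f := fun ω => field c x n 0 ω ^ 2 + field c x' n 0 ω ^ 2)
      ((memLp_field hτ x n 0).integrable_sq.add (memLp_field hτ x' n 0).integrable_sq)
      (integrable_const B), integral_add (memLp_field hτ x n 0).integrable_sq
      (memLp_field hτ x' n 0).integrable_sq, integral_field_sq hτ hc hx hn,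
      integral_field_sq hτ hc hx' hn]
    simp
  have hmin : ∀ {h : ℝ × ℝ → ℝ} (_ : Continuous h) (_ : ∀ p, 0 ≤ h p) (M : ℝ) (_ : 0 ≤ M) (p),
      |min (h p) M| ≤ M := fun _ hh M hM p => by
    rw [abs_of_nonneg (le_min (hh p) hM)]; exact min_le_right _ _
  -- the tail of the dominating function `g` under the limit law
  have htail : Tendsto (fun M : ℕ => ∫ p, (g (limitPair σ t p) - min (g (limitPair σ t p)) M)
      ∂stdGauss2) atTop (𝓝 0) := by
    have := tendsto_integral_of_dominated_convergence (μ := stdGauss2)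
      (F := fun (M : ℕ) p => g (limitPair σ t p) - min (g (limitPair σ t p)) M) (f := fun _ => 0)
      (fun p => g (limitPair σ t p))
      (fun M => ((hgc.measurable.comp hlpm).sub
        ((hgc.measurable.comp hlpm).min measurable_const)).aestronglyMeasurable) hgl
      (fun M => ae_of_all _ fun p => by
        have h1 := min_le_left (g (limitPair σ t p)) M
        have h2 : 0 ≤ min (g (limitPair σ t p)) (M : ℝ) := le_min (hg0 _) (Nat.cast_nonneg _)
        rw [Real.norm_of_nonneg (by linarith)]
        linarith)
      (ae_of_all _ fun p => by
        obtain ⟨N, hN⟩ := exists_nat_ge (g (limitPair σ t p))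
        refine tendsto_const_nhds.congr' ?_
        filter_upwards [eventually_ge_atTop N] with M hM
        rw [min_eq_left (hN.trans (by exact_mod_cast hM)), sub_self])
    simpa using this
  -- The truncation error is monotone, so that of `F` is at most that of `g`.
  have hsub : ∀ {a b M : ℝ}, a ≤ b → a - min a M ≤ b - min b M := by
    intro a b M hab
    rcases le_total a M with h | h <;> rcases le_total b M with h' | h'
    all_goals simp only [min_eq_left, min_eq_right, h, h']
    all_goals linarith
  have hsub0 : ∀ a M : ℝ, 0 ≤ a - min a M := fun a M => sub_nonneg.2 (min_le_left _ _)
  refine tendstoInMeasure_of_approx fun δ hδ => ?_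
  obtain ⟨M, hM⟩ := ((tendsto_order.1 htail).2 δ hδ).exists
  have hFMc : Continuous fun p => min (F p) (M : ℝ) := hF.min continuous_const
  have hgMc : Continuous fun p => min (g p) (M : ℝ) := hgc.min continuous_const
  have hwll := tendstoInMeasure_weighted_average hτ hc h0 hx hx' (q := fun _ => 1)
    measurable_const (memLp_const 1) hFMc (hmin hF hF0 M (Nat.cast_nonneg M))
  simp only [one_mul, integral_const, probReal_univ, one_smul] at hwll
  have hFl : Integrable (fun p => F (limitPair σ t p)) stdGauss2 :=
    hgl.mono' (hF.measurable.comp hlpm).aestronglyMeasurable (ae_of_all _ fun p => by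
      rw [Real.norm_of_nonneg (hF0 _)]; exact hFB _)
  have hFMl : Integrable (fun p => min (F (limitPair σ t p)) (M : ℝ)) stdGauss2 :=
    hFl.inf (integrable_const _)
  have hgMl : Integrable (fun p => min (g (limitPair σ t p)) (M : ℝ)) stdGauss2 :=
    hgl.inf (integrable_const _)
  refine ⟨_, _, hwll, ?_, ?_⟩
  · rw [abs_sub_comm, ← integral_sub hFl hFMl, abs_of_nonneg (integral_nonneg fun p => hsub0 _ _)]
    exact (integral_mono (hFl.sub hFMl) (hgl.sub hgMl) fun p => hsub (hFB _)).trans hM.le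
  · have hFf : ∀ n j, Integrable (fun ω => F (field c x n j ω, field c x' n j ω)) (initLaw d τ) :=
      fun n j => (hgf n j).mono' (hF.measurable.comp (by fun_prop)).aestronglyMeasurable
        (ae_of_all _ fun ω => by rw [Real.norm_of_nonneg (hF0 _)]; exact hFB _)
    have hFMf : ∀ n j, Integrable (fun ω => min (F (field c x n j ω, field c x' n j ω)) (M : ℝ))
        (initLaw d τ) := fun n j => (hFf n j).inf (integrable_const _)
    have hgMf : ∀ n j, Integrable (fun ω => min (g (field c x n j ω, field c x' n j ω)) (M : ℝ))
        (initLaw d τ) := fun n j => (hgf n j).inf (integrable_const _)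
    -- the tail at finite width converges to the tail of the limit
    have hconv : Tendsto (fun n : ℕ => ∫ ω, (g (field c x n 0 ω, field c x' n 0 ω)
        - min (g (field c x n 0 ω, field c x' n 0 ω)) M) ∂initLaw d τ) atTop
        (𝓝 (∫ p, (g (limitPair σ t p) - min (g (limitPair σ t p)) M) ∂stdGauss2)) := by
      have h1 := tendsto_integral_field hτ hc h0 hx hx' (G := fun w => min (g w.1) M)
        (hgMc.comp continuous_fst) (fun w => hmin hgc hg0 M (Nat.cast_nonneg M) w.1)
      rw [integral_fun_fst (μ := stdGauss2) (ν := stdGauss2)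
        (fun p => min (g (limitPair σ t p)) (M : ℝ)), probReal_univ, one_smul] at h1
      rw [integral_sub hgl hgMl, hgli]
      refine (h1.const_sub (c / d * V + c / d * V + B)).congr' ?_
      filter_upwards [eventually_gt_atTop 0] with n hn
      rw [integral_sub (hgf n 0) (hgMf n 0), hgfi n hn]
    have hev := (tendsto_order.1 hconv).2 δ hM
    have hfst : Tendsto (fun p : ℕ × ℕ => p.1) (atTop ×ˢ atTop : Filter (ℕ × ℕ)) atTop :=
      tendsto_fst
    have hsnd : Tendsto (fun p : ℕ × ℕ => p.2) (atTop ×ˢ atTop : Filter (ℕ × ℕ)) atTop :=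
      tendsto_snd
    filter_upwards [hfst.eventually hev, hsnd.eventually (eventually_gt_atTop 0)] with n hn hn2
    have hn2' : (0 : ℝ) < n.2 := by exact_mod_cast hn2
    have e : ∀ ω, 1 / (n.2 : ℝ) * ∑ j ∈ Finset.range n.2, F (field c x n.1 j ω, field c x' n.1 j ω)
        - 1 / (n.2 : ℝ) * ∑ j ∈ Finset.range n.2, min (F (field c x n.1 j ω, field c x' n.1 j ω)) M
        = 1 / (n.2 : ℝ) * ∑ j ∈ Finset.range n.2, (F (field c x n.1 j ω, field c x' n.1 j ω)
          - min (F (field c x n.1 j ω, field c x' n.1 j ω)) M) := by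
      intro ω; rw [Finset.sum_sub_distrib, mul_sub]
    have hi : Integrable (fun ω => 1 / (n.2 : ℝ) * ∑ j ∈ Finset.range n.2,
        (F (field c x n.1 j ω, field c x' n.1 j ω)
          - min (F (field c x n.1 j ω, field c x' n.1 j ω)) M)) (initLaw d τ) :=
      (integrable_finsetSum _ fun j _ => (hFf n.1 j).sub (hFMf n.1 j)).const_mul _
    have hdi : ∀ j, Integrable (fun ω => F (field c x n.1 j ω, field c x' n.1 j ω)
        - min (F (field c x n.1 j ω, field c x' n.1 j ω)) (M : ℝ)) (initLaw d τ) :=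
      fun j => (hFf n.1 j).sub (hFMf n.1 j)
    simp only [e]
    refine ⟨hi, ?_⟩
    have habs : ∀ ω : InitIdx d → ℝ, |1 / (n.2 : ℝ) * ∑ j ∈ Finset.range n.2,
        (F (field c x n.1 j ω, field c x' n.1 j ω)
          - min (F (field c x n.1 j ω, field c x' n.1 j ω)) M)|
        = 1 / (n.2 : ℝ) * ∑ j ∈ Finset.range n.2,
        (F (field c x n.1 j ω, field c x' n.1 j ω)
          - min (F (field c x n.1 j ω, field c x' n.1 j ω)) M) := fun ω =>
      abs_of_nonneg (mul_nonneg (by positivity) (Finset.sum_nonneg fun j _ => hsub0 _ _))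
    simp only [habs]
    rw [integral_const_mul, integral_finsetSum _ fun j _ => hdi j]
    have hterm : ∀ j ∈ Finset.range n.2, ∫ ω, (F (field c x n.1 j ω, field c x' n.1 j ω)
          - min (F (field c x n.1 j ω, field c x' n.1 j ω)) M) ∂initLaw d τ ≤ δ := by
      intro j _
      refine le_trans (integral_mono ((hFf n.1 j).sub (hFMf n.1 j)) ((hgf n.1 j).sub (hgMf n.1 j))
        fun ω => hsub (hFB _)) (le_trans (le_of_eq ?_) hn.le)
      obtain ⟨π, hπ, hπ0, -⟩ := exists_injective_zero_one (Nat.succ_ne_self j).symm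
      have hpair : Measurable fun ω : InitIdx d → ℝ => (field c x n.1 0 ω, field c x' n.1 0 ω) := by
        fun_prop
      have h5 := integral_comp_relabel (τ := τ) hπ (H := fun ω =>
        g (field c x n.1 0 ω, field c x' n.1 0 ω)
          - min (g (field c x n.1 0 ω, field c x' n.1 0 ω)) M)
        ((hgc.measurable.comp hpair).sub (hgMc.measurable.comp hpair))
      simp only [field_relabel, hπ0] at h5
      exact h5
    calc _ ≤ 1 / (n.2 : ℝ) * ∑ j ∈ Finset.range n.2, δ := by
          gcongr with j hj
          exact hterm j hj
      _ = δ := by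
          rw [Finset.sum_const, Finset.card_range, nsmul_eq_mul]
          field_simp

/-! ### The law of large numbers for the features -/

lemma integral_feature_mul {x x' : EuclideanSpace ℝ (Fin d)} (i : ℕ) :
    ∫ ω, feature x i ω * feature x' i ω ∂initLaw d τ = inner ℝ x x' / d := by
  have h := integral_feature_sq (τ := τ) ((1 : ℝ) • x + (1 : ℝ) • x') i
  have e : ∀ ω : InitIdx d → ℝ, feature ((1 : ℝ) • x + (1 : ℝ) • x') i ω
      * feature ((1 : ℝ) • x + (1 : ℝ) • x') i ω
      = (feature x i ω * feature x i ω + 2 * (feature x i ω * feature x' i ω))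
        + feature x' i ω * feature x' i ω := by
    intro ω; rw [feature_linear]; ring
  have i1 : Integrable (fun ω => feature x i ω * feature x i ω) (initLaw d τ) :=
    (memLp_feature x i).integrable_mul (memLp_feature x i)
  have i2 : Integrable (fun ω => 2 * (feature x i ω * feature x' i ω)) (initLaw d τ) :=
    ((memLp_feature x i).integrable_mul (memLp_feature x' i)).const_mul 2
  have i3 : Integrable (fun ω => feature x' i ω * feature x' i ω) (initLaw d τ) :=
    (memLp_feature x' i).integrable_mul (memLp_feature x' i)
  simp only [e] at h
  rw [integral_add (f := fun ω => feature x i ω * feature x i ω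
    + 2 * (feature x i ω * feature x' i ω)) (i1.add i2) i3, integral_add i1 i2, integral_const_mul,
    integral_feature_sq, integral_feature_sq, one_smul, one_smul, norm_add_sq_real] at h
  rw [add_div, add_div] at h
  linear_combination h / 2

lemma tendstoInMeasure_features (x x' : EuclideanSpace ℝ (Fin d)) :
    TendstoInMeasure (initLaw d τ) (fun (n : ℕ × ℕ) ω => 1 / n.1 * ∑ i ∈ Finset.range n.1,
        feature x i ω * feature x' i ω) (atTop ×ˢ atTop) (fun _ => inner ℝ x x' / d) := by
  have hG : Measurable fun r : Fin d ⊕ ℕ → ℝ => (1 / √d * ∑ k, r (.inl k) * x k)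
    * (1 / √d * ∑ k, r (.inl k) * x' k) := by fun_prop
  have h := strong_law_ae_real (μ := initLaw d τ) (fun i ω => feature x i ω * feature x' i ω)
    ((memLp_feature x 0).integrable_mul (memLp_feature x' 0))
    (fun i j hij => (iIndepFun_rows hG).indepFun hij) (identDistrib_rows hG)
  rw [integral_feature_mul] at h
  have h2 := tendstoInMeasure_of_tendsto_ae (μ := initLaw d τ)
    (f := fun (n : ℕ) ω => (∑ i ∈ Finset.range n, feature x i ω * feature x' i ω) / n)
    (fun n => Measurable.aestronglyMeasurable (by fun_prop)) h
  have hfst : Tendsto (fun p : ℕ × ℕ => p.1) (atTop ×ˢ atTop : Filter (ℕ × ℕ)) atTop := tendsto_fst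
  have h3 := h2.comp hfst
  refine h3.congr_left fun n => ae_of_all _ fun ω => ?_
  simp only [Function.comp_apply]
  ring

end

/-! ### The infinite-width limit of the neural tangent kernel -/

section

variable {d : ℕ} {τ : Measure ℝ} [IsProbabilityMeasure τ] {V c β : ℝ}

/-- The neural tangent kernel at initialization as a function of the array of all weights. -/
def kernelFun (c β ς : ℝ) (x x' : EuclideanSpace ℝ (Fin d)) (n : ℕ × ℕ) (ω : InitIdx d → ℝ) : ℝ :=
  (c * (1 / n.1 * ∑ i ∈ Finset.range n.1, feature x i ω * feature x' i ω) + β ^ 2) *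
    (1 / n.2 * ∑ j ∈ Finset.range n.2, ω (.inr (.inr j)) ^ 2 *
      (quasiActDeriv ς (field c x n.1 j ω) * quasiActDeriv ς (field c x' n.1 j ω)))
    + 1 / n.2 * ∑ j ∈ Finset.range n.2,
      quasiAct ς (field c x n.1 j ω) * quasiAct ς (field c x' n.1 j ω)

lemma measurable_kernelFun {ς : ℝ} (hς : 0 < ς) (x x' : EuclideanSpace ℝ (Fin d)) (n : ℕ × ℕ) :
    Measurable (kernelFun c β ς x x' n) := by
  have h1 : Measurable (quasiAct ς) := (continuous_quasiAct hς).measurable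
  have h2 : Measurable (quasiActDeriv ς) := (continuous_quasiActDeriv ς).measurable
  unfold kernelFun
  fun_prop

lemma ntk_initParams {Ω : Type*} {ς : ℝ} (hς : 0 < ς) (hc : 0 < c) (w₀ : Fin d → ℕ → Ω → ℝ)
    (θ : ℕ → ℕ → Ω → ℝ) (w₂ : ℕ → Ω → ℝ) (n : ℕ × ℕ) (ω : Ω) (x x' : EuclideanSpace ℝ (Fin d)) :
    ntk c β ς (initParams w₀ θ w₂ n.1 n.2 ω) x x' = kernelFun c β ς x x' n fun a =>
      Sum.elim (fun q : Fin d × ℕ => w₀ q.1 q.2)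
        (Sum.elim (fun q : ℕ × ℕ => θ q.1 q.2) (fun j : ℕ => w₂ j)) a ω := by
  rw [ntk_eq hς hc]
  simp only [kernelFun, feature, field, layerOne, preAct, initParams, Finset.sum_range, mul_zero,
    add_zero, Sum.elim_inl, Sum.elim_inr]

lemma tendstoInMeasure_kernelFun (hτ : IsWeightLaw V τ) (hd : 1 ≤ d) (hc : 0 < c) (h0 : 0 < V)
    (h1 : V < 1) {x x' : EuclideanSpace ℝ (Fin d)} (hx : ‖x‖ = 1) (hx' : ‖x'‖ = 1) :
    TendstoInMeasure (initLaw d τ) (kernelFun c β (condStd d c V) x x') (atTop ×ˢ atTop)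
      (fun _ => limitKernel d c β V (inner ℝ x x')) := by
  set ς := condStd d c V with hςdef
  have hς : 0 < ς := condStd_pos hd hc h1
  have ht : |(inner ℝ x x' : ℝ)| ≤ 1 := by
    have := abs_real_inner_le_norm x x'
    rwa [hx, hx', one_mul] at this
  have hψ := continuous_quasiAct hς
  have hψ' := continuous_quasiActDeriv ς
  have hsq : MemLp (fun z : ℝ => z ^ 2) 2 (gaussianReal 0 1) := by
    have h4 : MemLp (fun z : ℝ => z) 4 (gaussianReal 0 1) := memLp_id_gaussianReal' 4 (by simp)
    have : ENNReal.HolderTriple 4 4 2 := ⟨by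
      rw [← two_mul, show (4 : ENNReal) = 2 * 2 by norm_num,
        ENNReal.mul_inv (by simp) (by simp), ← mul_assoc, ENNReal.mul_inv_cancel (by simp) (by simp),
        one_mul]⟩
    simpa only [sq] using h4.mul' h4
  have hB := tendstoInMeasure_weighted_average hτ hc h0 hx hx' (q := fun z => z ^ 2) (by fun_prop)
    hsq (F := fun p => quasiActDeriv ς p.1 * quasiActDeriv ς p.2) (by fun_prop) (M := 1) fun p => by
      rw [abs_of_nonneg (mul_nonneg (quasiActDeriv_nonneg ς _) (quasiActDeriv_nonneg ς _))]
      exact mul_le_one₀ (quasiActDeriv_le_one ς _) (quasiActDeriv_nonneg ς _)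
        (quasiActDeriv_le_one ς _)
  have hsq1 : ∫ z, z ^ 2 ∂gaussianReal 0 1 = 1 := by
    simpa only [sq] using integral_sq_gaussianReal
  simp only [limitPair] at hB
  rw [hsq1, one_mul, integral_quasiActDeriv_mul hd hc h0 h1 ht] at hB
  -- `ψ ψ' ≤ (ψ² + ψ'²) / 2` and `ψ(ν)² ≤ (|ν| + ς)² ≤ 2 ν² + 2 ς²`.
  have hD := tendstoInMeasure_average_of_le_sq hτ hc h0 hx hx'
    (F := fun p => quasiAct ς p.1 * quasiAct ς p.2) (by fun_prop)
    (fun p => mul_nonneg (quasiAct_nonneg hς _) (quasiAct_nonneg hς _)) (B := 2 * ς ^ 2)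
    (by positivity) fun p => by
      have hb : ∀ ν : ℝ, quasiAct ς ν ^ 2 ≤ 2 * ν ^ 2 + 2 * ς ^ 2 := fun ν => by
        have h := abs_quasiAct_le hς ν
        have h2 : quasiAct ς ν ^ 2 ≤ (|ν| + ς) ^ 2 := by
          rw [← sq_abs]; exact pow_le_pow_left₀ (abs_nonneg _) h 2
        nlinarith [sq_nonneg (|ν| - ς), sq_abs ν]
      nlinarith [hb p.1, hb p.2, sq_nonneg (quasiAct ς p.1 - quasiAct ς p.2)]
  simp only [limitPair] at hD
  rw [integral_quasiAct_mul hd hc h0 h1 ht] at hD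
  have h := tendstoInMeasure_continuous₃ (φ := fun a b e => (c * a + β ^ 2) * b + e)
    (tendstoInMeasure_features (τ := τ) x x') hB hD (by fun_prop)
  rw [limitKernel, mul_div_assoc]
  exact h

end

section

variable {Ω : Type*} [MeasurableSpace Ω] {P : Measure Ω} {d : ℕ}
  {V c β : ℝ} {w₀ : Fin d → ℕ → Ω → ℝ} {θ : ℕ → ℕ → Ω → ℝ} {w₂ : ℕ → Ω → ℝ}

lemma IsRandomInit.aemeasurable (h : IsRandomInit P V w₀ θ w₂) (a : InitIdx d) :
    AEMeasurable (Sum.elim (fun q : Fin d × ℕ => w₀ q.1 q.2)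
      (Sum.elim (fun q : ℕ × ℕ => θ q.1 q.2) (fun j : ℕ => w₂ j)) a) P := by
  rcases a with a | a | a
  · exact (h.w₀_law a.1 a.2).aemeasurable
  · exact (h.θ_ident a.1 a.2).aemeasurable_fst
  · exact (h.w₂_law a).aemeasurable

lemma IsRandomInit.isWeightLaw (h : IsRandomInit P V w₀ θ w₂) :
    IsWeightLaw V (P.map (θ 0 0)) := by
  have hm : AEMeasurable (θ 0 0) P := (h.θ_ident 0 0).aemeasurable_fst
  refine ⟨?_, ?_, ?_⟩
  · rw [ae_map_iff hm (measurableSet_le (by fun_prop : Measurable fun x : ℝ => |x|) measurable_const)]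
    filter_upwards [h.θ_mem 0 0] with ω hω using abs_le.2 hω
  · rw [integral_map hm (by fun_prop)]
    exact h.θ_mean 0 0
  · rw [integral_map hm (by fun_prop), ← h.θ_var 0 0,
      variance_of_integral_eq_zero hm (h.θ_mean 0 0)]
    simp only [sq]

/-- The joint law of the initial weights is that of the canonical model. -/
lemma IsRandomInit.map_eq (h : IsRandomInit P V w₀ θ w₂) [IsProbabilityMeasure (P.map (θ 0 0))] :
    P.map (fun ω a => Sum.elim (fun q : Fin d × ℕ => w₀ q.1 q.2)
      (Sum.elim (fun q : ℕ × ℕ => θ q.1 q.2) (fun j : ℕ => w₂ j)) a ω)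
      = initLaw d (P.map (θ 0 0)) := by
  rw [h.indep.map_fun_eq_infinitePi_map₀' h.aemeasurable]
  congr 1
  funext a
  rcases a with a | a | a
  · exact (h.w₀_law a.1 a.2).map_eq
  · exact (h.θ_ident a.1 a.2).map_eq
  · exact (h.w₂_law a).map_eq

/-- The neural tangent kernel at random initialization converges in probability. -/
lemma IsRandomInit.tendstoInMeasure_ntk [IsProbabilityMeasure P]
    (h : IsRandomInit P V w₀ θ w₂) (hd : 1 ≤ d) (hc : 0 < c) (h0 : 0 < V) (h1 : V < 1) (x x' : Sph d) :
    TendstoInMeasure P (fun (n : ℕ × ℕ) ω =>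
        ntk c β (condStd d c V) (initParams w₀ θ w₂ n.1 n.2 ω) x.1 x'.1)
      (atTop ×ˢ atTop) (fun _ => limitKernel d c β V (inner ℝ x.1 x'.1)) := by
  have := Measure.isProbabilityMeasure_map (h.θ_ident 0 0).aemeasurable_fst
  have hς : 0 < condStd d c V := condStd_pos hd hc h1
  have hn : ∀ x : Sph d, ‖x.1‖ = 1 := fun x => by simp
  simp only [ntk_initParams hς hc]
  refine tendstoInMeasure_comp_of_map (aemeasurable_pi_iff.2 h.aemeasurable)
    (measurable_kernelFun hς x.1 x'.1) ?_
  rw [h.map_eq]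
  exact tendstoInMeasure_kernelFun h.isWeightLaw hd hc h0 h1 (hn x) (hn x')

end

end QuasiNN

end

theorem mainTheorem1 (V : ℝ) (hV₀ : 0 < V) (hV₁ : V < 1) :
    ∃ C : ℝ, 1 < C ∧ ∀ d : ℕ, 2 ≤ d → ∃ K : ℕ, ∀ c β : ℝ, 0 < c →
      ∃ (κ : QuasiNN.Sph d → QuasiNN.Sph d → ℝ) (u : ℕ → ℝ),
        -- `κ` is the infinite-width limit of the neural tangent kernel at initialization
        (∀ (Ω : Type*) [MeasurableSpace Ω] (P : Measure Ω) [IsProbabilityMeasure P]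
            (w₀ : Fin d → ℕ → Ω → ℝ) (θ : ℕ → ℕ → Ω → ℝ) (w₂ : ℕ → Ω → ℝ),
            QuasiNN.IsRandomInit P V w₀ θ w₂ → ∀ x x' : QuasiNN.Sph d,
              TendstoInMeasure P
                (fun (n : ℕ × ℕ) (ω : Ω) =>
                  QuasiNN.ntk c β (QuasiNN.condStd d c V)
                    (QuasiNN.initParams w₀ θ w₂ n.1 n.2 ω) x.1 x'.1)
                (atTop ×ˢ atTop) (fun _ => κ x x')) ∧
        -- Mercer decomposition of `κ` in spherical harmonics
        (∀ k, 0 ≤ u k) ∧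
        (∀ Y : (k : ℕ) → Fin (QuasiNN.numHarmonics d k) → QuasiNN.Sph d → ℝ,
            QuasiNN.IsHarmonicBasis d Y → ∀ x x' : QuasiNN.Sph d,
              HasSum (fun k : ℕ => u k * ∑ j, Y k j x * Y k j x') (κ x x')) ∧
        -- decay of the eigenvalues, up to powers of `k`
        (∃ a₁ p₁ a₂ p₂ : ℝ, 0 < a₁ ∧ 0 < a₂ ∧ ∀ k : ℕ, K ≤ k →
            (β ≠ 0 → a₁ * (k : ℝ) ^ p₁ * C ^ (-(k : ℤ)) ≤ u k) ∧
              u k ≤ a₂ * (k : ℝ) ^ p₂ * C ^ (-(k : ℤ))) := by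
  obtain ⟨K, hK1, hK⟩ := QuasiNN.exists_le_zonalEigenvalue hV₀ hV₁
  have hρ := QuasiNN.decayRate_pos hV₀
  have hC : ∀ k : ℕ, (QuasiNN.decayRate V)⁻¹ ^ (-(k : ℤ)) = QuasiNN.decayRate V ^ k := fun k => by
    rw [zpow_neg, inv_zpow, inv_inv, zpow_natCast]
  refine ⟨(QuasiNN.decayRate V)⁻¹, (one_lt_inv₀ hρ).2 (QuasiNN.decayRate_lt_one hV₀ hV₁),
    fun d hd => ⟨K, fun c β hc => ?_⟩⟩
  obtain ⟨A, hA, hlow⟩ := hK d hd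
  have hd1 : 1 ≤ d := by omega
  have hd0 : (0 : ℝ) < d := by exact_mod_cast hd1
  have hg := QuasiNN.limitCoeff_nonneg (d := d) (β := β) hc hV₀
  have hs := QuasiNN.summable_limitCoeff (d := d) (β := β) hc hV₀ hV₁
  have hS0 := QuasiNN.pathSum_zero_pos (x := V / 2) (by positivity) (by linarith)
  have hB : 0 < β ^ 2 + c / d / V + c / d := by positivity
  have hb : 0 ≤ min (β ^ 2) (c / d) / (2 * Real.pi) :=
    div_nonneg (le_min (sq_nonneg β) (by positivity)) (by positivity)
  refine ⟨fun x x' => QuasiNN.limitKernel d c β V (inner ℝ x.1 x'.1),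
    QuasiNN.zonalEigenvalue d (QuasiNN.limitCoeff d c β V),
    fun Ω _ P _ w₀ θ w₂ h x x' => h.tendstoInMeasure_ntk hd1 hc hV₀ hV₁ x x',
    QuasiNN.zonalEigenvalue_nonneg hd hg, fun Y hY x x' => ?_, ?_⟩
  · have ht : |(inner ℝ x.1 x'.1 : ℝ)| ≤ 1 := by
      have hn : ∀ x : QuasiNN.Sph d, ‖x.1‖ = 1 := fun x => by simp
      have := abs_real_inner_le_norm x.1 x'.1
      rwa [hn, hn, one_mul] at this
    have h := hY.hasSum_zonal hd hg hs x x'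
    rwa [(QuasiNN.hasSum_limitCoeff hV₀ hV₁ ht).tsum_eq] at h
  · -- For `β = 0` the lower bound is void and the value of `a₁` is immaterial.
    refine ⟨if β = 0 then 1 else min (β ^ 2) (c / d) / (2 * Real.pi) * A, -((d + 2 : ℕ) : ℝ),
      (β ^ 2 + c / d / V + c / d) * QuasiNN.pathSum (V / 2) 0, 0, ?_, by positivity, fun k hk => ?_⟩
    · split_ifs with hβ
      · exact one_pos
      · have : 0 < min (β ^ 2) (c / d) := lt_min (by positivity) (by positivity)
        positivity
    rw [hC]
    refine ⟨fun hβ => ?_, ?_⟩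
    · rw [if_neg hβ, Real.rpow_neg (Nat.cast_nonneg k), Real.rpow_natCast, ← div_eq_mul_inv]
      exact hlow _ _ hg hs hb (QuasiNN.le_limitCoeff hc hV₀ hV₁) k hk
    · rw [Real.rpow_zero, mul_one]
      exact QuasiNN.zonalEigenvalue_le hd hV₀ hV₁ hg hB.le (QuasiNN.limitCoeff_le hc hV₀) k
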